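/- **Setting.** Let $p\ge 1$, $n\ge 0$, let $X\in\mathbb R^{n\times p}$ have rows $x_1^T,\dots,x_n^T$, let $y\in\{0,1\}^n$, $v\in\mathbb R^p$, and let $Q\in\mathbb R^{p\times p}$ be symmetric and either positive definite or zero. Write $\Phi,\phi$ for the standard normal cdf and density, and let $$\pi(\beta)\propto \prod_{i=1}^n\Phi(x_i^T\beta)^{y_i}(1-\Phi(x_i^T\beta))^{1-y_i}\exp\{-\tfrac12(\beta-v)^TQ(\beta-v)\},\qquad \beta\in\mathbb R^p,$$ be the posterior density of the Bayesian probit model. Assume the posterior is proper, i.e. the right-hand side is integrable, and let $\Pi$ be the probability measure with density $\pi$. Let $\Sigma=X^TX+Q$ (which is then positive definite), $\|\beta\|=(\beta^T\Sigma\beta)^{1/2}$, $\psi(\beta,\beta')=\|\beta-\beta'\|$, and let $\psi_2$ be the Euclidean distance. Let $W_\psi(\mu,\nu)$ be the infimum of $\int\psi\,d\upsilon$ over all couplings $\upsilon$ of $\mu$ and $\nu$, and likewise $W_{\psi_2}$. Let $\mathrm{TN}(\mu,1;a)$ be the $\mathrm N(\mu,1)$ distribution truncated to $(0,\infty)$ if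 $a=1$ and to $(-\infty,0)$ if $a=0$, and let $H(\cdot,\mu,a)$ be its inverse cdf. The Albert and Chib (A&C) chain moves from $\beta$ to $\tilde\beta$ by drawing independent $Z_i\sim \mathrm{TN}(x_i^T\beta,1;y_i)$ and then $\tilde\beta\sim\mathrm N(\Sigma^{-1}(X^TZ+Qv),\Sigma^{-1})$; $K^m_\beta$ is the law of the chain after $m$ steps from $\beta$. Let $\hat\beta$ be the (unique) mode of $\pi$, and $V(\beta)=\|\beta-\hat\beta\|^2/p$. Let $\Lambda(\beta)$ be the diagonal matrix whose $i$th diagonal entry is, with $t=x_i^T\beta$, $1-\frac{t\phi(t)}{\Phi(t)}-\left(\frac{\phi(t)}{\Phi(t)}\right)^2$ if $y_i=1$ and $1+\frac{t\phi(t)}{1-\Phi(t)}-\left(\frac{\phi(t)}{1-\Phi(t)}\right)^2$ if $y_i=0$, and let $$\lambda=\sup_{t\in(0,1)}\ \sup_{\alpha\in\mathbb R^p\setminus\{0\}}\frac{\|\Sigma^{-1}X^T\Lambda(\hat\beta+t\alpha)X\alpha\|^2}{\|\alpha\|^2}.$$ Let $U$ be a vector of $n$ independent $\mathrm{Uniform}(0,1)$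 variables, and let $S(\beta,U)$ be the diagonal matrix whose $i$th diagonal entry is $\partial H(U_i,\mu,y_i)/\partial\mu$ at $\mu=x_i^T\beta$. **Proposition.** The A&C chain converges geometrically in $W_\psi$, and also in $W_{\psi_2}$: for each of these distances, say $W$, there are $\rho\in[0,1)$ and $M:\mathbb R^p\to[0,\infty)$ with $W(K^m_\beta,\Pi)\le M(\beta)\rho^m$ for all $\beta\in\mathbb R^p$ and $m\ge0$. More specifically, the mode $\hat\beta$ exists and is unique, $\lambda<1$, and for every $d>4/(1-\lambda)$, $$\gamma=\sup_{\{\beta:\ \|\beta-\hat\beta\|^2\le pd\}}\mathbb E\,\lambda_{\max}\!\left(\Sigma^{-1/2}X^TS(\beta,U)X\Sigma^{-1/2}\right)<1,$$ and for every $a$ with $\frac{\log5}{\log5-\log\gamma}<a<1$ (read as $0<a<1$ if $\gamma=0$), $$\rho_a=\left(5^{1-a}\gamma^a\right)\vee\left(\frac{\lambda d+5}{d+1}\right)^{1-a}<1,$$ and, for all $\beta\in\mathbb R^p$ and $m\ge0$, $$W_\psi(K^m_\beta,\Pi)\le c(\beta)\,\rho_a^m,\qquad c(\beta)=2p\left(\frac{(\lambda+1)V(\beta)+3}{1-\rho_a}\right).$$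 -/

import Mathlib

open MeasureTheory ProbabilityTheory Set Matrix
open scoped ENNReal NNReal MatrixOrder

noncomputable section

/-! ## General notions -/

/-- Couplings of two measures: measures on the product space with the given marginals. -/
def couplings {E : Type*} [MeasurableSpace E] (μ ν : Measure E) : Set (Measure (E × E)) :=
  {υ | υ.map Prod.fst = μ ∧ υ.map Prod.snd = ν}

/-- The Wasserstein distance of two probability measures induced by a distance function `ψ`
(with values in `[0, ∞]`). -/
def wasserstein {E : Type*} [MeasurableSpace E] (ψ : E → E → ℝ) (μ ν : Measure E) : ℝ≥0∞ :=
  ⨅ υ ∈ couplings μ ν, ∫⁻ z, ENNReal.ofReal (ψ z.1 z.2) ∂υ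

/-- The `m`-step transition kernel of a Markov kernel:
`K ^ 0 (x, A) = 1_A(x)` and `K ^ (m+1) (x, A) = ∫ K (y, A) K ^ m (x, dy)`. -/
def kernelIter {E : Type*} [MeasurableSpace E] (K : Kernel E E) : ℕ → Kernel E E
  | 0 => Kernel.id
  | m + 1 => K ∘ₖ kernelIter K m

/-- The chain with kernel `K` converges geometrically to `π` in the distance `D`. -/
def ConvergesGeometrically {E : Type*} [MeasurableSpace E]
    (D : Measure E → Measure E → ℝ≥0∞) (K : Kernel E E) (π : Measure E) : Prop :=
  ∃ ρ : ℝ, 0 ≤ ρ ∧ ρ < 1 ∧ ∃ M : E → ℝ≥0, ∀ (m : ℕ) (x : E),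
    D (kernelIter K m x) π ≤ ENNReal.ofReal ((M x : ℝ) * ρ ^ m)

/-- The quantile function (inverse cdf) of a probability measure on `ℝ`, for levels in `(0,1)`. -/
def quantile (ν : Measure ℝ) (u : ℝ) : ℝ := sInf {z | u ≤ cdf ν z}

/-- The largest eigenvalue of a real symmetric matrix. -/
def lambdaMax {p : ℕ} (M : Matrix (Fin p) (Fin p) ℝ) : ℝ := sSup (spectrum ℝ M)

/-- The standard normal cumulative distribution function. -/
def stdPhi (x : ℝ) : ℝ := cdf (gaussianReal 0 1) x

/-- The standard normal density. -/
def stdphi (x : ℝ) : ℝ := gaussianPDFReal 0 1 x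

/-- The half-line on which a latent variable lives: `(0, ∞)` for response `1` (`true`) and
`(-∞, 0)` for response `0` (`false`). -/
def truncSet (a : Bool) : Set ℝ := if a then Ioi 0 else Iio 0

/-- The truncated normal distribution `TN(μ, 1; a)`. -/
def truncNormal (μ : ℝ) (a : Bool) : Measure ℝ := (gaussianReal μ 1)[|truncSet a]

/-- `H(u, μ, a)`: the inverse cdf of `TN(μ, 1; a)`. -/
def quantileTN (u μ : ℝ) (a : Bool) : ℝ := quantile (truncNormal μ a) u

/-- The law of a vector of `n` independent `Uniform(0,1)` variables. -/
def unifLaw (n : ℕ) : Measure (Fin n → ℝ) := Measure.pi fun _ => volume.restrict (Ioo (0 : ℝ) 1)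

lemma truncSet_measurable (a : Bool) : MeasurableSet (truncSet a) := by
  unfold truncSet; split_ifs <;> measurability

lemma truncSet_pos (μ : ℝ) (a : Bool) : gaussianReal μ 1 (truncSet a) ≠ 0 := by
  intro h
  have h2 := (gaussianReal_absolutelyContinuous' μ (v := 1) one_ne_zero) h
  unfold truncSet at h2
  split_ifs at h2 <;> simp at h2

instance (μ : ℝ) (a : Bool) : IsProbabilityMeasure (truncNormal μ a) :=
  cond_isProbabilityMeasure (truncSet_pos μ a)

lemma truncNormal_measurable (a : Bool) : Measurable fun μ => truncNormal μ a := by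
  refine Measure.measurable_of_measurable_coe _ fun s hs => ?_
  have key : ∀ t : Set ℝ, MeasurableSet t → Measurable fun μ : ℝ => gaussianReal μ 1 t := by
    intro t ht
    have h : Measurable fun μ : ℝ => gaussianReal μ 1 :=
      measurable_gaussianReal.comp (measurable_id.prodMk measurable_const)
    exact (Measure.measurable_coe ht).comp h
  simp only [truncNormal, cond_apply (truncSet_measurable a)]
  exact (key _ (truncSet_measurable a)).inv.mul (key _ ((truncSet_measurable a).inter hs))

/-! ## The Bayesian probit model and the Albert-Chib chain -/

/-- The data of a Bayesian probit regression with `n` observations and `p` regressors: the design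
matrix `X`, the binary responses `y` (`true` is `1`, `false` is `0`), and the parameters `v`, `Q`
of the prior density, which is proportional to `exp (-(β - v)ᵀ Q (β - v) / 2)`. -/
structure ProbitModel (n p : ℕ) where
  X : Matrix (Fin n) (Fin p) ℝ
  y : Fin n → Bool
  v : EuclideanSpace ℝ (Fin p)
  Q : Matrix (Fin p) (Fin p) ℝ

namespace ProbitModel

variable {n p : ℕ} (D : ProbitModel n p)

/-- The linear predictor `xᵢᵀ β`. -/
def lin (i : Fin n) (β : EuclideanSpace ℝ (Fin p)) : ℝ := (D.X *ᵥ β.ofLp) i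

/-- The unnormalized prior density. -/
def prior (β : EuclideanSpace ℝ (Fin p)) : ℝ :=
  Real.exp (-(1 / 2) * ((β - D.v).ofLp ⬝ᵥ (D.Q *ᵥ (β - D.v).ofLp)))

/-- The unnormalized posterior density. -/
def postDensity (β : EuclideanSpace ℝ (Fin p)) : ℝ :=
  (∏ i, if D.y i then stdPhi (D.lin i β) else 1 - stdPhi (D.lin i β)) * D.prior β

/-- The posterior is proper: the unnormalized posterior density has a finite integral. -/
def Proper : Prop := Integrable D.postDensity volume

/-- The posterior distribution (for a proper posterior, a probability measure). -/
def posterior : Measure (EuclideanSpace ℝ (Fin p)) :=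
  (∫⁻ β, ENNReal.ofReal (D.postDensity β))⁻¹ •
    volume.withDensity fun β => ENNReal.ofReal (D.postDensity β)

/-- `Σ = Xᵀ X + Q`. -/
def Sig : Matrix (Fin p) (Fin p) ℝ := D.Xᵀ * D.X + D.Q

/-- `Σ ^ (-1/2)`. -/
def SigInvSqrt : Matrix (Fin p) (Fin p) ℝ := (CFC.sqrt D.Sig)⁻¹

/-- The norm `‖β‖ = (βᵀ Σ β) ^ (1/2)`. -/
def sigNorm (β : EuclideanSpace ℝ (Fin p)) : ℝ := Real.sqrt (β.ofLp ⬝ᵥ (D.Sig *ᵥ β.ofLp))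

/-- The distance `ψ` induced by the norm `(βᵀ Σ β) ^ (1/2)`. -/
def psi (β β' : EuclideanSpace ℝ (Fin p)) : ℝ := D.sigNorm (β - β')

/-- The law of the latent vector `Z`, with independent coordinates
`Zᵢ ∼ TN(xᵢᵀ β, 1; yᵢ)`. -/
def latentLaw (β : EuclideanSpace ℝ (Fin p)) : Measure (Fin n → ℝ) :=
  Measure.pi fun i => truncNormal (D.lin i β) (D.y i)

/-- The mean `Σ⁻¹ (Xᵀ z + Q v)` of the Gaussian step. -/
def condMean (z : Fin n → ℝ) : EuclideanSpace ℝ (Fin p) :=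
  WithLp.toLp 2 (D.Sig⁻¹ *ᵥ (D.Xᵀ *ᵥ z + D.Q *ᵥ D.v.ofLp))

lemma lin_measurable (i : Fin n) : Measurable (D.lin i) := by
  unfold lin mulVec dotProduct
  fun_prop

instance (β : EuclideanSpace ℝ (Fin p)) : IsProbabilityMeasure (D.latentLaw β) := by
  unfold latentLaw; infer_instance

lemma latentLaw_measurable : Measurable D.latentLaw := by
  refine Measurable.measure_of_isPiSystem_of_isProbabilityMeasure (S := Set.pi univ ''
    Set.pi univ fun _ : Fin n => {s : Set ℝ | MeasurableSet s}) generateFrom_pi.symm isPiSystem_pi ?_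
  rintro _ ⟨s, hs, rfl⟩
  simp only [latentLaw, Measure.pi_pi]
  refine Finset.measurable_prod _ fun i _ => ?_
  have hsi : MeasurableSet (s i) := hs i (mem_univ i)
  exact (Measure.measurable_coe hsi).comp
    ((truncNormal_measurable (D.y i)).comp (D.lin_measurable i))

lemma gaussStep_measurable :
    Measurable fun z : Fin n → ℝ => multivariateGaussian (D.condMean z) D.Sig⁻¹ := by
  have hm : Measurable D.condMean := by
    unfold condMean mulVec dotProduct
    fun_prop
  refine Measure.measurable_of_measurable_coe _ fun s hs => ?_
  have hg : Measurable fun x : EuclideanSpace ℝ (Fin p) =>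
      (toEuclideanCLM (𝕜 := ℝ) (CFC.sqrt D.Sig⁻¹)) x := ContinuousLinearMap.measurable _
  have hpre : MeasurableSet {q : (Fin n → ℝ) × EuclideanSpace ℝ (Fin p) |
      D.condMean q.1 + (toEuclideanCLM (𝕜 := ℝ) (CFC.sqrt D.Sig⁻¹)) q.2 ∈ s} :=
    ((hm.comp measurable_fst).add (hg.comp measurable_snd)) hs
  have h1 := measurable_measure_prodMk_left (ν := stdGaussian (EuclideanSpace ℝ (Fin p))) hpre
  have h2 : (fun z : Fin n → ℝ => multivariateGaussian (D.condMean z) D.Sig⁻¹ s) =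
      fun z => stdGaussian (EuclideanSpace ℝ (Fin p)) (Prod.mk z ⁻¹'
        {q : (Fin n → ℝ) × EuclideanSpace ℝ (Fin p) |
          D.condMean q.1 + (toEuclideanCLM (𝕜 := ℝ) (CFC.sqrt D.Sig⁻¹)) q.2 ∈ s}) := by
    funext z
    rw [multivariateGaussian, Measure.map_apply (hg.const_add _) hs]
    rfl
  rw [h2]
  exact h1

/-- The transition kernel of the Albert-Chib chain: given `β`, draw `Z` from `latentLaw β`, then
draw the new state from `N(Σ⁻¹ (Xᵀ Z + Q v), Σ⁻¹)`. -/
def acKernel : Kernel (EuclideanSpace ℝ (Fin p)) (EuclideanSpace ℝ (Fin p)) :=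
  (⟨fun z => multivariateGaussian (D.condMean z) D.Sig⁻¹, D.gaussStep_measurable⟩ :
      Kernel (Fin n → ℝ) (EuclideanSpace ℝ (Fin p))) ∘ₖ
    (⟨D.latentLaw, D.latentLaw_measurable⟩ : Kernel (EuclideanSpace ℝ (Fin p)) (Fin n → ℝ))

/-- The drift function `V(β) = ‖β - β̂‖² / p`. -/
def driftV (βhat β : EuclideanSpace ℝ (Fin p)) : ℝ := D.sigNorm (β - βhat) ^ 2 / p

/-- The diagonal matrix `Λ(β)`. -/
def Lam (β : EuclideanSpace ℝ (Fin p)) : Matrix (Fin n) (Fin n) ℝ :=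
  Matrix.diagonal fun i =>
    let t := D.lin i β
    if D.y i then 1 - (t * stdphi t / stdPhi t + (stdphi t / stdPhi t) ^ 2)
    else 1 - (-(t * stdphi t) / (1 - stdPhi t) + (stdphi t / (1 - stdPhi t)) ^ 2)

/-- The values `‖Σ⁻¹ Xᵀ Λ(β̂ + t α) X α‖² / ‖α‖²`, with `t ∈ (0,1)` and `α ≠ 0`. -/
def driftRatios (βhat : EuclideanSpace ℝ (Fin p)) : Set ℝ :=
  {r | ∃ t ∈ Ioo (0 : ℝ) 1, ∃ α : EuclideanSpace ℝ (Fin p), α ≠ 0 ∧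
    r = D.sigNorm (WithLp.toLp 2
        ((D.Sig⁻¹ * D.Xᵀ * D.Lam (βhat + t • α) * D.X) *ᵥ α.ofLp)) ^ 2 / D.sigNorm α ^ 2}

/-- The drift constant `λ`. -/
def driftConst (βhat : EuclideanSpace ℝ (Fin p)) : ℝ := sSup (D.driftRatios βhat)

/-- The diagonal matrix `S(β, u)`, with entries `∂H(uᵢ, μ, yᵢ)/∂μ` at `μ = xᵢᵀ β`. -/
def S (β : EuclideanSpace ℝ (Fin p)) (u : Fin n → ℝ) : Matrix (Fin n) (Fin n) ℝ :=
  Matrix.diagonal fun i => deriv (fun μ => quantileTN (u i) μ (D.y i)) (D.lin i β)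

/-- `λ_max (Σ^(-1/2) Xᵀ S(β, u) X Σ^(-1/2))`. -/
def localLip (β : EuclideanSpace ℝ (Fin p)) (u : Fin n → ℝ) : ℝ :=
  lambdaMax (D.SigInvSqrt * D.Xᵀ * D.S β u * D.X * D.SigInvSqrt)

/-- The expectation `E λ_max (Σ^(-1/2) Xᵀ S(β, U) X Σ^(-1/2))`. -/
def meanLip (β : EuclideanSpace ℝ (Fin p)) : ℝ := ∫ u, D.localLip β u ∂(unifLaw n)

/-- The sublevel set `{β | V(β) ≤ d}` of the drift function, i.e. the ball
`‖β - β̂‖² ≤ p d`. -/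
def smallBall (βhat : EuclideanSpace ℝ (Fin p)) (d : ℝ) : Set (EuclideanSpace ℝ (Fin p)) :=
  {β | D.driftV βhat β ≤ d}

/-- `γ`, the supremum of `E λ_max (Σ^(-1/2) Xᵀ S(β, U) X Σ^(-1/2))` over the ball. -/
def contractConst (βhat : EuclideanSpace ℝ (Fin p)) (d : ℝ) : ℝ :=
  sSup (D.meanLip '' D.smallBall βhat d)

/-- `ρ_a = (5^(1-a) γ^a) ∨ ((λ d + 5) / (d + 1))^(1-a)`. -/
def rate (βhat : EuclideanSpace ℝ (Fin p)) (d a : ℝ) : ℝ :=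
  max ((5 : ℝ) ^ (1 - a) * D.contractConst βhat d ^ a)
    (((D.driftConst βhat * d + 5) / (d + 1)) ^ (1 - a))

/-- `c(β) = 2 p ((λ + 1) V(β) + 3) / (1 - ρ_a)`. -/
def startConst (βhat : EuclideanSpace ℝ (Fin p)) (d a : ℝ) (β : EuclideanSpace ℝ (Fin p)) : ℝ :=
  2 * p * (((D.driftConst βhat + 1) * D.driftV βhat β + 3) / (1 - D.rate βhat d a))

end ProbitModel

end

noncomputable section

/-! ## The standard normal density and distribution function -/

/-! The chain is an iterated random map: one step sends β to `condMean (latent u β) + gaussMap x`,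
with u uniform and x standard Gaussian (`acKernel_eq_map`). Two copies driven by the same (u, x) are
coupled, and the additive Gaussian part cancels in their difference. Two estimates on this map are
then combined.

Contraction. The Jacobian in β is Σ⁻¹XᵀSX, where S holds the derivatives of truncated normal
quantiles in the location. Each is 1 minus a quotient of two values of φ/Φ, and lies in [0, 1]
because φ/Φ decreases. As XᵀX ≤ Σ, the map never expands ‖·‖. The entries stay uniformly below 1
when the linear predictors are bounded and u lies in the cube [1/4, 3/4]ⁿ, an event of probability
2⁻ⁿ; hence γ < 1 on every ball (`exists_meanLip_le`, `lintegral_psi_acStep_le`).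

Drift. The mean of the next state is `meanMap β`, and the gradient of the log-posterior for the Σ
inner product is `meanMap β - β`, so the mode is a fixed point of `meanMap`. The derivative of
`meanMap` is Σ⁻¹XᵀΛX, where Λ holds truncated variances, all below 1. They are uniformly below 1
except for predictors far on the side of their response; propriety excludes a direction that is free
of decay in both the prior and all predictors, and compactness of the sphere turns this into λ < 1
(`exists_sigNorm_meanMapDeriv_le`). So `meanMap` pulls towards the mode by the factor √λ. The
Gaussian noise and the latent noise each add at most p to the expected squared norm, whence the
drift bound λV + 2 (`lintegral_driftV_acStep_le`).

Combination. Let w = V(x) + V(y) + 1 and apply Hölder to ψ^a w^(1-a) (`wasserstein_kernelIter_le`).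
If V(x) + V(y) ≤ d, then in mean ψ shrinks by γ and w grows by at most 5 = 2·2 + 1. Otherwise ψ does
not grow in mean and w is multiplied by at most (λd + 5)/(d + 1), which is below 1 because d > 4/(1
- λ). The posterior is invariant, since the joint density of (β, z) can be integrated in either
order (`posterior_bind_acKernel`), and the drift bounds its mean of V by 2/(1 - λ). The Euclidean
distance is dominated by a multiple of ψ. -/

lemma stdphi_eq (x : ℝ) : stdphi x = (√(2 * Real.pi))⁻¹ * Real.exp (-x ^ 2 / 2) := by
  simp [stdphi, gaussianPDFReal]

lemma stdphi_pos (x : ℝ) : 0 < stdphi x := gaussianPDFReal_pos 0 1 x one_ne_zero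

lemma stdphi_neg (x : ℝ) : stdphi (-x) = stdphi x := by simp [stdphi_eq]

lemma gaussianPDFReal_eq_stdphi (μ z : ℝ) : gaussianPDFReal μ 1 z = stdphi (z - μ) := by
  simp [stdphi, gaussianPDFReal]

lemma hasDerivAt_stdphi (x : ℝ) : HasDerivAt stdphi (-x * stdphi x) x := by
  have h : HasDerivAt (fun x : ℝ => (√(2 * Real.pi))⁻¹ * Real.exp (-x ^ 2 / 2))
      ((√(2 * Real.pi))⁻¹ * (Real.exp (-x ^ 2 / 2) * (-(2 * x) / 2))) x := by
    have h1 : HasDerivAt (fun x : ℝ => -x ^ 2 / 2) (-(2 * x) / 2) x := by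
      simpa using ((hasDerivAt_pow 2 x).neg.div_const 2)
    exact (h1.exp).const_mul _
  rw [show stdphi = _ from funext stdphi_eq]
  exact h.congr_deriv (by ring)

lemma continuous_stdphi : Continuous stdphi :=
  continuous_iff_continuousAt.2 fun x => (hasDerivAt_stdphi x).continuousAt

lemma gaussianReal_real_Iic (μ z : ℝ) : (gaussianReal μ 1).real (Iic z) = stdPhi (z - μ) := by
  have h : gaussianReal μ 1 = (gaussianReal 0 1).map (· + μ) := by
    rw [gaussianReal_map_add_const]; simp
  rw [stdPhi, cdf_eq_real, h, map_measureReal_apply (by fun_prop) measurableSet_Iic]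
  congr 1
  ext x
  simp [le_sub_iff_add_le]

lemma stdPhi_eq_integral (x : ℝ) : stdPhi x = ∫ y in Iic x, stdphi y := by
  rw [stdPhi, cdf_eq_real, measureReal_def, gaussianReal_apply_eq_integral _ one_ne_zero,
    ENNReal.toReal_ofReal (integral_nonneg fun y => gaussianPDFReal_nonneg _ _ _)]
  rfl

lemma integrable_stdphi : Integrable stdphi := integrable_gaussianPDFReal 0 1

lemma hasDerivAt_stdPhi (x : ℝ) : HasDerivAt stdPhi (stdphi x) x := by
  have h : ∀ y, stdPhi y = stdPhi 0 + ∫ t in (0 : ℝ)..y, stdphi t := by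
    intro y
    rw [stdPhi_eq_integral, stdPhi_eq_integral,
      ← intervalIntegral.integral_Iic_sub_Iic integrable_stdphi.integrableOn
        integrable_stdphi.integrableOn]
    ring
  rw [show stdPhi = _ from funext h]
  exact (intervalIntegral.integral_hasDerivAt_right
    (continuous_stdphi.intervalIntegrable _ _)
    (continuous_stdphi.stronglyMeasurableAtFilter _ _) continuous_stdphi.continuousAt).const_add _

lemma continuous_stdPhi : Continuous stdPhi :=
  continuous_iff_continuousAt.2 fun x => (hasDerivAt_stdPhi x).continuousAt

lemma strictMono_stdPhi : StrictMono stdPhi :=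
  strictMono_of_hasDerivAt_pos hasDerivAt_stdPhi stdphi_pos

lemma stdPhi_pos (x : ℝ) : 0 < stdPhi x :=
  (cdf_nonneg _ (x - 1)).trans_lt (strictMono_stdPhi (by linarith))

lemma stdPhi_lt_one (x : ℝ) : stdPhi x < 1 :=
  (strictMono_stdPhi (by linarith : x < x + 1)).trans_le (cdf_le_one _ _)

lemma stdPhi_neg (x : ℝ) : stdPhi (-x) = 1 - stdPhi x := by
  have h : gaussianReal 0 1 = (gaussianReal 0 1).map (fun x => -x) := by
    rw [gaussianReal_map_neg]; simp
  have := nullSingletonClass_gaussianReal (μ := 0) (v := 1) one_ne_zero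
  rw [stdPhi, stdPhi, cdf_eq_real, cdf_eq_real]
  nth_rw 1 [h]
  rw [map_measureReal_apply (by fun_prop) measurableSet_Iic, ← probReal_compl_eq_one_sub
    measurableSet_Iic]
  have : (fun x : ℝ => -x) ⁻¹' Iic (-x) = Ici x := by ext; simp
  rw [this, compl_Iic]
  exact (measureReal_congr Ioi_ae_eq_Ici).symm

/-! ## Partial moments of the normal distribution -/

/-- The `k`-th moment of `N(μ, 1)` over the half-line `(0, ∞)`. -/
def partialMoment (k : ℕ) (μ : ℝ) : ℝ := ∫ z in Ioi 0, z ^ k * stdphi (z - μ)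

lemma integrable_pow_mul_stdphi (k : ℕ) (μ : ℝ) :
    Integrable fun z : ℝ => z ^ k * stdphi (z - μ) := by
  have h : Integrable (fun z : ℝ => z ^ k) (gaussianReal μ 1) := by
    have := (memLp_id_gaussianReal (μ := μ) (v := 1) k).integrable_norm_pow'
    refine this.mono' (by fun_prop) (.of_forall fun z => by simp)
  rw [gaussianReal_of_var_ne_zero _ one_ne_zero,
    integrable_withDensity_iff_integrable_smul' (measurable_gaussianPDF _ _)
      (.of_forall fun _ => gaussianPDF_lt_top)] at h
  refine h.congr (.of_forall fun z => ?_)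
  simp [toReal_gaussianPDF, gaussianPDFReal_eq_stdphi, mul_comm]

lemma hasDerivAt_stdphi_sub (μ z : ℝ) :
    HasDerivAt (fun z : ℝ => stdphi (z - μ)) (-(z - μ) * stdphi (z - μ)) z := by
  have h := (hasDerivAt_stdphi (z - μ)).comp z ((hasDerivAt_id z).sub_const μ)
  rwa [mul_one] at h

lemma hasDerivAt_pow_mul_stdphi (k : ℕ) (μ z : ℝ) :
    HasDerivAt (fun z : ℝ => z ^ (k + 1) * stdphi (z - μ))
      ((k + 1) * (z ^ k * stdphi (z - μ)) - (z ^ (k + 2) * stdphi (z - μ)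
        - μ * (z ^ (k + 1) * stdphi (z - μ)))) z := by
  refine ((hasDerivAt_pow (k + 1) z).mul (hasDerivAt_stdphi_sub μ z)).congr_deriv ?_
  push_cast
  ring

lemma partialMoment_zero (μ : ℝ) : partialMoment 0 μ = stdPhi μ := by
  have h : ∫ z in Ioi 0, stdphi (z - μ) = (gaussianReal μ 1).real (Ioi 0) := by
    rw [measureReal_def, gaussianReal_apply_eq_integral _ one_ne_zero,
      ENNReal.toReal_ofReal (integral_nonneg fun y => gaussianPDFReal_nonneg _ _ _)]
    simp only [gaussianPDFReal_eq_stdphi]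
  simp only [partialMoment, pow_zero, one_mul]
  rw [h, ← compl_Iic, probReal_compl_eq_one_sub measurableSet_Iic, gaussianReal_real_Iic, zero_sub,
    stdPhi_neg]
  ring

/-- Integration of the derivative of φ(z - μ) over the half-line; the boundary term at 0 is φ(-μ) =
φ(μ). -/
lemma partialMoment_one (μ : ℝ) : partialMoment 1 μ = μ * stdPhi μ + stdphi μ := by
  have hd : ∀ z ∈ Ici (0 : ℝ), HasDerivAt (fun z : ℝ => stdphi (z - μ))
      (-(z ^ 1 * stdphi (z - μ) - μ * (z ^ 0 * stdphi (z - μ)))) z := by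
    intro z _
    exact (hasDerivAt_stdphi_sub μ z).congr_deriv (by ring)
  have hi : Integrable fun z : ℝ => -(z ^ 1 * stdphi (z - μ) - μ * (z ^ 0 * stdphi (z - μ))) :=
    ((integrable_pow_mul_stdphi 1 μ).sub ((integrable_pow_mul_stdphi 0 μ).const_mul μ)).neg
  have ht := tendsto_zero_of_hasDerivAt_of_integrableOn_Ioi (a := 0)
    (fun x hx => hd x (Ioi_subset_Ici_self hx)) hi.integrableOn
    (by simpa using (integrable_pow_mul_stdphi 0 μ).integrableOn)
  have h := integral_Ioi_of_hasDerivAt_of_tendsto' hd hi.integrableOn ht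
  rw [integral_neg, integral_sub (integrable_pow_mul_stdphi 1 μ).integrableOn
    ((integrable_pow_mul_stdphi 0 μ).const_mul μ).integrableOn, integral_const_mul] at h
  change -(partialMoment 1 μ - μ * partialMoment 0 μ) = _ at h
  rw [partialMoment_zero, zero_sub, zero_sub, stdphi_neg] at h
  linarith

/-- Integration by parts: the derivative of z^(k+1) φ(z - μ) has integral zero over the half-line,
because the function vanishes at 0 and at infinity. -/
lemma partialMoment_add_two (k : ℕ) (μ : ℝ) :
    partialMoment (k + 2) μ = μ * partialMoment (k + 1) μ + (k + 1) * partialMoment k μ := by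
  have hi0 := (integrable_pow_mul_stdphi k μ).const_mul ((k : ℝ) + 1)
  have hi1 := (integrable_pow_mul_stdphi (k + 1) μ).const_mul μ
  have hi2 := integrable_pow_mul_stdphi (k + 2) μ
  have hi3 : Integrable fun z : ℝ => z ^ (k + 2) * stdphi (z - μ)
      - μ * (z ^ (k + 1) * stdphi (z - μ)) := hi2.sub hi1
  have ht := tendsto_zero_of_hasDerivAt_of_integrableOn_Ioi (a := 0)
    (fun x _ => hasDerivAt_pow_mul_stdphi k μ x) (hi0.sub hi3).integrableOn
    (integrable_pow_mul_stdphi (k + 1) μ).integrableOn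
  have h := integral_Ioi_of_hasDerivAt_of_tendsto' (a := 0)
    (fun x _ => hasDerivAt_pow_mul_stdphi k μ x) (hi0.sub hi3).integrableOn ht
  rw [integral_sub hi0.integrableOn hi3.integrableOn,
    integral_sub hi2.integrableOn hi1.integrableOn, integral_const_mul,
    integral_const_mul] at h
  change (k + 1) * partialMoment k μ - (partialMoment (k + 2) μ - μ * partialMoment (k + 1) μ)
    = _ at h
  simp at h
  linarith

lemma partialMoment_pos (k : ℕ) (μ : ℝ) : 0 < partialMoment k μ := by
  refine (setIntegral_pos_iff_support_of_nonneg_ae ?_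
    (integrable_pow_mul_stdphi k μ).integrableOn).2 ?_
  · filter_upwards [ae_restrict_mem measurableSet_Ioi] with z (hz : 0 < z)
    have := stdphi_pos (z - μ)
    simp only [Pi.zero_apply]
    positivity
  · have : Ioi (0 : ℝ) ⊆ Function.support (fun z : ℝ => z ^ k * stdphi (z - μ)) ∩ Ioi 0 := by
      intro z (hz : 0 < z)
      exact ⟨(mul_pos (pow_pos hz k) (stdphi_pos _)).ne', hz⟩
    refine lt_of_lt_of_le ?_ (measure_mono this)
    simp

/-! ## The inverse Mills ratio -/

/-- The ratio `φ / Φ`. -/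
def mills (t : ℝ) : ℝ := stdphi t / stdPhi t

/-- The variance of `TN(t, 1; 1)`. -/
def truncVar (t : ℝ) : ℝ := 1 - (t * mills t + mills t ^ 2)

lemma mills_pos (t : ℝ) : 0 < mills t := div_pos (stdphi_pos t) (stdPhi_pos t)

lemma add_mills_eq (t : ℝ) : t + mills t = partialMoment 1 t / stdPhi t := by
  have := (stdPhi_pos t).ne'
  rw [partialMoment_one, mills]; field_simp

lemma add_mills_pos (t : ℝ) : 0 < t + mills t := by
  rw [add_mills_eq]; exact div_pos (partialMoment_pos 1 t) (stdPhi_pos t)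

lemma truncVar_eq (t : ℝ) : truncVar t = 1 - mills t * (t + mills t) := by
  rw [truncVar]; ring

/-- The defect from 1 is the product of φ/Φ and of the mean t + φ/Φ of a positive variable. -/
lemma truncVar_lt_one (t : ℝ) : truncVar t < 1 := by
  rw [truncVar_eq]; linarith [mul_pos (mills_pos t) (add_mills_pos t)]

lemma partialMoment_two (t : ℝ) :
    partialMoment 2 t = (1 + t * (t + mills t)) * stdPhi t := by
  have := (stdPhi_pos t).ne'
  rw [partialMoment_add_two 0, zero_add, partialMoment_zero, partialMoment_one, mills]
  push_cast; field_simp; ring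

lemma truncVar_eq_integral (t : ℝ) : truncVar t * stdPhi t =
    ∫ z in Ioi 0, (z - (t + mills t)) ^ 2 * stdphi (z - t) := by
  have h : ∀ z : ℝ, (z - (t + mills t)) ^ 2 * stdphi (z - t) = z ^ 2 * stdphi (z - t)
      - 2 * (t + mills t) * (z ^ 1 * stdphi (z - t))
      + (t + mills t) ^ 2 * (z ^ 0 * stdphi (z - t)) := fun z => by ring
  have i0 := ((integrable_pow_mul_stdphi 0 t).const_mul ((t + mills t) ^ 2)).integrableOn
    (s := Ioi 0)
  have i1 := ((integrable_pow_mul_stdphi 1 t).const_mul (2 * (t + mills t))).integrableOn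
    (s := Ioi 0)
  have i2 := (integrable_pow_mul_stdphi 2 t).integrableOn (s := Ioi 0)
  have i3 : IntegrableOn (fun z : ℝ => z ^ 2 * stdphi (z - t)
      - 2 * (t + mills t) * (z ^ 1 * stdphi (z - t))) (Ioi 0) := i2.sub i1
  simp_rw [h]
  rw [integral_add i3 i0, integral_sub i2 i1, integral_const_mul, integral_const_mul]
  change _ = partialMoment 2 t - _ * partialMoment 1 t + _ * partialMoment 0 t
  have h1 : partialMoment 1 t = (t + mills t) * stdPhi t := by
    rw [add_mills_eq, div_mul_cancel₀ _ (stdPhi_pos t).ne']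
  rw [partialMoment_two, h1, partialMoment_zero, truncVar]
  ring

lemma truncVar_nonneg (t : ℝ) : 0 ≤ truncVar t := by
  have h : 0 ≤ truncVar t * stdPhi t := by
    rw [truncVar_eq_integral]
    exact integral_nonneg fun z => mul_nonneg (sq_nonneg _) (stdphi_pos _).le
  exact nonneg_of_mul_nonneg_left h (stdPhi_pos t)

lemma hasDerivAt_mills (t : ℝ) : HasDerivAt mills (truncVar t - 1) t := by
  have := (stdPhi_pos t).ne'
  refine ((hasDerivAt_stdphi t).div (hasDerivAt_stdPhi t) this).congr_deriv ?_
  unfold truncVar mills; field_simp; ring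

lemma strictAnti_mills : StrictAnti mills :=
  strictAnti_of_hasDerivAt_neg hasDerivAt_mills fun t => by linarith [truncVar_lt_one t]

lemma continuous_mills : Continuous mills :=
  continuous_iff_continuousAt.2 fun x => (hasDerivAt_mills x).continuousAt

lemma hasDerivAt_add_mills (t : ℝ) : HasDerivAt (fun t => t + mills t) (truncVar t) t := by
  have h := (hasDerivAt_id t).add (hasDerivAt_mills t)
  rwa [add_sub_cancel] at h

lemma monotone_add_mills : Monotone fun t => t + mills t :=
  monotone_of_hasDerivAt_nonneg hasDerivAt_add_mills truncVar_nonneg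

/-- The defect `mills t * (t + mills t)` has to be bounded below. On [-1, C] its first factor
decreases and its second increases, so endpoint values suffice. For t ≤ -1, positivity of the third
partial moment gives e > |t|/(t² + 2) for the mean e = t + `mills t`, so the defect e(e + |t|)
exceeds t²/(t² + 2) ≥ 1/3. -/
lemma exists_truncVar_le (C : ℝ) : ∃ δ > 0, ∀ t ≤ C, truncVar t ≤ 1 - δ := by
  have hC := mills_pos C
  have h1 := add_mills_pos (-1)
  refine ⟨min (1 / 3) (mills C * (-1 + mills (-1))), by positivity, fun t ht => ?_⟩
  rw [truncVar_eq]
  rcases le_total t (-1) with h | h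
  · have hP := stdPhi_pos t
    have h3 := partialMoment_pos 3 t
    have ha := add_mills_pos t
    rw [partialMoment_add_two 1, partialMoment_two] at h3
    have e1 : partialMoment (1 : ℕ) t = (t + mills t) * stdPhi t := by
      rw [add_mills_eq, div_mul_cancel₀ _ hP.ne']
    rw [e1] at h3
    have h3' : 0 < t * (1 + t * (t + mills t)) + 2 * (t + mills t) := by
      push_cast at h3
      refine pos_of_mul_pos_left (b := stdPhi t) ?_ hP.le
      nlinarith
    have : 1 / 3 ≤ mills t * (t + mills t) := by
      set e := t + mills t
      have hm : mills t = e - t := by simp [e]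
      rw [hm]
      nlinarith [mul_pos ha ha, sq_nonneg (t + 1)]
    linarith [min_le_left (1 / 3) (mills C * (-1 + mills (-1)))]
  · have : mills C * (-1 + mills (-1)) ≤ mills t * (t + mills t) :=
      mul_le_mul (strictAnti_mills.antitone ht) (monotone_add_mills h) h1.le (mills_pos t).le
    linarith [min_le_right (1 / 3) (mills C * (-1 + mills (-1)))]

/-- For t ≤ 0 and z > 0 one has φ(z - t) ≤ exp(-t²/2) φ(z). This makes each likelihood factor decay
like a Gaussian on the side opposed to its response. -/
lemma stdPhi_le_exp (t : ℝ) : stdPhi t ≤ Real.exp (-(min t 0) ^ 2 / 2) := by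
  rcases le_total 0 t with h | h
  · simp [min_eq_right h, (stdPhi_lt_one t).le]
  · rw [min_eq_left h, ← partialMoment_zero]
    have hle : partialMoment 0 t ≤ ∫ z in Ioi 0, Real.exp (-t ^ 2 / 2) * stdphi z := by
      refine setIntegral_mono_on (integrable_pow_mul_stdphi 0 t).integrableOn
        (integrable_stdphi.const_mul _).integrableOn measurableSet_Ioi fun z (hz : 0 < z) => ?_
      rw [stdphi_eq, stdphi_eq, pow_zero, one_mul, mul_left_comm, ← Real.exp_add]
      gcongr
      nlinarith
    refine hle.trans ?_
    rw [integral_const_mul]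
    have : ∫ z in Ioi 0, stdphi z ≤ 1 := by
      have := partialMoment_zero 0
      simp only [partialMoment, pow_zero, one_mul, sub_zero] at this
      rw [this]; exact (stdPhi_lt_one 0).le
    nlinarith [Real.exp_pos (-t ^ 2 / 2)]

/-! ## Truncated normal distributions -/

/-- The sign attached to a response: `1` for `true` and `-1` for `false`. -/
def sgn (a : Bool) : ℝ := if a then 1 else -1

lemma sgn_mul_self (a : Bool) : sgn a * sgn a = 1 := by cases a <;> simp [sgn]

lemma sgn_mul_sgn_mul (a : Bool) (x : ℝ) : sgn a * (sgn a * x) = x := by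
  rw [← mul_assoc, sgn_mul_self, one_mul]

lemma abs_sgn (a : Bool) : |sgn a| = 1 := by cases a <;> simp [sgn]

lemma gaussianReal_truncSet (μ : ℝ) (a : Bool) :
    gaussianReal μ 1 (truncSet a) = ENNReal.ofReal (stdPhi (sgn a * μ)) := by
  have := nullSingletonClass_gaussianReal (μ := μ) (v := 1) one_ne_zero
  cases a
  · simp only [truncSet, sgn, Bool.false_eq_true, if_false]
    rw [measure_congr Iio_ae_eq_Iic, ← ofReal_measureReal, gaussianReal_real_Iic]
    simp
  · simp only [truncSet, sgn, if_true]
    rw [← compl_Iic, ← ofReal_measureReal, probReal_compl_eq_one_sub measurableSet_Iic,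
      gaussianReal_real_Iic, zero_sub, stdPhi_neg]
    simp

lemma truncNormal_eq_withDensity (μ : ℝ) (a : Bool) :
    truncNormal μ a = (ENNReal.ofReal (stdPhi (sgn a * μ)))⁻¹ •
      (volume.restrict (truncSet a)).withDensity (gaussianPDF μ 1) := by
  rw [truncNormal, ProbabilityTheory.cond, gaussianReal_truncSet,
    gaussianReal_of_var_ne_zero _ one_ne_zero, restrict_withDensity (truncSet_measurable a)]

/-- Reflection at 0 exchanges the two responses, so all moments can be computed on the positive
half-line. -/
lemma truncNormal_eq_map (μ : ℝ) (a : Bool) :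
    truncNormal μ a = (truncNormal (sgn a * μ) true).map (sgn a * ·) := by
  cases a
  · have h : gaussianReal μ 1 = (gaussianReal (-μ) 1).map (fun x => -x) := by
      rw [gaussianReal_map_neg]; simp
    ext s hs
    have hm : MeasurableSet ((fun x : ℝ => -x) ⁻¹' s) := measurable_neg hs
    simp only [sgn, Bool.false_eq_true, if_false, neg_mul, one_mul]
    rw [Measure.map_apply (by fun_prop) hs, truncNormal, truncNormal,
      cond_apply (truncSet_measurable _), cond_apply (truncSet_measurable _),
      gaussianReal_truncSet, gaussianReal_truncSet, h,
      Measure.map_apply (by fun_prop) ((truncSet_measurable _).inter hs)]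
    congr 2
    · simp [sgn]
    · ext x; simp [truncSet]
  · simp [sgn]

lemma integral_truncNormal_true (μ : ℝ) (f : ℝ → ℝ) :
    ∫ z, f z ∂(truncNormal μ true) =
      (stdPhi μ)⁻¹ * ∫ z in Ioi 0, f z * stdphi (z - μ) := by
  rw [truncNormal_eq_withDensity, integral_smul_measure,
    integral_withDensity_eq_integral_toReal_smul (measurable_gaussianPDF _ _)
      (.of_forall fun _ => gaussianPDF_lt_top)]
  simp [toReal_gaussianPDF, gaussianPDFReal_eq_stdphi, mul_comm, truncSet, sgn,
    ENNReal.toReal_inv, ENNReal.toReal_ofReal (stdPhi_pos μ).le]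

/-- The mean of `TN(μ, 1; a)`. -/
def truncMean (μ : ℝ) (a : Bool) : ℝ := μ + sgn a * mills (sgn a * μ)

lemma truncMean_eq (μ : ℝ) (a : Bool) :
    truncMean μ a = sgn a * (sgn a * μ + mills (sgn a * μ)) := by
  rw [truncMean, mul_add, sgn_mul_sgn_mul]

lemma memLp_id_truncNormal (μ : ℝ) (a : Bool) : MemLp id 2 (truncNormal μ a) := by
  refine ((memLp_id_gaussianReal' (μ := μ) (v := 1) 2 (by simp)).restrict
    (truncSet a)).smul_measure ?_
  exact ENNReal.inv_ne_top.2 (truncSet_pos μ a)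

lemma integral_id_truncNormal (μ : ℝ) (a : Bool) :
    ∫ z, z ∂(truncNormal μ a) = truncMean μ a := by
  rw [truncNormal_eq_map, integral_map (by fun_prop) (by fun_prop), integral_const_mul,
    integral_truncNormal_true, truncMean_eq, add_mills_eq]
  simp [partialMoment, div_eq_inv_mul]

lemma integral_sq_truncNormal (μ : ℝ) (a : Bool) :
    ∫ z, (z - truncMean μ a) ^ 2 ∂(truncNormal μ a) = truncVar (sgn a * μ) := by
  rw [truncNormal_eq_map, integral_map (by fun_prop) (by fun_prop), truncMean_eq]
  have : ∀ z, (sgn a * z - sgn a * (sgn a * μ + mills (sgn a * μ))) ^ 2 =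
      (z - (sgn a * μ + mills (sgn a * μ))) ^ 2 := fun z => by
    rw [← mul_sub, mul_pow, sq (sgn a), sgn_mul_self, one_mul]
  simp_rw [this]
  rw [integral_truncNormal_true, ← truncVar_eq_integral]
  field_simp [(stdPhi_pos (sgn a * μ)).ne']

/-- In this exponential family the derivative of the mean is the variance; the two signs cancel. It
is the reason why Λ appears in the derivative of the mean map. -/
lemma hasDerivAt_truncMean (μ : ℝ) (a : Bool) :
    HasDerivAt (fun μ => truncMean μ a) (truncVar (sgn a * μ)) μ := by
  have h1 : HasDerivAt (fun μ => sgn a * μ) (sgn a) μ := by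
    simpa using (hasDerivAt_id μ).const_mul (sgn a)
  have h := ((hasDerivAt_add_mills (sgn a * μ)).comp μ h1).const_mul (sgn a)
  simp_rw [truncMean_eq]
  refine h.congr_deriv ?_
  rw [mul_comm (truncVar _), sgn_mul_sgn_mul]

/-! ## Quantile functions -/

/-- Right-continuity of the cdf makes the infimum attained. Levels strictly between 0 and 1 ensure
that the set is nonempty and bounded below, so that `sInf` is not a default value. -/
lemma quantile_le_iff (ν : Measure ℝ) {u : ℝ} (hu : u ∈ Ioo (0 : ℝ) 1) (z : ℝ) :
    quantile ν u ≤ z ↔ u ≤ cdf ν z := by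
  obtain ⟨b, hb⟩ := (((tendsto_cdf_atTop ν).eventually_const_lt hu.2).mono fun _ h => h.le).exists
  obtain ⟨c, hc⟩ := Filter.eventually_atBot.1 ((tendsto_cdf_atBot ν).eventually_lt_const hu.1)
  have hbdd : BddBelow {z | u ≤ cdf ν z} :=
    ⟨c, fun x hx => le_of_not_gt fun h => not_lt_of_ge hx (hc x h.le)⟩
  refine ⟨fun h => ?_, fun h => csInf_le hbdd h⟩
  have hr : ContinuousWithinAt (cdf ν) (Ioi z) z :=
    ((cdf ν).right_continuous z).mono Ioi_subset_Ici_self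
  refine ge_of_tendsto hr ?_
  filter_upwards [self_mem_nhdsWithin] with w (hw : z < w)
  obtain ⟨s, hs, hsw⟩ := exists_lt_of_csInf_lt ⟨b, hb⟩ (h.trans_lt hw)
  exact le_trans hs (monotone_cdf ν hsw.le)

lemma aemeasurable_quantile (ν : Measure ℝ) :
    AEMeasurable (quantile ν) (volume.restrict (Ioo 0 1)) := by
  refine aemeasurable_restrict_of_monotoneOn measurableSet_Ioo fun x hx y hy hxy => ?_
  rw [quantile_le_iff ν hx]
  exact hxy.trans ((quantile_le_iff ν hy _).1 le_rfl)

instance : IsProbabilityMeasure (volume.restrict (Ioo (0 : ℝ) 1)) := ⟨by simp⟩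

/-- Inverse transform sampling, read off from `quantile_le_iff` on the half-lines `Iic z`. -/
lemma map_quantile (ν : Measure ℝ) [IsProbabilityMeasure ν] :
    (volume.restrict (Ioo 0 1)).map (quantile ν) = ν := by
  have : IsProbabilityMeasure ((volume.restrict (Ioo 0 1)).map (quantile ν)) :=
    Measure.isProbabilityMeasure_map (aemeasurable_quantile ν)
  refine Measure.ext_of_Iic _ _ fun z => ?_
  rw [Measure.map_apply_of_aemeasurable (aemeasurable_quantile ν) measurableSet_Iic,
    ← ofReal_cdf ν z]
  have h : quantile ν ⁻¹' Iic z =ᵐ[volume.restrict (Ioo 0 1)] Iic (cdf ν z) := by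
    refine Filter.eventuallyEq_set.2 ?_
    filter_upwards [ae_restrict_mem measurableSet_Ioo] with u hu
    exact quantile_le_iff ν hu z
  have h0 := cdf_nonneg ν z
  have h1 := cdf_le_one ν z
  rw [measure_congr h, Measure.restrict_apply measurableSet_Iic]
  refine le_antisymm ?_ ?_
  · calc volume (Iic (cdf ν z) ∩ Ioo 0 1) ≤ volume (Icc 0 (cdf ν z)) :=
          measure_mono fun x hx => ⟨hx.2.1.le, hx.1⟩
      _ = _ := by simp
  · calc ENNReal.ofReal (cdf ν z) = volume (Ioo 0 (cdf ν z)) := by simp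
      _ ≤ volume (Iic (cdf ν z) ∩ Ioo 0 1) :=
        measure_mono fun x hx => ⟨hx.2.le, hx.1, hx.2.trans_le h1⟩

/-- The inverse of the standard normal distribution function on `(0, 1)`, extended by `0`. -/
def normInv : ℝ → ℝ := (Ioo (0 : ℝ) 1).indicator (quantile (gaussianReal 0 1))

lemma normInv_le_iff {u : ℝ} (hu : u ∈ Ioo (0 : ℝ) 1) (z : ℝ) :
    normInv u ≤ z ↔ u ≤ stdPhi z := by
  rw [normInv, indicator_of_mem hu, quantile_le_iff _ hu]; rfl

lemma stdPhi_mem_Ioo (x : ℝ) : stdPhi x ∈ Ioo (0 : ℝ) 1 := ⟨stdPhi_pos x, stdPhi_lt_one x⟩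

lemma normInv_stdPhi (z : ℝ) : normInv (stdPhi z) = z :=
  eq_of_forall_ge_iff fun w => by
    rw [normInv_le_iff (stdPhi_mem_Ioo z), strictMono_stdPhi.le_iff_le]

lemma exists_stdPhi_eq {u : ℝ} (hu : u ∈ Ioo (0 : ℝ) 1) : ∃ z, stdPhi z = u :=
  mem_range_of_exists_le_of_exists_ge continuous_stdPhi
    (((tendsto_cdf_atBot (gaussianReal 0 1)).eventually_lt_const hu.1).mono fun _ h => h.le).exists
    (((tendsto_cdf_atTop (gaussianReal 0 1)).eventually_const_lt hu.2).mono fun _ h => h.le).exists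

lemma stdPhi_normInv {u : ℝ} (hu : u ∈ Ioo (0 : ℝ) 1) : stdPhi (normInv u) = u := by
  obtain ⟨z, rfl⟩ := exists_stdPhi_eq hu
  rw [normInv_stdPhi]

lemma le_normInv_iff {u : ℝ} (hu : u ∈ Ioo (0 : ℝ) 1) (z : ℝ) :
    z ≤ normInv u ↔ stdPhi z ≤ u := by
  obtain ⟨w, rfl⟩ := exists_stdPhi_eq hu
  rw [normInv_stdPhi, strictMono_stdPhi.le_iff_le]

lemma measurable_normInv : Measurable normInv := by
  refine measurable_of_Iic fun z => ?_
  have : normInv ⁻¹' Iic z = (Ioo 0 1 ∩ Iic (stdPhi z)) ∪ ((Ioo 0 1)ᶜ ∩ {_u | 0 ≤ z}) := by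
    ext u
    by_cases hu : u ∈ Ioo (0 : ℝ) 1
    · simp only [mem_preimage, mem_Iic, normInv_le_iff hu, mem_union, mem_inter_iff, hu, true_and,
        mem_compl_iff, not_true_eq_false, false_and, or_false]
    · simp only [mem_preimage, mem_Iic, normInv, indicator_of_notMem hu, mem_union, mem_inter_iff,
        hu, false_and, mem_compl_iff, not_false_eq_true, true_and, false_or, mem_ofPred_eq]
  rw [this]
  exact (measurableSet_Ioo.inter measurableSet_Iic).union
    (measurableSet_Ioo.compl.inter (MeasurableSet.const _))

lemma continuousAt_normInv {u : ℝ} (hu : u ∈ Ioo (0 : ℝ) 1) : ContinuousAt normInv u := by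
  refine continuousAt_of_monotoneOn_of_image_mem_nhds (s := Ioo 0 1) (fun x hx y hy hxy => ?_)
    (isOpen_Ioo.mem_nhds hu) ?_
  · rw [normInv_le_iff hx, stdPhi_normInv hy]; exact hxy
  · have : normInv '' Ioo 0 1 = univ :=
      eq_univ_of_forall fun z => ⟨stdPhi z, stdPhi_mem_Ioo z, normInv_stdPhi z⟩
    rw [this]; exact Filter.univ_mem

lemma hasDerivAt_normInv {u : ℝ} (hu : u ∈ Ioo (0 : ℝ) 1) :
    HasDerivAt normInv (stdphi (normInv u))⁻¹ u := by
  refine HasDerivAt.of_local_left_inverse (continuousAt_normInv hu) (hasDerivAt_stdPhi _)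
    (stdphi_pos _).ne' ?_
  filter_upwards [isOpen_Ioo.mem_nhds hu] with v hv using stdPhi_normInv hv

/-! ## The inverse distribution function of a truncated normal distribution -/

/-- The value at level `1 - v` of the inverse cdf of `TN(m, 1; 1)`. -/
def upperQuantile (v m : ℝ) : ℝ := m - normInv (v * stdPhi m)

/-- The derivative of `upperQuantile v` at `m`. -/
def upperQuantileDeriv (v m : ℝ) : ℝ := 1 - mills m / mills (normInv (v * stdPhi m))

/-- The level at which the inverse cdf of `TN(m, 1; 1)` is taken: `1 - u` or `u`, according to the
response. -/
def level (a : Bool) (u : ℝ) : ℝ := if a then 1 - u else u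

lemma level_mem {u : ℝ} (a : Bool) (hu : u ∈ Ioo (0 : ℝ) 1) : level a u ∈ Ioo (0 : ℝ) 1 := by
  cases a <;> simp [level, hu.1, hu.2]

lemma measurable_level (a : Bool) : Measurable (level a) := by
  unfold level; cases a
  · exact measurable_id
  · exact measurable_const.sub measurable_id

lemma mul_stdPhi_mem {v : ℝ} (hv : v ∈ Ioo (0 : ℝ) 1) (m : ℝ) :
    v * stdPhi m ∈ Ioo (0 : ℝ) 1 :=
  ⟨mul_pos hv.1 (stdPhi_pos m), mul_lt_one_of_nonneg_of_lt_one_left hv.1.le hv.2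
    (stdPhi_lt_one m).le⟩

lemma normInv_mul_stdPhi_lt {v : ℝ} (hv : v ∈ Ioo (0 : ℝ) 1) (m : ℝ) :
    normInv (v * stdPhi m) < m := by
  rw [← strictMono_stdPhi.lt_iff_lt, stdPhi_normInv (mul_stdPhi_mem hv m)]
  exact mul_lt_of_lt_one_left (stdPhi_pos m) hv.2

lemma upperQuantile_pos {v : ℝ} (hv : v ∈ Ioo (0 : ℝ) 1) (m : ℝ) : 0 < upperQuantile v m :=
  sub_pos.2 (normInv_mul_stdPhi_lt hv m)

lemma measurable_upperQuantile : Measurable fun q : ℝ × ℝ => upperQuantile q.1 q.2 := by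
  have := continuous_stdPhi.measurable
  have := measurable_normInv
  unfold upperQuantile; fun_prop

lemma measurable_upperQuantileDeriv :
    Measurable fun q : ℝ × ℝ => upperQuantileDeriv q.1 q.2 := by
  have := continuous_stdPhi.measurable
  have := measurable_normInv
  have := continuous_mills.measurable
  unfold upperQuantileDeriv; fun_prop

/-- With w = `normInv (v * stdPhi m)` the chain rule gives 1 - v φ(m)/φ(w); since Φ(w) = v Φ(m), the
fraction is a quotient of two values of φ/Φ. -/
lemma hasDerivAt_upperQuantile {v : ℝ} (hv : v ∈ Ioo (0 : ℝ) 1) (m : ℝ) :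
    HasDerivAt (upperQuantile v) (upperQuantileDeriv v m) m := by
  have hmem := mul_stdPhi_mem hv m
  have h := (hasDerivAt_id m).sub
    ((hasDerivAt_normInv hmem).comp m ((hasDerivAt_stdPhi m).const_mul v))
  refine h.congr_deriv ?_
  have h1 := stdPhi_normInv hmem
  have h2 := (stdphi_pos (normInv (v * stdPhi m))).ne'
  have h3 := (stdPhi_pos m).ne'
  have h4 := hv.1.ne'
  rw [upperQuantileDeriv, mills, mills, h1]
  field_simp

lemma continuous_upperQuantileDeriv {v : ℝ} (hv : v ∈ Ioo (0 : ℝ) 1) :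
    Continuous (upperQuantileDeriv v) := by
  refine continuous_iff_continuousAt.2 fun m => ?_
  have h1 : ContinuousAt (fun m => normInv (v * stdPhi m)) m :=
    ContinuousAt.comp (g := normInv) (continuousAt_normInv (mul_stdPhi_mem hv m))
      (continuous_stdPhi.continuousAt.const_mul v)
  exact continuousAt_const.sub (continuous_mills.continuousAt.div
    (ContinuousAt.comp (g := mills) continuous_mills.continuousAt h1) (mills_pos _).ne')

/-- The point w = `normInv (v * stdPhi m)` lies below m and `mills` decreases, so the quotient of
Mills ratios is in (0, 1]. This is the source of nonexpansiveness. -/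
lemma upperQuantileDeriv_mem {v : ℝ} (hv : v ∈ Ioo (0 : ℝ) 1) (m : ℝ) :
    upperQuantileDeriv v m ∈ Icc (0 : ℝ) 1 := by
  have h1 := mills_pos m
  have h2 := mills_pos (normInv (v * stdPhi m))
  have h3 := strictAnti_mills (normInv_mul_stdPhi_lt hv m)
  refine ⟨sub_nonneg.2 ((div_le_one h2).2 h3.le), ?_⟩
  rw [upperQuantileDeriv]
  linarith [div_pos h1 h2]

/-- On |m| ≤ R the numerator is at least `mills R`, and v ≥ 1/4 keeps the denominator at most its
value at the extreme point. The interval [1/4, 3/4] is symmetric about 1/2, hence stable under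
`level`. -/
lemma exists_upperQuantileDeriv_le (R : ℝ) : ∃ δ > 0, ∀ m, |m| ≤ R → ∀ v ∈ Icc (1 / 4 : ℝ) (3 / 4),
    upperQuantileDeriv v m ≤ 1 - δ := by
  set w := normInv (1 / 4 * stdPhi (-R))
  refine ⟨mills R / mills w, div_pos (mills_pos _) (mills_pos _), fun m hm v hv => ?_⟩
  have hm' := abs_le.1 hm
  have hv' : v ∈ Ioo (0 : ℝ) 1 := ⟨by linarith [hv.1], by linarith [hv.2]⟩
  have hw : w ≤ normInv (v * stdPhi m) := by
    rw [normInv_le_iff (mul_stdPhi_mem ⟨by norm_num, by norm_num⟩ _),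
      stdPhi_normInv (mul_stdPhi_mem hv' m)]
    exact mul_le_mul hv.1 (strictMono_stdPhi.monotone hm'.1) (stdPhi_pos _).le hv'.1.le
  rw [upperQuantileDeriv]
  have : mills R / mills w ≤ mills m / mills (normInv (v * stdPhi m)) :=
    div_le_div₀ (mills_pos _).le (strictAnti_mills.antitone hm'.2) (mills_pos _)
      (strictAnti_mills.antitone hw)
  linarith

lemma cdf_truncNormal (μ : ℝ) (a : Bool) (z : ℝ) : cdf (truncNormal μ a) z =
    (stdPhi (sgn a * μ))⁻¹ * (gaussianReal μ 1).real (truncSet a ∩ Iic z) := by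
  rw [cdf_eq_real, truncNormal, measureReal_def, cond_apply (truncSet_measurable a),
    gaussianReal_truncSet, ENNReal.toReal_mul, ENNReal.toReal_inv,
    ENNReal.toReal_ofReal (stdPhi_pos _).le]
  rfl

/-- Both sides are compared through their upper bounds z. On the far side of the truncation point
the truncated cdf is 0 or 1, so these z form a separate case. -/
lemma quantileTN_eq {u : ℝ} (hu : u ∈ Ioo (0 : ℝ) 1) (μ : ℝ) (a : Bool) :
    quantileTN u μ a = sgn a * upperQuantile (level a u) (sgn a * μ) := by
  refine eq_of_forall_ge_iff fun z => ?_
  have hl := level_mem a hu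
  have hmem := mul_stdPhi_mem hl (sgn a * μ)
  have hpos := upperQuantile_pos hl (sgn a * μ)
  have hP := stdPhi_pos (sgn a * μ)
  rw [quantileTN, quantile_le_iff _ hu, cdf_truncNormal, le_inv_mul_iff₀ hP, upperQuantile]
  rw [upperQuantile] at hpos
  cases a
  · simp only [level, sgn, truncSet, Bool.false_eq_true, if_false, neg_mul, one_mul, neg_sub,
      sub_neg_eq_add] at *
    rcases lt_or_ge z 0 with hz | hz
    · rw [inter_eq_right.2 (Iic_subset_Iio.2 hz), gaussianReal_real_Iic,
        mul_comm, ← normInv_le_iff hmem, le_sub_iff_add_le]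
    · rw [inter_eq_left.2 ((Iio_subset_Iio hz).trans Iio_subset_Iic_self)]
      have h := gaussianReal_truncSet μ false
      simp only [truncSet, sgn, Bool.false_eq_true, if_false, neg_mul, one_mul] at h
      rw [measureReal_def, h, ENNReal.toReal_ofReal hP.le]
      exact iff_of_true (mul_le_of_le_one_right hP.le hu.2.le) (by linarith)
  · simp only [level, sgn, truncSet, if_true, one_mul] at *
    rcases lt_or_ge 0 z with hz | hz
    · have : Ioi 0 ∩ Iic z = Iic z \ Iic (0 : ℝ) := by ext; simp [and_comm]
      rw [this, measureReal_sdiff (Iic_subset_Iic.2 hz.le) measurableSet_Iic,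
        gaussianReal_real_Iic, gaussianReal_real_Iic, sub_le_comm, le_normInv_iff hmem,
        zero_sub, stdPhi_neg, ← neg_sub z, stdPhi_neg]
      constructor <;> intro h <;> linarith
    · have : Ioi 0 ∩ Iic z = ∅ := by
        ext x; simp only [mem_inter_iff, mem_Ioi, mem_Iic, mem_empty_iff_false, iff_false]
        intro h; linarith
      rw [this, measureReal_empty]
      exact iff_of_false (not_le.2 (mul_pos hP hu.1)) (by linarith)

lemma hasDerivAt_quantileTN {u : ℝ} (hu : u ∈ Ioo (0 : ℝ) 1) (μ : ℝ) (a : Bool) :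
    HasDerivAt (fun μ => quantileTN u μ a) (upperQuantileDeriv (level a u) (sgn a * μ)) μ := by
  simp_rw [quantileTN_eq hu]
  have h1 : HasDerivAt (fun μ => sgn a * μ) (sgn a) μ := by
    simpa using (hasDerivAt_id μ).const_mul (sgn a)
  have h := ((hasDerivAt_upperQuantile (level_mem a hu) (sgn a * μ)).comp μ h1).const_mul (sgn a)
  refine h.congr_deriv ?_
  rw [mul_comm (upperQuantileDeriv _ _), sgn_mul_sgn_mul]

/-- A version of the inverse cdf of `TN(μ, 1; a)` which is jointly measurable in the level `u` and
in `μ`. -/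
def truncSample (a : Bool) (u μ : ℝ) : ℝ := sgn a * upperQuantile (level a u) (sgn a * μ)

lemma measurable_truncSample (a : Bool) :
    Measurable fun q : ℝ × ℝ => truncSample a q.1 q.2 := by
  unfold truncSample
  have := measurable_level a
  exact (measurable_upperQuantile.comp (f := fun q : ℝ × ℝ => (level a q.1, sgn a * q.2))
    (by fun_prop)).const_mul _

lemma map_truncSample (a : Bool) (μ : ℝ) :
    (volume.restrict (Ioo 0 1)).map (fun u => truncSample a u μ) = truncNormal μ a := by
  rw [← map_quantile (truncNormal μ a)]
  refine Measure.map_congr ?_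
  filter_upwards [ae_restrict_mem measurableSet_Ioo] with u hu
  exact (quantileTN_eq hu μ a).symm

/-! ## The largest eigenvalue -/

/-- The matrix inequality M ≤ c·1 is read once on the spectrum and once on the quadratic form. For p
= 0 the spectrum is empty and its `sSup` is 0, so the equivalence would fail for c < 0. -/
lemma lambdaMax_le_iff {p : ℕ} (hp : 0 < p) {M : Matrix (Fin p) (Fin p) ℝ} (hM : M.IsHermitian)
    (c : ℝ) : lambdaMax M ≤ c ↔ ∀ x, x ⬝ᵥ (M *ᵥ x) ≤ c * (x ⬝ᵥ x) := by
  have : Nonempty (Fin p) := ⟨⟨0, hp⟩⟩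
  have hs := hM.spectrum_real_eq_range_eigenvalues
  have hbdd : BddAbove (spectrum ℝ M) := by rw [hs]; exact (finite_range _).bddAbove
  have hne : (spectrum ℝ M).Nonempty := by rw [hs]; exact range_nonempty _
  have hsa : IsSelfAdjoint M := hM
  have hH : ((algebraMap ℝ (Matrix (Fin p) (Fin p) ℝ) c) - M).IsHermitian := by
    refine Matrix.IsHermitian.sub ?_ hM
    rw [Algebra.algebraMap_eq_smul_one]
    simp [Matrix.IsHermitian]
  rw [lambdaMax, csSup_le_iff hbdd hne, ← le_algebraMap_iff_spectrum_le (p := IsSelfAdjoint) hsa,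
    Matrix.le_iff, posSemidef_iff_dotProduct_mulVec, and_iff_right hH]
  refine forall_congr' fun x => ?_
  rw [Algebra.algebraMap_eq_smul_one, sub_mulVec, dotProduct_sub, smul_mulVec, one_mulVec,
    dotProduct_smul, sub_nonneg, smul_eq_mul, star_trivial]

namespace ProbitModel

variable {n p : ℕ} {D : ProbitModel n p}

/-! ## The geometry of the norm `‖·‖_Σ` -/

/-- The linear map of the matrix `Σ ^ (1/2)`. -/
def sqrtMap (D : ProbitModel n p) :
    EuclideanSpace ℝ (Fin p) →L[ℝ] EuclideanSpace ℝ (Fin p) :=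
  toEuclideanCLM (𝕜 := ℝ) (CFC.sqrt D.Sig)

/-- Σ^(1/2) is an isometry from the Σ inner product to the Euclidean one, so Cauchy-Schwarz and norm
identities can be used for `sigNorm`. -/
lemma inner_sqrtMap (hS : D.Sig.PosDef) (a b : EuclideanSpace ℝ (Fin p)) :
    inner ℝ (D.sqrtMap a) (D.sqrtMap b) = a.ofLp ⬝ᵥ (D.Sig *ᵥ b.ofLp) := by
  have hsymm : (CFC.sqrt D.Sig)ᵀ = CFC.sqrt D.Sig := by
    have h : IsSelfAdjoint (CFC.sqrt D.Sig) := (CFC.sqrt_nonneg D.Sig).isSelfAdjoint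
    simpa [IsSelfAdjoint, star_eq_conjTranspose] using h
  have hsq : CFC.sqrt D.Sig * CFC.sqrt D.Sig = D.Sig :=
    CFC.sqrt_mul_sqrt_self _ hS.posSemidef.nonneg
  rw [sqrtMap, inner_toEuclideanCLM, ofLp_toEuclideanCLM]
  conv_rhs => rw [← hsq, ← mulVec_mulVec, dotProduct_mulVec]
  nth_rw 3 [← hsymm]
  rw [vecMul_transpose]

lemma sigNorm_eq (hS : D.Sig.PosDef) (a : EuclideanSpace ℝ (Fin p)) :
    D.sigNorm a = ‖D.sqrtMap a‖ := by
  rw [sigNorm, ← inner_sqrtMap hS, real_inner_self_eq_norm_sq, Real.sqrt_sq (norm_nonneg _)]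

lemma sigNorm_nonneg (a : EuclideanSpace ℝ (Fin p)) : 0 ≤ D.sigNorm a := Real.sqrt_nonneg _

lemma sigNorm_sq (hS : D.Sig.PosDef) (a : EuclideanSpace ℝ (Fin p)) :
    D.sigNorm a ^ 2 = a.ofLp ⬝ᵥ (D.Sig *ᵥ a.ofLp) := by
  rw [sigNorm_eq hS, ← real_inner_self_eq_norm_sq, inner_sqrtMap hS]

lemma sigNorm_pos (hS : D.Sig.PosDef) {a : EuclideanSpace ℝ (Fin p)} (ha : a ≠ 0) :
    0 < D.sigNorm a := by
  refine Real.sqrt_pos.2 ?_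
  have := hS.dotProduct_mulVec_pos (x := a.ofLp) (by simpa using ha)
  simpa using this

lemma isUnit_det_Sig (hS : D.Sig.PosDef) : IsUnit D.Sig.det :=
  (Matrix.isUnit_iff_isUnit_det _).1 hS.isUnit

lemma isUnit_sqrt_Sig (hS : D.Sig.PosDef) : IsUnit (CFC.sqrt D.Sig).det := by
  have hsq : CFC.sqrt D.Sig * CFC.sqrt D.Sig = D.Sig :=
    CFC.sqrt_mul_sqrt_self _ hS.posSemidef.nonneg
  have h := isUnit_det_Sig hS
  rw [← hsq, det_mul] at h
  exact isUnit_of_mul_isUnit_left h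

lemma sqrtMap_SigInvSqrt (hS : D.Sig.PosDef) (x : Fin p → ℝ) :
    D.sqrtMap (WithLp.toLp 2 (D.SigInvSqrt *ᵥ x)) = WithLp.toLp 2 x := by
  rw [sqrtMap, toEuclideanCLM_toLp, mulVec_mulVec, SigInvSqrt,
    mul_nonsing_inv _ (isUnit_sqrt_Sig hS), one_mulVec]

lemma sqrt_inv_Sig (hS : D.Sig.PosDef) : CFC.sqrt D.Sig⁻¹ = D.SigInvSqrt := by
  have hsq : CFC.sqrt D.Sig * CFC.sqrt D.Sig = D.Sig :=
    CFC.sqrt_mul_sqrt_self _ hS.posSemidef.nonneg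
  refine CFC.sqrt_unique ?_ ?_
  · rw [SigInvSqrt, ← Matrix.mul_inv_rev, hsq]
  · have h : (CFC.sqrt D.Sig).PosSemidef :=
      nonneg_iff_posSemidef.1 (CFC.sqrt_nonneg D.Sig)
    exact nonneg_iff_posSemidef.2 h.inv

/-- In the Σ inner product the factor Σ⁻¹ of the update disappears; later computations with
conditional means rest on this. -/
lemma inner_sqrtMap_solve (hS : D.Sig.PosDef) (w : EuclideanSpace ℝ (Fin p)) (b : Fin p → ℝ) :
    inner ℝ (D.sqrtMap w) (D.sqrtMap (WithLp.toLp 2 (D.Sig⁻¹ *ᵥ b))) = w.ofLp ⬝ᵥ b := by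
  rw [inner_sqrtMap hS, mulVec_mulVec, mul_nonsing_inv _ (isUnit_det_Sig hS), one_mulVec]

lemma inner_sqrtMap_solve_design (hS : D.Sig.PosDef) (w : EuclideanSpace ℝ (Fin p))
    (z : Fin n → ℝ) :
    inner ℝ (D.sqrtMap w) (D.sqrtMap (WithLp.toLp 2 (D.Sig⁻¹ *ᵥ (D.Xᵀ *ᵥ z)))) =
      ∑ i, D.lin i w * z i := by
  rw [inner_sqrtMap_solve hS, dotProduct_mulVec, vecMul_transpose]
  rfl

lemma continuous_sigNorm (hS : D.Sig.PosDef) : Continuous D.sigNorm := by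
  rw [show D.sigNorm = fun a => ‖D.sqrtMap a‖ from funext (sigNorm_eq hS)]
  fun_prop

lemma continuous_lin (i : Fin n) : Continuous (D.lin i) := by
  unfold lin mulVec dotProduct; fun_prop

lemma lin_add (i : Fin n) (a b : EuclideanSpace ℝ (Fin p)) :
    D.lin i (a + b) = D.lin i a + D.lin i b := by simp [lin, mulVec_add]

lemma lin_sub (i : Fin n) (a b : EuclideanSpace ℝ (Fin p)) :
    D.lin i (a - b) = D.lin i a - D.lin i b := by simp [lin, mulVec_sub]

lemma lin_smul (i : Fin n) (t : ℝ) (a : EuclideanSpace ℝ (Fin p)) :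
    D.lin i (t • a) = t * D.lin i a := by simp [lin, mulVec_smul]

lemma sum_lin_sq_add (hS : D.Sig.PosDef) (a : EuclideanSpace ℝ (Fin p)) :
    D.sigNorm a ^ 2 = ∑ i, D.lin i a ^ 2 + a.ofLp ⬝ᵥ (D.Q *ᵥ a.ofLp) := by
  rw [sigNorm_sq hS, Sig, add_mulVec, dotProduct_add, ← mulVec_mulVec, dotProduct_mulVec,
    vecMul_transpose]
  simp [dotProduct, lin, sq]

/-- The Cauchy-Schwarz inequality for the form `∑ sᵢ aᵢ bᵢ`, in terms of bounds on its diagonal. -/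
lemma sum_mul_lin_le {s : Fin n → ℝ} (hs : ∀ i, 0 ≤ s i) {c d A B : ℝ} (hc : 0 ≤ c) (hA : 0 ≤ A)
    (hB : 0 ≤ B) (hd : 0 ≤ d) (a b : EuclideanSpace ℝ (Fin p))
    (h1 : ∑ i, s i * D.lin i a ^ 2 ≤ c ^ 2 * A ^ 2)
    (h2 : ∑ i, s i * D.lin i b ^ 2 ≤ d ^ 2 * B ^ 2) :
    ∑ i, D.lin i a * (s i * D.lin i b) ≤ (c * A) * (d * B) := by
  have h := Finset.sum_mul_sq_le_sq_mul_sq Finset.univ (fun i => √(s i) * D.lin i a)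
    (fun i => √(s i) * D.lin i b)
  simp only [mul_pow, Real.sq_sqrt (hs _)] at h
  have e : ∑ i, √(s i) * D.lin i a * (√(s i) * D.lin i b) =
      ∑ i, D.lin i a * (s i * D.lin i b) := Finset.sum_congr rfl fun i _ => by
    nth_rw 3 [← Real.mul_self_sqrt (hs i)]; ring
  rw [e] at h
  refine abs_le_of_sq_le_sq' (h.trans ?_) (by positivity) |>.2
  have h3 : 0 ≤ ∑ i, s i * D.lin i b ^ 2 :=
    Finset.sum_nonneg fun i _ => mul_nonneg (hs i) (sq_nonneg _)
  calc _ ≤ (c ^ 2 * A ^ 2) * (d ^ 2 * B ^ 2) := mul_le_mul h1 h2 h3 (by positivity)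
    _ = _ := by ring

/-! ## The largest eigenvalue of `Σ^(-1/2) Xᵀ diag(s) X Σ^(-1/2)` -/

/-- `λ_max (Σ^(-1/2) Xᵀ diag(s) X Σ^(-1/2))`. -/
def gramMax (D : ProbitModel n p) (s : Fin n → ℝ) : ℝ :=
  lambdaMax (D.SigInvSqrt * D.Xᵀ * Matrix.diagonal s * D.X * D.SigInvSqrt)

lemma SigInvSqrt_transpose : D.SigInvSqrtᵀ = D.SigInvSqrt := by
  have h : IsSelfAdjoint (CFC.sqrt D.Sig) := (CFC.sqrt_nonneg D.Sig).isSelfAdjoint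
  have hsymm : (CFC.sqrt D.Sig)ᵀ = CFC.sqrt D.Sig := by
    simpa [IsSelfAdjoint, star_eq_conjTranspose] using h
  rw [SigInvSqrt, transpose_nonsing_inv, hsymm]

/-- The substitution β = Σ^(-1/2) x turns the Rayleigh quotient of the symmetrized matrix into that
of Xᵀ diag(s) X relative to Σ. -/
lemma gramMax_le_iff (hp : 0 < p) (hS : D.Sig.PosDef) (s : Fin n → ℝ) (c : ℝ) :
    D.gramMax s ≤ c ↔
      ∀ β, ∑ i, s i * D.lin i β ^ 2 ≤ c * D.sigNorm β ^ 2 := by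
  have hH : (D.SigInvSqrt * D.Xᵀ * Matrix.diagonal s * D.X * D.SigInvSqrt).IsHermitian := by
    rw [Matrix.IsHermitian, conjTranspose_eq_transpose_of_trivial]
    simp [transpose_mul, SigInvSqrt_transpose, Matrix.mul_assoc]
  have key : ∀ x : Fin p → ℝ,
      x ⬝ᵥ ((D.SigInvSqrt * D.Xᵀ * Matrix.diagonal s * D.X * D.SigInvSqrt) *ᵥ x) =
        ∑ i, s i * D.lin i (WithLp.toLp 2 (D.SigInvSqrt *ᵥ x)) ^ 2 := by
    intro x
    simp only [← mulVec_mulVec]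
    rw [dotProduct_mulVec]
    nth_rw 1 [← SigInvSqrt_transpose]
    rw [vecMul_transpose, dotProduct_mulVec, vecMul_transpose]
    simp only [dotProduct, mulVec_diagonal, lin]
    exact Finset.sum_congr rfl fun i _ => by ring
  have hn : ∀ x : Fin p → ℝ,
      D.sigNorm (WithLp.toLp 2 (D.SigInvSqrt *ᵥ x)) ^ 2 = x ⬝ᵥ x := by
    intro x
    rw [sigNorm_eq hS, sqrtMap_SigInvSqrt hS, EuclideanSpace.real_norm_sq_eq]
    simp [dotProduct, sq]
  rw [gramMax, lambdaMax_le_iff hp hH]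
  simp only [key, ← hn]
  refine ⟨fun h β => ?_, fun h x => h _⟩
  have := h (CFC.sqrt D.Sig *ᵥ β.ofLp)
  rwa [SigInvSqrt, mulVec_mulVec, nonsing_inv_mul _ (isUnit_sqrt_Sig hS), one_mulVec] at this

lemma sum_lin_sq_le_gramMax (hp : 0 < p) (hS : D.Sig.PosDef) (s : Fin n → ℝ)
    (β : EuclideanSpace ℝ (Fin p)) :
    ∑ i, s i * D.lin i β ^ 2 ≤ D.gramMax s * D.sigNorm β ^ 2 :=
  (gramMax_le_iff hp hS s _).1 le_rfl β

lemma gramMax_nonneg (hp : 0 < p) (hS : D.Sig.PosDef) {s : Fin n → ℝ} (hs : ∀ i, 0 ≤ s i) :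
    0 ≤ D.gramMax s := by
  have hne : (EuclideanSpace.single (⟨0, hp⟩ : Fin p) (1 : ℝ)) ≠ 0 := by simp
  have h1 := sum_lin_sq_le_gramMax hp hS s (EuclideanSpace.single (⟨0, hp⟩ : Fin p) (1 : ℝ))
  have h2 : 0 ≤ ∑ i, s i * D.lin i (EuclideanSpace.single (⟨0, hp⟩ : Fin p) (1 : ℝ)) ^ 2 :=
    Finset.sum_nonneg fun i _ => mul_nonneg (hs i) (sq_nonneg _)
  exact nonneg_of_mul_nonneg_left (h2.trans h1) (pow_pos (sigNorm_pos hS hne) 2)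

lemma posSemidef_Q (hQ : D.Q.PosDef ∨ D.Q = 0) : D.Q.PosSemidef :=
  hQ.elim (·.posSemidef) (fun h => h ▸ .zero)

lemma quad_Q_nonneg (hQ : D.Q.PosDef ∨ D.Q = 0) (a : EuclideanSpace ℝ (Fin p)) :
    0 ≤ a.ofLp ⬝ᵥ (D.Q *ᵥ a.ofLp) := by
  simpa using (posSemidef_Q hQ).dotProduct_mulVec_nonneg a.ofLp

/-- Xᵀ diag(s) X ≤ c XᵀX ≤ c Σ; the last inequality is Q ≥ 0. -/
lemma sum_mul_lin_sq_le (hQ : D.Q.PosDef ∨ D.Q = 0) (hS : D.Sig.PosDef) {s : Fin n → ℝ} {c : ℝ}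
    (hc : 0 ≤ c) (hs : ∀ i, s i ≤ c) (β : EuclideanSpace ℝ (Fin p)) :
    ∑ i, s i * D.lin i β ^ 2 ≤ c * D.sigNorm β ^ 2 := by
  rw [sum_lin_sq_add hS]
  calc ∑ i, s i * D.lin i β ^ 2 ≤ ∑ i, c * D.lin i β ^ 2 :=
        Finset.sum_le_sum fun i _ => mul_le_mul_of_nonneg_right (hs i) (sq_nonneg _)
    _ ≤ _ := by
        rw [← Finset.mul_sum]
        exact mul_le_mul_of_nonneg_left (le_add_of_nonneg_right (quad_Q_nonneg hQ β)) hc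

/-- As a supremum of linear functions of s, `gramMax` has closed sublevel sets; the intersection
over β is uncountable, but each of its members is closed. -/
lemma measurable_gramMax (hp : 0 < p) (hS : D.Sig.PosDef) : Measurable D.gramMax := by
  refine measurable_of_Iic fun c => ?_
  have : D.gramMax ⁻¹' Iic c =
      ⋂ β, {s : Fin n → ℝ | ∑ i, s i * D.lin i β ^ 2 ≤ c * D.sigNorm β ^ 2} := by
    ext s
    rw [mem_preimage, mem_Iic, gramMax_le_iff hp hS, mem_iInter]
    rfl
  rw [this]
  exact (isClosed_iInter fun β => isClosed_le (by fun_prop) (by fun_prop)).measurableSet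

lemma exists_norm_le_sigNorm (hS : D.Sig.PosDef) :
    ∃ C : ℝ, 0 ≤ C ∧ ∀ a : EuclideanSpace ℝ (Fin p), ‖a‖ ≤ C * D.sigNorm a := by
  refine ⟨‖toEuclideanCLM (𝕜 := ℝ) D.SigInvSqrt‖, norm_nonneg _, fun a => ?_⟩
  have h : toEuclideanCLM (𝕜 := ℝ) D.SigInvSqrt (D.sqrtMap a) = a := by
    rw [sqrtMap, ← ContinuousLinearMap.comp_apply, ← ContinuousLinearMap.mul_def, ← map_mul,
      SigInvSqrt, nonsing_inv_mul _ (isUnit_sqrt_Sig hS), map_one]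
    rfl
  rw [sigNorm_eq hS]
  nth_rw 1 [← h]
  exact ContinuousLinearMap.le_opNorm _ _

/-! ## Coercivity of the log-posterior -/

lemma dotProduct_Q_comm (hQ : D.Q.PosDef ∨ D.Q = 0) (a b : Fin p → ℝ) :
    a ⬝ᵥ (D.Q *ᵥ b) = b ⬝ᵥ (D.Q *ᵥ a) := by
  have h : D.Qᵀ = D.Q := by
    have := (posSemidef_Q hQ).isHermitian
    rwa [Matrix.IsHermitian, conjTranspose_eq_transpose_of_trivial] at this
  rw [dotProduct_comm, dotProduct_mulVec b]
  nth_rw 2 [← h]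
  rw [vecMul_transpose]

/-- The logarithm of the unnormalized posterior density. -/
def logPost (D : ProbitModel n p) (β : EuclideanSpace ℝ (Fin p)) : ℝ :=
  ∑ i, Real.log (stdPhi (sgn (D.y i) * D.lin i β)) +
    -(1 / 2) * ((β - D.v).ofLp ⬝ᵥ (D.Q *ᵥ (β - D.v).ofLp))

lemma postDensity_eq (β : EuclideanSpace ℝ (Fin p)) :
    D.postDensity β = (∏ i, stdPhi (sgn (D.y i) * D.lin i β)) * D.prior β := by
  rw [postDensity]
  congr 1
  refine Finset.prod_congr rfl fun i _ => ?_
  cases D.y i <;> simp [sgn, stdPhi_neg]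

lemma postDensity_eq_exp (β : EuclideanSpace ℝ (Fin p)) :
    D.postDensity β = Real.exp (D.logPost β) := by
  rw [postDensity_eq, logPost, Real.exp_add, Real.exp_sum, prior]
  congr 1
  exact Finset.prod_congr rfl fun i _ => (Real.exp_log (stdPhi_pos _)).symm

lemma postDensity_pos (β : EuclideanSpace ℝ (Fin p)) : 0 < D.postDensity β := by
  rw [postDensity_eq_exp]; exact Real.exp_pos _

lemma continuous_logPost : Continuous D.logPost := by
  unfold logPost
  refine (continuous_finsetSum _ fun i _ => ?_).add ?_
  · exact (continuous_stdPhi.comp ((continuous_lin i).const_mul _)).log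
      fun β => (stdPhi_pos _).ne'
  · unfold mulVec dotProduct; fun_prop

lemma continuous_postDensity : Continuous D.postDensity := by
  rw [show D.postDensity = _ from funext postDensity_eq_exp]
  exact Real.continuous_exp.comp continuous_logPost

/-- A quadratically homogeneous lower bound for the decay of the log-posterior. -/
def deficit (D : ProbitModel n p) (α : EuclideanSpace ℝ (Fin p)) : ℝ :=
  α.ofLp ⬝ᵥ (D.Q *ᵥ α.ofLp) + ∑ i, min (sgn (D.y i) * D.lin i α) 0 ^ 2

lemma continuous_deficit : Continuous D.deficit := by
  unfold deficit
  have := continuous_lin (D := D)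
  refine Continuous.add ?_ (by fun_prop)
  unfold mulVec dotProduct; fun_prop

lemma deficit_smul {t : ℝ} (ht : 0 ≤ t) (α : EuclideanSpace ℝ (Fin p)) :
    D.deficit (t • α) = t ^ 2 * D.deficit α := by
  have h : ∀ i, min (sgn (D.y i) * D.lin i (t • α)) 0 =
      t * min (sgn (D.y i) * D.lin i α) 0 := fun i => by
    rw [lin_smul, mul_left_comm, mul_min_of_nonneg _ _ ht, mul_zero]
  simp only [deficit, h, mul_pow, ← Finset.mul_sum, WithLp.ofLp_smul, mulVec_smul,
    smul_dotProduct, dotProduct_smul, smul_eq_mul]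
  ring

/-- With a flat prior the density does not decrease along α. It is therefore at least its minimum
over the unit ball on infinitely many disjoint translates of that ball, a set of infinite volume. -/
lemma not_proper_of_direction (hQ : D.Q = 0) {α : EuclideanSpace ℝ (Fin p)} (hα : α ≠ 0)
    (h : ∀ i, 0 ≤ sgn (D.y i) * D.lin i α) : ¬ D.Proper := by
  intro hprop
  have hmono : ∀ (t : ℝ), 0 ≤ t → ∀ β, D.postDensity β ≤ D.postDensity (β + t • α) := by
    intro t ht β
    simp only [postDensity_eq, prior, hQ, zero_mulVec, dotProduct_zero]
    gcongr with i
    · exact fun i _ => (stdPhi_pos _).le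
    · refine strictMono_stdPhi.monotone ?_
      rw [lin_add, lin_smul, mul_add]
      nlinarith [mul_nonneg ht (h i)]
  obtain ⟨β₀, -, hβ₀⟩ := (isCompact_closedBall (0 : EuclideanSpace ℝ (Fin p)) 1).exists_isMinOn
    ⟨0, by simp⟩ continuous_postDensity.continuousOn
  have hfin : volume {β | D.postDensity β₀ ≤ D.postDensity β} < ∞ := by
    have := hprop.measure_norm_ge_lt_top (postDensity_pos (D := D) β₀)
    simpa [abs_of_pos (postDensity_pos (D := D) _)] using this
  have hαn : 0 < ‖α‖ := norm_pos_iff.2 hα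
  -- Consecutive centres are at distance 3, more than twice the radius.
  set e : ℕ → EuclideanSpace ℝ (Fin p) := fun k => ((k : ℝ) * (3 / ‖α‖)) • α
  have hsub : (⋃ k, Metric.ball (e k) 1) ⊆ {β | D.postDensity β₀ ≤ D.postDensity β} := by
    refine iUnion_subset fun k β hβ => ?_
    have h1 : β - e k ∈ Metric.closedBall (0 : EuclideanSpace ℝ (Fin p)) 1 := by
      rw [mem_closedBall_zero_iff, ← dist_eq_norm]; exact (Metric.mem_ball.1 hβ).le
    refine (hβ₀ h1).trans ((hmono ((k : ℝ) * (3 / ‖α‖)) (by positivity) _).trans_eq ?_)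
    simp [e]
  have hdisj : Pairwise (Function.onFun Disjoint fun k => Metric.ball (e k) 1) := by
    intro j k hjk
    refine Metric.ball_disjoint_ball ?_
    have hjk' : (1 : ℝ) ≤ |(j : ℝ) - k| := by
      have : (1 : ℤ) ≤ |(j : ℤ) - k| := Int.one_le_abs (by omega)
      exact_mod_cast this
    have : dist (e j) (e k) = |(j : ℝ) - k| * 3 := by
      rw [dist_eq_norm, ← sub_smul, ← sub_mul, norm_smul, Real.norm_eq_abs, abs_mul,
        abs_of_pos (by positivity : 0 < 3 / ‖α‖)]
      field_simp
    rw [this]; linarith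
  have htop : volume (⋃ k, Metric.ball (e k) 1) = ∞ := by
    rw [measure_iUnion hdisj fun k => measurableSet_ball]
    have : ∀ k, volume (Metric.ball (e k) 1) =
        volume (Metric.ball (0 : EuclideanSpace ℝ (Fin p)) 1) :=
      fun k => Measure.addHaar_ball_center _ _ _
    simp_rw [this]
    exact ENNReal.tsum_const_eq_top_of_ne_zero (Metric.measure_ball_pos _ _ one_pos).ne'
  exact hfin.ne (measure_mono_top hsub htop)

/-- For positive definite Q the quadratic term suffices. For Q = 0 a vanishing deficit would make
every signed predictor nonnegative along α, which propriety forbids. -/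
lemma deficit_pos (hQ : D.Q.PosDef ∨ D.Q = 0) (hproper : D.Proper)
    {α : EuclideanSpace ℝ (Fin p)} (hα : α ≠ 0) : 0 < D.deficit α := by
  have h2 : 0 ≤ ∑ i, min (sgn (D.y i) * D.lin i α) 0 ^ 2 :=
    Finset.sum_nonneg fun i _ => sq_nonneg _
  rcases hQ with hQ | hQ
  · have := hQ.dotProduct_mulVec_pos (x := α.ofLp) (by simpa using hα)
    rw [star_trivial] at this
    exact add_pos_of_pos_of_nonneg this h2
  · simp only [deficit, hQ, zero_mulVec, dotProduct_zero, zero_add]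
    refine lt_of_le_of_ne h2 fun h => ?_
    refine not_proper_of_direction hQ hα (fun i => ?_) hproper
    have := (Finset.sum_eq_zero_iff_of_nonneg fun i _ => sq_nonneg _).1 h.symm i
      (Finset.mem_univ i)
    exact min_eq_right_iff.1 (pow_eq_zero_iff two_ne_zero |>.1 this)

/-- Continuity gives a positive minimum on the unit sphere, and homogeneity of degree 2 extends the
bound to all α. -/
lemma exists_le_deficit (hp : 0 < p) (hQ : D.Q.PosDef ∨ D.Q = 0) (hproper : D.Proper) :
    ∃ c > 0, ∀ α, c * ‖α‖ ^ 2 ≤ D.deficit α := by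
  have : Nontrivial (EuclideanSpace ℝ (Fin p)) :=
    ⟨EuclideanSpace.single (⟨0, hp⟩ : Fin p) (1 : ℝ), 0, by simp⟩
  obtain ⟨α₀, h₀, hmin⟩ := (isCompact_sphere (0 : EuclideanSpace ℝ (Fin p)) 1).exists_isMinOn
    (NormedSpace.sphere_nonempty.2 zero_le_one) (continuous_deficit (D := D)).continuousOn
  have hα₀ : α₀ ≠ 0 := by rintro rfl; simp at h₀
  refine ⟨D.deficit α₀, deficit_pos hQ hproper hα₀, fun α => ?_⟩
  rcases eq_or_ne α 0 with rfl | hα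
  · simp [deficit, lin]
  have hαn : 0 < ‖α‖ := norm_pos_iff.2 hα
  have hm : ‖α‖⁻¹ • α ∈ Metric.sphere (0 : EuclideanSpace ℝ (Fin p)) 1 := by
    simp [norm_smul, hαn.ne']
  have h := hmin hm
  rw [mem_ofPred_eq, deficit_smul (by positivity)] at h
  calc D.deficit α₀ * ‖α‖ ^ 2 ≤ ‖α‖⁻¹ ^ 2 * D.deficit α * ‖α‖ ^ 2 := by gcongr
    _ = D.deficit α := by field_simp

/-- The form αᵀΣα dominates the deficit, which keeps only the negative parts of the predictors. -/
lemma posDef_Sig (hQ : D.Q.PosDef ∨ D.Q = 0) (hproper : D.Proper) : D.Sig.PosDef := by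
  refine PosDef.of_dotProduct_mulVec_pos ?_ fun x hx => ?_
  · refine Matrix.IsHermitian.add ?_ (posSemidef_Q hQ).isHermitian
    simpa [conjTranspose_eq_transpose_of_trivial] using isHermitian_conjTranspose_mul_self D.X
  · have h := deficit_pos hQ hproper (α := WithLp.toLp 2 x) (by simpa using hx)
    have hle : ∑ i, min (sgn (D.y i) * D.lin i (WithLp.toLp 2 x)) 0 ^ 2 ≤
        ∑ i, (D.X *ᵥ x) i * (D.X *ᵥ x) i := by
      refine Finset.sum_le_sum fun i _ => ?_
      have h1 : (sgn (D.y i) * D.lin i (WithLp.toLp 2 x)) ^ 2 =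
          (D.X *ᵥ x) i * (D.X *ᵥ x) i := by
        rw [mul_pow, sq (sgn _), sgn_mul_self, one_mul, sq]; rfl
      rw [← h1]
      rcases min_choice (sgn (D.y i) * D.lin i (WithLp.toLp 2 x)) 0 with h | h <;> rw [h]
      simp [sq_nonneg]
    rw [deficit] at h
    rw [star_trivial, Sig, add_mulVec, dotProduct_add, ← mulVec_mulVec, dotProduct_mulVec,
      vecMul_transpose]
    have hle' : _ ≤ (D.X *ᵥ x) ⬝ᵥ (D.X *ᵥ x) := hle
    refine h.trans_le ?_
    change x ⬝ᵥ (D.Q *ᵥ x) + _ ≤ _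
    linarith

lemma exists_logPost_le (hp : 0 < p) (hQ : D.Q.PosDef ∨ D.Q = 0) (hproper : D.Proper) :
    ∃ c > 0, ∃ K, ∀ β, D.logPost β ≤ K - c * ‖β‖ ^ 2 := by
  obtain ⟨c, hc, h⟩ := exists_le_deficit hp hQ hproper
  refine ⟨c / 4, by positivity, D.v.ofLp ⬝ᵥ (D.Q *ᵥ D.v.ofLp) / 2, fun β => ?_⟩
  have h1 : ∑ i, Real.log (stdPhi (sgn (D.y i) * D.lin i β)) ≤
      -(1 / 2) * ∑ i, min (sgn (D.y i) * D.lin i β) 0 ^ 2 := by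
    rw [Finset.mul_sum]
    refine Finset.sum_le_sum fun i _ => ?_
    rw [Real.log_le_iff_le_exp (stdPhi_pos _)]
    convert stdPhi_le_exp _ using 2
    ring
  have hnn : 0 ≤ ∑ i, min (sgn (D.y i) * D.lin i β) 0 ^ 2 :=
    Finset.sum_nonneg fun i _ => sq_nonneg _
  -- Nonnegativity of the form at β - 2v says (β - v)ᵀQ(β - v) ≥ βᵀQβ/2 - vᵀQv. With the factor -1/2
  -- of the prior this explains c/4 and the constant vᵀQv/2.
  have h2 := quad_Q_nonneg hQ (β - (2 : ℝ) • D.v)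
  have h3 := h β
  rw [deficit] at h3
  rw [logPost]
  simp only [WithLp.ofLp_sub, WithLp.ofLp_smul, mulVec_sub, mulVec_smul, sub_dotProduct,
    dotProduct_sub, smul_dotProduct, dotProduct_smul, smul_eq_mul,
    dotProduct_Q_comm hQ D.v.ofLp β.ofLp] at h2 ⊢
  nlinarith

/-! ## The mean map and the mode -/

/-- The mean of the next state of the chain. -/
def meanMap (D : ProbitModel n p) (β : EuclideanSpace ℝ (Fin p)) : EuclideanSpace ℝ (Fin p) :=
  D.condMean fun i => truncMean (D.lin i β) (D.y i)

lemma inner_condMean (hS : D.Sig.PosDef) (w : EuclideanSpace ℝ (Fin p)) (z : Fin n → ℝ) :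
    inner ℝ (D.sqrtMap w) (D.sqrtMap (D.condMean z)) =
      ∑ i, D.lin i w * z i + w.ofLp ⬝ᵥ (D.Q *ᵥ D.v.ofLp) := by
  rw [condMean, inner_sqrtMap_solve hS, dotProduct_add, dotProduct_mulVec, vecMul_transpose]
  rfl

lemma hasDerivAt_lin_line (i : Fin n) (β α : EuclideanSpace ℝ (Fin p)) (t : ℝ) :
    HasDerivAt (fun t : ℝ => D.lin i (β + t • α)) (D.lin i α) t := by
  simp_rw [lin_add, lin_smul]
  simpa using ((hasDerivAt_id t).mul_const (D.lin i α)).const_add (D.lin i β)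

/-- The Euclidean gradient Xᵀ(`truncMean` - Xβ) - Q(β - v) equals Σ(`meanMap β` - β); so, for the Σ
inner product, the gradient is the expected displacement of the chain. -/
lemma hasDerivAt_logPost (hQ : D.Q.PosDef ∨ D.Q = 0) (hS : D.Sig.PosDef)
    (β α : EuclideanSpace ℝ (Fin p)) (t : ℝ) :
    HasDerivAt (fun t : ℝ => D.logPost (β + t • α))
      (inner ℝ (D.sqrtMap α) (D.sqrtMap (D.meanMap (β + t • α) - (β + t • α)))) t := by
  have h1 : ∀ i, HasDerivAt (fun t : ℝ => Real.log (stdPhi (sgn (D.y i) * D.lin i (β + t • α))))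
      (D.lin i α * (sgn (D.y i) * mills (sgn (D.y i) * D.lin i (β + t • α)))) t := by
    intro i
    have h := ((hasDerivAt_stdPhi _).comp t
      ((hasDerivAt_lin_line (D := D) i β α t).const_mul (sgn (D.y i)))).log (stdPhi_pos _).ne'
    refine h.congr_deriv ?_
    rw [mills]; simp only [Function.comp_apply]; ring
  have h2 : HasDerivAt (fun t : ℝ => -(1 / 2) * ((β + t • α - D.v).ofLp ⬝ᵥ
      (D.Q *ᵥ (β + t • α - D.v).ofLp))) (-(α.ofLp ⬝ᵥ (D.Q *ᵥ (β + t • α - D.v).ofLp))) t := by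
    have e : ∀ t : ℝ, (β + t • α - D.v).ofLp ⬝ᵥ (D.Q *ᵥ (β + t • α - D.v).ofLp) =
        (β - D.v).ofLp ⬝ᵥ (D.Q *ᵥ (β - D.v).ofLp) + 2 * t * (α.ofLp ⬝ᵥ (D.Q *ᵥ (β - D.v).ofLp))
          + t ^ 2 * (α.ofLp ⬝ᵥ (D.Q *ᵥ α.ofLp)) := by
      intro t
      have e1 : β + t • α - D.v = (β - D.v) + t • α := by abel
      rw [e1]
      simp only [WithLp.ofLp_add, WithLp.ofLp_smul, mulVec_add, mulVec_smul, add_dotProduct,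
        dotProduct_add, smul_dotProduct, dotProduct_smul, smul_eq_mul,
        dotProduct_Q_comm hQ (β - D.v).ofLp α.ofLp]
      ring
    simp_rw [e]
    have hd := ((((hasDerivAt_id t).const_mul 2).mul_const
      (α.ofLp ⬝ᵥ (D.Q *ᵥ (β - D.v).ofLp))).const_add
        ((β - D.v).ofLp ⬝ᵥ (D.Q *ᵥ (β - D.v).ofLp))).add
      ((hasDerivAt_pow 2 t).mul_const (α.ofLp ⬝ᵥ (D.Q *ᵥ α.ofLp)))
    refine (hd.const_mul (-(1 / 2))).congr_deriv ?_
    have e1 : β + t • α - D.v = (β - D.v) + t • α := by abel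
    rw [e1]
    simp only [WithLp.ofLp_add, WithLp.ofLp_smul, mulVec_add, mulVec_smul,
      dotProduct_add, dotProduct_smul, smul_eq_mul]
    push_cast
    ring
  have h3 := (HasDerivAt.fun_sum (u := Finset.univ) fun i _ => h1 i).add h2
  refine h3.congr_deriv ?_
  rw [map_sub, inner_sub_right, meanMap, inner_condMean hS, inner_sqrtMap hS, Sig, add_mulVec,
    dotProduct_add, ← mulVec_mulVec, dotProduct_mulVec α.ofLp D.Xᵀ, vecMul_transpose]
  have e2 : (D.X *ᵥ α.ofLp) ⬝ᵥ (D.X *ᵥ (β + t • α).ofLp) =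
      ∑ i, D.lin i α * D.lin i (β + t • α) := rfl
  rw [e2, WithLp.ofLp_sub, mulVec_sub, dotProduct_sub]
  simp only [truncMean, mul_add, Finset.sum_add_distrib]
  ring

/-- First-order condition at a maximum, tested in the direction of the gradient itself. -/
lemma meanMap_eq_self (hQ : D.Q.PosDef ∨ D.Q = 0) (hS : D.Sig.PosDef)
    {βhat : EuclideanSpace ℝ (Fin p)} (h : ∀ β, D.logPost β ≤ D.logPost βhat) :
    D.meanMap βhat = βhat := by
  set α := D.meanMap βhat - βhat with hα
  have hd := hasDerivAt_logPost hQ hS βhat α 0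
  have hmax : IsLocalMax (fun t : ℝ => D.logPost (βhat + t • α)) 0 :=
    Filter.Eventually.of_forall fun t => by simpa using h _
  have h0 := hmax.hasDerivAt_eq_zero hd
  simp only [zero_smul, add_zero, ← hα, real_inner_self_eq_norm_sq, ← sigNorm_eq hS] at h0
  by_contra hne
  exact (pow_pos (sigNorm_pos hS (sub_ne_zero.2 hne)) 2).ne' h0

lemma exists_isMax_logPost (hp : 0 < p) (hQ : D.Q.PosDef ∨ D.Q = 0) (hproper : D.Proper) :
    ∃ βhat, ∀ β, D.logPost β ≤ D.logPost βhat := by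
  obtain ⟨c, hc, K, hK⟩ := exists_logPost_le hp hQ hproper
  refine continuous_logPost.exists_forall_ge ?_
  refine Filter.tendsto_atBot_mono hK ?_
  refine Filter.tendsto_atBot_add_const_left _ _ ?_
  refine Filter.tendsto_neg_atTop_atBot.comp ?_
  exact ((Filter.tendsto_pow_atTop two_ne_zero).comp
    (tendsto_norm_cocompact_atTop)).const_mul_atTop hc

/-! ## The drift constant -/

lemma Lam_eq (β : EuclideanSpace ℝ (Fin p)) :
    D.Lam β = Matrix.diagonal fun i => truncVar (sgn (D.y i) * D.lin i β) := by
  rw [Lam]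
  congr 1
  funext i
  cases D.y i <;> simp [sgn, truncVar, mills, stdPhi_neg, stdphi_neg, mul_div_assoc, neg_div]

/-- The derivative of the mean map at `β` in the direction `α`. -/
def meanMapDeriv (D : ProbitModel n p) (β α : EuclideanSpace ℝ (Fin p)) :
    EuclideanSpace ℝ (Fin p) :=
  WithLp.toLp 2 ((D.Sig⁻¹ * D.Xᵀ * D.Lam β * D.X) *ᵥ α.ofLp)

lemma inner_meanMapDeriv (hS : D.Sig.PosDef) (w β α : EuclideanSpace ℝ (Fin p)) :
    inner ℝ (D.sqrtMap w) (D.sqrtMap (D.meanMapDeriv β α)) =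
      ∑ i, D.lin i w * (truncVar (sgn (D.y i) * D.lin i β) * D.lin i α) := by
  rw [meanMapDeriv, Lam_eq]
  simp only [← mulVec_mulVec]
  rw [inner_sqrtMap_solve_design hS]
  simp only [mulVec_diagonal]
  rfl

/-- A coordinate whose signed predictor decreases along α has at β̂ + tα an argument bounded by its
value at β̂, so its truncated variance is at most 1 - δ. The other coordinates lose nothing but only
need variance at most 1. The total loss, together with the Q term, dominates a multiple of the
deficit, hence of ‖α‖², uniformly in t and in the size of α. -/
lemma exists_sigNorm_meanMapDeriv_le (hp : 0 < p) (hQ : D.Q.PosDef ∨ D.Q = 0)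
    (hproper : D.Proper) (βhat : EuclideanSpace ℝ (Fin p)) :
    ∃ κ : ℝ, 0 ≤ κ ∧ κ < 1 ∧ ∀ t ∈ Ioo (0 : ℝ) 1, ∀ α,
      D.sigNorm (D.meanMapDeriv (βhat + t • α) α) ≤ κ * D.sigNorm α := by
  have hS := posDef_Sig hQ hproper
  obtain ⟨c, hc, hdef⟩ := exists_le_deficit hp hQ hproper
  obtain ⟨δ, hδ, hvar⟩ := exists_truncVar_le (∑ i, |D.lin i βhat|)
  set N := ‖D.sqrtMap‖ + 1
  have hN : 0 < N := by positivity
  set κ₀ := 1 - min δ 1 * c / N ^ 2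
  have hκ₀ : κ₀ < 1 := sub_lt_self _ (by positivity)
  have key : ∀ t ∈ Ioo (0 : ℝ) 1, ∀ α,
      ∑ i, truncVar (sgn (D.y i) * D.lin i (βhat + t • α)) * D.lin i α ^ 2 ≤
        κ₀ * D.sigNorm α ^ 2 := by
    intro t ht α
    have h1 : ∑ i, truncVar (sgn (D.y i) * D.lin i (βhat + t • α)) * D.lin i α ^ 2 ≤
        ∑ i, (D.lin i α ^ 2 - min δ 1 * min (sgn (D.y i) * D.lin i α) 0 ^ 2) := by
      refine Finset.sum_le_sum fun i _ => ?_
      rcases le_total 0 (sgn (D.y i) * D.lin i α) with h | h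
      · rw [min_eq_right h]
        nlinarith [truncVar_lt_one (sgn (D.y i) * D.lin i (βhat + t • α)),
          sq_nonneg (D.lin i α)]
      · rw [min_eq_left h, mul_pow, sq (sgn _), sgn_mul_self, one_mul]
        have hle : sgn (D.y i) * D.lin i (βhat + t • α) ≤ ∑ i, |D.lin i βhat| := by
          rw [lin_add, lin_smul, mul_add, mul_left_comm]
          have h2 : sgn (D.y i) * D.lin i βhat ≤ |D.lin i βhat| := by
            refine (le_abs_self _).trans_eq ?_
            rw [abs_mul, abs_sgn, one_mul]
          have h3 := Finset.single_le_sum (f := fun i => |D.lin i βhat|)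
            (fun i _ => abs_nonneg _) (Finset.mem_univ i)
          have h4 := mul_nonpos_of_nonneg_of_nonpos ht.1.le h
          linarith
        nlinarith [hvar _ hle, min_le_left δ 1, sq_nonneg (D.lin i α)]
    have h5 : D.sigNorm α ≤ N * ‖α‖ := by
      rw [sigNorm_eq hS]
      refine (D.sqrtMap.le_opNorm α).trans ?_
      gcongr
      linarith
    have h6 : D.sigNorm α ^ 2 / N ^ 2 ≤ ‖α‖ ^ 2 := by
      rw [div_le_iff₀ (by positivity), mul_comm, ← mul_pow]
      exact pow_le_pow_left₀ (sigNorm_nonneg _) h5 2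
    have h7 := hdef α
    have h8 := quad_Q_nonneg hQ α
    have hm : 0 < min δ 1 := by positivity
    have hm1 : min δ 1 ≤ 1 := min_le_right _ _
    rw [deficit] at h7
    refine h1.trans ?_
    rw [Finset.sum_sub_distrib, ← Finset.mul_sum]
    have h9 := sum_lin_sq_add hS α
    have h10 : κ₀ * D.sigNorm α ^ 2 = D.sigNorm α ^ 2 -
        min δ 1 * (c * (D.sigNorm α ^ 2 / N ^ 2)) := by simp only [κ₀]; ring
    rw [h10]
    have h11 : min δ 1 * (c * (D.sigNorm α ^ 2 / N ^ 2)) ≤ min δ 1 *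
        (α.ofLp ⬝ᵥ (D.Q *ᵥ α.ofLp) + ∑ i, min (sgn (D.y i) * D.lin i α) 0 ^ 2) :=
      mul_le_mul_of_nonneg_left ((mul_le_mul_of_nonneg_left h6 hc.le).trans h7) hm.le
    nlinarith
  -- Cauchy-Schwarz for the form with weights `truncVar` gives ‖w‖² ≤ ‖w‖·√κ₀‖α‖ for the image w of
  -- α; the maximum with 0 makes the root legitimate for any sign of κ₀.
  refine ⟨√(max κ₀ 0), Real.sqrt_nonneg _, ?_, fun t ht α => ?_⟩
  · rw [Real.sqrt_lt' one_pos, one_pow]; exact max_lt hκ₀ one_pos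
  set w := D.meanMapDeriv (βhat + t • α) α
  have h1 := sum_mul_lin_le (s := fun i => truncVar (sgn (D.y i) * D.lin i (βhat + t • α)))
    (D := D) (fun i => truncVar_nonneg _) (c := 1) (d := √(max κ₀ 0)) zero_le_one
    (sigNorm_nonneg (D := D) w) (sigNorm_nonneg (D := D) α) (Real.sqrt_nonneg _) w α
    (by
      rw [one_pow]
      exact sum_mul_lin_sq_le hQ hS zero_le_one (fun i => (truncVar_lt_one _).le) w)
    (by
      rw [Real.sq_sqrt (le_max_right _ _)]
      exact (key t ht α).trans
        (mul_le_mul_of_nonneg_right (le_max_left _ _) (sq_nonneg _)))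
  rw [← inner_meanMapDeriv hS, real_inner_self_eq_norm_sq, ← sigNorm_eq hS, one_mul, sq] at h1
  rcases (sigNorm_nonneg (D := D) w).eq_or_lt with h | h
  · rw [← h]; exact mul_nonneg (Real.sqrt_nonneg _) (sigNorm_nonneg _)
  · exact le_of_mul_le_mul_left h1 h

lemma driftRatios_le (hp : 0 < p) (hQ : D.Q.PosDef ∨ D.Q = 0)
    (hproper : D.Proper) (βhat : EuclideanSpace ℝ (Fin p)) :
    ∃ κ < 1, ∀ r ∈ D.driftRatios βhat, r ≤ κ := by
  have hS := posDef_Sig hQ hproper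
  obtain ⟨κ, h0, h1, h⟩ := exists_sigNorm_meanMapDeriv_le hp hQ hproper βhat
  refine ⟨κ ^ 2, pow_lt_one₀ h0 h1 two_ne_zero, ?_⟩
  rintro _ ⟨t, ht, α, hα, rfl⟩
  rw [div_le_iff₀ (pow_pos (sigNorm_pos hS hα) 2), ← mul_pow]
  exact pow_le_pow_left₀ (sigNorm_nonneg _) (h t ht α) 2

lemma bddAbove_driftRatios (hp : 0 < p) (hQ : D.Q.PosDef ∨ D.Q = 0)
    (hproper : D.Proper) (βhat : EuclideanSpace ℝ (Fin p)) : BddAbove (D.driftRatios βhat) := by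
  obtain ⟨κ, -, h⟩ := driftRatios_le hp hQ hproper βhat
  exact ⟨κ, h⟩

lemma driftConst_lt_one (hp : 0 < p) (hQ : D.Q.PosDef ∨ D.Q = 0)
    (hproper : D.Proper) (βhat : EuclideanSpace ℝ (Fin p)) : D.driftConst βhat < 1 := by
  obtain ⟨κ, h1, h⟩ := driftRatios_le hp hQ hproper βhat
  have hne : (D.driftRatios βhat).Nonempty :=
    ⟨_, 1 / 2, ⟨by norm_num, by norm_num⟩, EuclideanSpace.single (⟨0, hp⟩ : Fin p) (1 : ℝ),
      by simp, rfl⟩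
  exact (csSup_le hne h).trans_lt h1

lemma driftConst_nonneg (βhat : EuclideanSpace ℝ (Fin p)) : 0 ≤ D.driftConst βhat := by
  refine Real.sSup_nonneg ?_
  rintro _ ⟨t, -, α, -, rfl⟩
  positivity

lemma sigNorm_meanMapDeriv_le (hp : 0 < p) (hQ : D.Q.PosDef ∨ D.Q = 0)
    (hproper : D.Proper) (βhat : EuclideanSpace ℝ (Fin p)) {t : ℝ} (ht : t ∈ Ioo (0 : ℝ) 1)
    (α : EuclideanSpace ℝ (Fin p)) : D.sigNorm (D.meanMapDeriv (βhat + t • α) α) ≤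
      √(D.driftConst βhat) * D.sigNorm α := by
  have hS := posDef_Sig hQ hproper
  rcases eq_or_ne α 0 with rfl | hα
  · simp [meanMapDeriv, sigNorm]
  have h := le_csSup (bddAbove_driftRatios hp hQ hproper βhat) ⟨t, ht, α, hα, rfl⟩
  change _ ≤ D.driftConst βhat at h
  rw [div_le_iff₀ (pow_pos (sigNorm_pos hS hα) 2)] at h
  refine abs_le_of_sq_le_sq' ?_ (mul_nonneg (Real.sqrt_nonneg _) (sigNorm_nonneg _)) |>.2
  rw [mul_pow, Real.sq_sqrt (driftConst_nonneg _)]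
  exact h

/-- The mean value theorem is applied to the scalar function obtained by pairing `meanMap` along the
segment with the total displacement w. The root appears because λ bounds squared ratios. -/
lemma sigNorm_meanMap_sub_le (hp : 0 < p) (hQ : D.Q.PosDef ∨ D.Q = 0)
    (hproper : D.Proper) {βhat : EuclideanSpace ℝ (Fin p)} (hfix : D.meanMap βhat = βhat)
    (β : EuclideanSpace ℝ (Fin p)) :
    D.sigNorm (D.meanMap β - βhat) ≤ √(D.driftConst βhat) * D.sigNorm (β - βhat) := by
  have hS := posDef_Sig hQ hproper
  set α := β - βhat
  set w := D.meanMap β - βhat with hw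
  have hd : ∀ t, HasDerivAt (fun t : ℝ => inner ℝ (D.sqrtMap w)
      (D.sqrtMap (D.meanMap (βhat + t • α))))
      (inner ℝ (D.sqrtMap w) (D.sqrtMap (D.meanMapDeriv (βhat + t • α) α))) t := by
    intro t
    simp_rw [meanMap, inner_condMean hS, inner_meanMapDeriv hS]
    refine HasDerivAt.add_const _ (HasDerivAt.fun_sum fun i _ => ?_)
    exact (((hasDerivAt_truncMean _ _).comp t (hasDerivAt_lin_line i βhat α t))).const_mul _
  obtain ⟨t, ht, hmv⟩ := exists_hasDerivAt_eq_slope _ _ zero_lt_one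
    (HasDerivAt.continuousOn fun t _ => hd t) (fun t _ => hd t)
  have e1 : βhat + (1 : ℝ) • α = β := by simp [α]
  rw [e1, zero_smul, add_zero, hfix, sub_zero, div_one, ← inner_sub_right, ← map_sub, ← hw,
    real_inner_self_eq_norm_sq, ← sigNorm_eq hS] at hmv
  have h1 := real_inner_le_norm (D.sqrtMap w) (D.sqrtMap (D.meanMapDeriv (βhat + t • α) α))
  rw [hmv, ← sigNorm_eq hS, ← sigNorm_eq hS, sq] at h1
  have h2 := sigNorm_meanMapDeriv_le hp hQ hproper βhat ht α
  rcases (sigNorm_nonneg (D := D) w).eq_or_lt with h | h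
  · rw [← h]; exact mul_nonneg (Real.sqrt_nonneg _) (sigNorm_nonneg _)
  · exact (le_of_mul_le_mul_left h1 h).trans h2

lemma sigNorm_smul {t : ℝ} (ht : 0 ≤ t) (a : EuclideanSpace ℝ (Fin p)) :
    D.sigNorm (t • a) = t * D.sigNorm a := by
  rw [sigNorm, sigNorm, WithLp.ofLp_smul, mulVec_smul, smul_dotProduct, dotProduct_smul,
    smul_eq_mul, smul_eq_mul, ← mul_assoc, ← sq, Real.sqrt_mul (sq_nonneg t), Real.sqrt_sq ht]

/-- The derivative of the log-posterior at β̂ + tα in direction α is ⟨α, `meanMap` - β̂⟩ - t‖α‖²,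
which is negative since `meanMap` contracts towards β̂ by √λ < 1. Uniqueness of the mode thus
follows from λ < 1. -/
lemma postDensity_lt (hp : 0 < p) (hQ : D.Q.PosDef ∨ D.Q = 0)
    (hproper : D.Proper) {βhat : EuclideanSpace ℝ (Fin p)} (hfix : D.meanMap βhat = βhat)
    {β : EuclideanSpace ℝ (Fin p)} (hβ : β ≠ βhat) : D.postDensity β < D.postDensity βhat := by
  have hS := posDef_Sig hQ hproper
  rw [postDensity_eq_exp, postDensity_eq_exp, Real.exp_lt_exp]
  set α := β - βhat with hα
  have hd := hasDerivAt_logPost hQ hS βhat α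
  obtain ⟨t, ht, hmv⟩ := exists_hasDerivAt_eq_slope _ _ zero_lt_one
    (HasDerivAt.continuousOn fun t _ => hd t) (fun t _ => hd t)
  have e1 : βhat + (1 : ℝ) • α = β := by simp [α]
  rw [e1, zero_smul, add_zero, sub_zero, div_one] at hmv
  have hpos : 0 < D.sigNorm α := sigNorm_pos hS (sub_ne_zero.2 hβ)
  have e2 : D.meanMap (βhat + t • α) - (βhat + t • α) =
      (D.meanMap (βhat + t • α) - βhat) - t • α := by abel
  rw [e2, map_sub D.sqrtMap (_ - βhat) (t • α), inner_sub_right, map_smul, real_inner_smul_right,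
    real_inner_self_eq_norm_sq, ← sigNorm_eq hS] at hmv
  have h1 := real_inner_le_norm (D.sqrtMap α) (D.sqrtMap (D.meanMap (βhat + t • α) - βhat))
  rw [← sigNorm_eq hS, ← sigNorm_eq hS] at h1
  have h2 := sigNorm_meanMap_sub_le hp hQ hproper hfix (βhat + t • α)
  rw [add_sub_cancel_left, sigNorm_smul ht.1.le] at h2
  have h3 : √(D.driftConst βhat) < 1 := by
    rw [Real.sqrt_lt' one_pos, one_pow]; exact driftConst_lt_one hp hQ hproper βhat
  have h4 : D.sigNorm α * D.sigNorm (D.meanMap (βhat + t • α) - βhat) ≤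
      √(D.driftConst βhat) * (t * D.sigNorm α ^ 2) := by
    calc _ ≤ D.sigNorm α * (√(D.driftConst βhat) * (t * D.sigNorm α)) :=
          mul_le_mul_of_nonneg_left h2 hpos.le
      _ = _ := by ring
  have h5 : √(D.driftConst βhat) * (t * D.sigNorm α ^ 2) < 1 * (t * D.sigNorm α ^ 2) :=
    mul_lt_mul_of_pos_right h3 (mul_pos ht.1 (pow_pos hpos 2))
  linarith

end ProbitModel

/-! ## Wasserstein bounds from random maps -/

section RandomMap

variable {E Ω : Type*} [MeasurableSpace E] [MeasurableSpace Ω] {P : Measure Ω}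
  [IsProbabilityMeasure P] {F : Ω → E → E} {K : Kernel E E}

lemma map_prod_randomMap (hF : Measurable fun q : Ω × E => F q.1 q.2)
    (hK : ∀ x, K x = P.map fun ω => F ω x) {X : Type*} [MeasurableSpace X] (υ : Measure X)
    [SFinite υ] {f : X → E} (hf : Measurable f) :
    (P.prod υ).map (fun q => F q.1 (f q.2)) = (υ.map f).bind K := by
  have hm : Measurable fun q : Ω × X => F q.1 (f q.2) :=
    hF.comp (measurable_fst.prodMk (hf.comp measurable_snd))
  ext s hs
  rw [Measure.map_apply hm hs, Measure.prod_apply_symm (hm hs),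
    Measure.bind_apply hs K.measurable.aemeasurable, lintegral_map (K.measurable_coe hs) hf]
  refine lintegral_congr fun x => ?_
  have hx : Measurable fun ω => F ω (f x) := hF.comp measurable_prodMk_right
  rw [hK, Measure.map_apply hx hs]
  rfl

/-- Both coordinates are moved by the same ω at each step; the second starts from π and stays there
by invariance. -/
lemma exists_coupling_kernelIter (hF : Measurable fun q : Ω × E => F q.1 q.2)
    (hK : ∀ x, K x = P.map fun ω => F ω x) {π : Measure E} [IsProbabilityMeasure π]
    (hinv : π.bind K = π) {g : E × E → ℝ≥0∞} (hg : Measurable g) {ρ : ℝ≥0∞}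
    (hstep : ∀ x y, ∫⁻ ω, g (F ω x, F ω y) ∂P ≤ ρ * g (x, y)) (x : E) (m : ℕ) :
    ∃ υ ∈ couplings (kernelIter K m x) π, ∫⁻ z, g z ∂υ ≤ ρ ^ m * ∫⁻ y, g (x, y) ∂π := by
  -- The induction also has to carry that υ is a probability measure, for the product with the noise
  -- law.
  suffices h : ∃ υ ∈ couplings (kernelIter K m x) π, IsProbabilityMeasure υ ∧
      ∫⁻ z, g z ∂υ ≤ ρ ^ m * ∫⁻ y, g (x, y) ∂π by
    obtain ⟨υ, h1, -, h2⟩ := h; exact ⟨υ, h1, h2⟩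
  induction m with
  | zero =>
    refine ⟨(Measure.dirac x).prod π, ⟨?_, ?_⟩, inferInstance, ?_⟩
    · rw [← Measure.fst, Measure.fst_prod, kernelIter, Kernel.id_apply]
    · rw [← Measure.snd, Measure.snd_prod]
    · rw [lintegral_prod _ hg.aemeasurable, lintegral_dirac' _ hg.lintegral_prod_right', pow_zero,
        one_mul]
  | succ m ih =>
    obtain ⟨υ, ⟨h1, h2⟩, hprob, hint⟩ := ih
    have hG : Measurable fun q : Ω × E × E => (F q.1 q.2.1, F q.1 q.2.2) :=
      (hF.comp (measurable_fst.prodMk (measurable_fst.comp measurable_snd))).prodMk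
        (hF.comp (measurable_fst.prodMk (measurable_snd.comp measurable_snd)))
    refine ⟨(P.prod υ).map fun q => (F q.1 q.2.1, F q.1 q.2.2), ⟨?_, ?_⟩,
      Measure.isProbabilityMeasure_map hG.aemeasurable, ?_⟩
    · rw [Measure.map_map measurable_fst hG, kernelIter, Kernel.comp_apply, ← h1]
      exact map_prod_randomMap hF hK υ measurable_fst
    · rw [Measure.map_map measurable_snd hG]
      refine (map_prod_randomMap hF hK υ measurable_snd).trans ?_
      rw [h2, hinv]
    · rw [lintegral_map hg hG]
      calc _ = ∫⁻ z, ∫⁻ ω, g (F ω z.1, F ω z.2) ∂P ∂υ :=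
            lintegral_prod_symm _ (hg.comp hG).aemeasurable
        _ ≤ ∫⁻ z, ρ * g z ∂υ :=
            lintegral_mono fun z => hstep z.1 z.2
        _ = ρ * ∫⁻ z, g z ∂υ := lintegral_const_mul _ hg
        _ ≤ ρ * (ρ ^ m * ∫⁻ y, g (x, y) ∂π) := by gcongr
        _ = _ := by rw [pow_succ', mul_assoc]

/-- Geometric convergence in a Wasserstein distance from a drift condition, together with
contraction on a sublevel set of the drift function and nonexpansiveness elsewhere. -/
lemma wasserstein_kernelIter_le (hF : Measurable fun q : Ω × E => F q.1 q.2)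
    (hK : ∀ x, K x = P.map fun ω => F ω x) {π : Measure E} [IsProbabilityMeasure π]
    (hinv : π.bind K = π) {ψ : E → E → ℝ} (hψ : Measurable fun z : E × E => ψ z.1 z.2)
    {V : E → ℝ} (hV : Measurable V) (hV0 : ∀ x, 0 ≤ V x)
    {C lam L γ d a ρ : ℝ} (hC : 0 ≤ C) (hψV : ∀ x y, ψ x y ≤ C * (V x + V y + 1))
    (hlam : 0 ≤ lam) (hL : 0 ≤ L) (hlam1 : lam ≤ 2 * L + 1)
    (hdrift : ∀ x, ∫⁻ ω, ENNReal.ofReal (V (F ω x)) ∂P ≤ ENNReal.ofReal (lam * V x + L))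
    (hne : ∀ x y, ∫⁻ ω, ENNReal.ofReal (ψ (F ω x) (F ω y)) ∂P ≤ ENNReal.ofReal (ψ x y))
    (hγ : 0 ≤ γ) (hd : 0 ≤ d) (hcontr : ∀ x y, V x ≤ d → V y ≤ d →
      ∫⁻ ω, ENNReal.ofReal (ψ (F ω x) (F ω y)) ∂P ≤ ENNReal.ofReal γ * ENNReal.ofReal (ψ x y))
    (ha : 0 ≤ a) (ha1 : a ≤ 1) (hρ1 : (2 * L + 1) ^ (1 - a) * γ ^ a ≤ ρ)
    (hρ2 : ((lam * d + (2 * L + 1)) / (d + 1)) ^ (1 - a) ≤ ρ) (x : E) (m : ℕ) :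
    wasserstein ψ (kernelIter K m x) π ≤ ENNReal.ofReal C * ENNReal.ofReal ρ ^ m *
      ∫⁻ y, ENNReal.ofReal (V x + V y + 1) ∂π := by
  have ha' : 0 ≤ 1 - a := sub_nonneg.2 ha1
  set f : E × E → ℝ≥0∞ := fun z => ENNReal.ofReal (ψ z.1 z.2) with hf
  set w : E × E → ℝ≥0∞ := fun z => ENNReal.ofReal (V z.1 + V z.2 + 1) with hw
  have hfm : Measurable f := hψ.ennreal_ofReal
  have hwm : Measurable w := by
    have : Measurable fun z : E × E => V z.1 + V z.2 + 1 := by fun_prop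
    exact this.ennreal_ofReal
  have hfw : ∀ z, f z ≤ ENNReal.ofReal C * w z := fun z => by
    rw [hf, hw, ← ENNReal.ofReal_mul hC]; exact ENNReal.ofReal_le_ofReal (hψV _ _)
  -- The weight interpolates between ψ, which contracts only on the small set, and w, which
  -- decreases only far from it.
  set g : E × E → ℝ≥0∞ := fun z => f z ^ a * w z ^ (1 - a) with hg
  have hgm : Measurable g := (hfm.pow_const a).mul (hwm.pow_const _)
  have hwint : ∀ x y, ∫⁻ ω, w (F ω x, F ω y) ∂P ≤
      ENNReal.ofReal (lam * (V x + V y) + (2 * L + 1)) := by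
    intro x y
    have hx : Measurable fun ω => F ω x := hF.comp measurable_prodMk_right
    have hy : Measurable fun ω => F ω y := hF.comp measurable_prodMk_right
    have e : ∀ ω, w (F ω x, F ω y) = ENNReal.ofReal (V (F ω x)) + ENNReal.ofReal (V (F ω y)) + 1 :=
      fun ω => by
        rw [hw]
        simp only
        rw [ENNReal.ofReal_add (add_nonneg (hV0 _) (hV0 _)) zero_le_one,
          ENNReal.ofReal_add (hV0 _) (hV0 _), ENNReal.ofReal_one]
    simp_rw [e]
    have hVy : Measurable fun ω => ENNReal.ofReal (V (F ω y)) := (hV.comp hy).ennreal_ofReal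
    rw [lintegral_add_right _ measurable_const, lintegral_add_right _ hVy,
      lintegral_one, measure_univ]
    refine (add_le_add_left (add_le_add (hdrift x) (hdrift y)) 1).trans_eq ?_
    have h1 := mul_nonneg hlam (hV0 x)
    have h2 := mul_nonneg hlam (hV0 y)
    rw [← ENNReal.ofReal_add (by linarith) (by linarith), ← ENNReal.ofReal_one,
      ← ENNReal.ofReal_add (by linarith) zero_le_one]
    congr 1; ring
  have hholder : ∀ (x y : E) (A B : ℝ≥0∞), ∫⁻ ω, f (F ω x, F ω y) ∂P ≤ A * f (x, y) →
      ENNReal.ofReal (lam * (V x + V y) + (2 * L + 1)) ≤ B * w (x, y) →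
      ∫⁻ ω, g (F ω x, F ω y) ∂P ≤ (A ^ a * B ^ (1 - a)) * g (x, y) := by
    intro x y A B hA hB
    have hxy : Measurable fun ω => (F ω x, F ω y) :=
      (hF.comp measurable_prodMk_right).prodMk (hF.comp measurable_prodMk_right)
    refine (ENNReal.lintegral_mul_norm_pow_le (hfm.comp hxy).aemeasurable
      (hwm.comp hxy).aemeasurable ha ha' (by ring)).trans ?_
    calc _ ≤ (A * f (x, y)) ^ a * (B * w (x, y)) ^ (1 - a) := by
          gcongr
          · exact hA
          · exact (hwint x y).trans hB
      _ = _ := by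
          rw [ENNReal.mul_rpow_of_nonneg _ _ ha, ENNReal.mul_rpow_of_nonneg _ _ ha', hg]
          ring
  have hstep : ∀ x y, ∫⁻ ω, g (F ω x, F ω y) ∂P ≤ ENNReal.ofReal ρ * g (x, y) := by
    intro x y
    have hv : 0 ≤ V x + V y := add_nonneg (hV0 x) (hV0 y)
    -- Near the centre the ratio (λs + 2L + 1)/(s + 1), with s = V x + V y, is at most 2L + 1. Far
    -- away it is at most its value at s = d, as it is nonincreasing in s when λ ≤ 2L + 1.
    rcases le_or_gt (V x + V y) d with h | h
    · refine (hholder x y _ (ENNReal.ofReal (2 * L + 1)) (hcontr x y (by linarith [hV0 y])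
        (by linarith [hV0 x])) ?_).trans ?_
      · rw [hw, ← ENNReal.ofReal_mul (by linarith)]
        exact ENNReal.ofReal_le_ofReal (by nlinarith)
      · gcongr
        rw [ENNReal.ofReal_rpow_of_nonneg hγ ha, ENNReal.ofReal_rpow_of_nonneg (by linarith) ha',
          ← ENNReal.ofReal_mul (Real.rpow_nonneg hγ _), mul_comm]
        exact ENNReal.ofReal_le_ofReal hρ1
    · have hr : 0 ≤ (lam * d + (2 * L + 1)) / (d + 1) := by positivity
      refine (hholder x y 1 (ENNReal.ofReal ((lam * d + (2 * L + 1)) / (d + 1)))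
        (by simpa using hne x y) ?_).trans ?_
      · rw [hw, ← ENNReal.ofReal_mul hr]
        refine ENNReal.ofReal_le_ofReal ?_
        rw [div_mul_eq_mul_div, le_div_iff₀ (by linarith)]
        nlinarith [mul_nonneg (sub_nonneg.2 hlam1) (sub_nonneg.2 h.le)]
      · gcongr
        rw [ENNReal.one_rpow, one_mul, ENNReal.ofReal_rpow_of_nonneg hr ha']
        exact ENNReal.ofReal_le_ofReal hρ2
  obtain ⟨υ, hυ, hint⟩ := exists_coupling_kernelIter hF hK hinv hgm hstep x m
  refine (iInf₂_le υ hυ).trans ?_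
  -- The bound ψ ≤ C w is used twice: to recover ψ from g, at the cost C^(1-a), and to bound g by w
  -- at time 0, at the cost C^a.
  have hCa : ENNReal.ofReal C ^ (1 - a) * ENNReal.ofReal C ^ a = ENNReal.ofReal C := by
    rw [← ENNReal.rpow_add_of_nonneg _ _ ha' ha, sub_add_cancel, ENNReal.rpow_one]
  calc ∫⁻ z, f z ∂υ ≤ ∫⁻ z, ENNReal.ofReal C ^ (1 - a) * g z ∂υ := by
        refine lintegral_mono fun z => ?_
        calc f z = f z ^ a * f z ^ (1 - a) := by
              rw [← ENNReal.rpow_add_of_nonneg _ _ ha ha', add_sub_cancel, ENNReal.rpow_one]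
          _ ≤ f z ^ a * (ENNReal.ofReal C * w z) ^ (1 - a) := by gcongr; exact hfw z
          _ = _ := by rw [ENNReal.mul_rpow_of_nonneg _ _ ha', hg]; ring
    _ = ENNReal.ofReal C ^ (1 - a) * ∫⁻ z, g z ∂υ := lintegral_const_mul _ hgm
    _ ≤ ENNReal.ofReal C ^ (1 - a) * (ENNReal.ofReal ρ ^ m *
          ∫⁻ y, ENNReal.ofReal C ^ a * w (x, y) ∂π) := by
        gcongr
        refine hint.trans ?_
        gcongr with y
        calc g (x, y) ≤ (ENNReal.ofReal C * w (x, y)) ^ a * w (x, y) ^ (1 - a) := by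
              exact mul_le_mul_left (ENNReal.rpow_le_rpow (hfw _) ha) _
          _ = ENNReal.ofReal C ^ a * w (x, y) := by
              rw [ENNReal.mul_rpow_of_nonneg _ _ ha, mul_assoc,
                ← ENNReal.rpow_add_of_nonneg _ _ ha ha', add_sub_cancel, ENNReal.rpow_one]
    _ = _ := by
        have hwx : Measurable fun y => w (x, y) := hwm.comp measurable_prodMk_left
        rw [lintegral_const_mul _ hwx,
          show ∀ A B M I : ℝ≥0∞, A * (M * (B * I)) = (A * B) * M * I by intros; ring, hCa]

end RandomMap

lemma wasserstein_mono {E : Type*} [MeasurableSpace E] {ψ ψ' : E → E → ℝ} {C : ℝ} (hC : 0 < C)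
    (h : ∀ x y, ψ' x y ≤ C * ψ x y) (μ ν : Measure E) :
    wasserstein ψ' μ ν ≤ ENNReal.ofReal C * wasserstein ψ μ ν := by
  have h0 : ENNReal.ofReal C ≠ 0 := by simpa using hC
  simp only [wasserstein, ENNReal.mul_iInf_of_ne h0 ENNReal.ofReal_ne_top]
  refine le_iInf₂ fun υ hυ => (iInf₂_le υ hυ).trans ?_
  rw [← lintegral_const_mul' _ _ ENNReal.ofReal_ne_top]
  refine lintegral_mono fun z => ?_
  rw [← ENNReal.ofReal_mul hC.le]
  exact ENNReal.ofReal_le_ofReal (h _ _)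

/-! ### Second moments of the standard Gaussian vector -/

lemma integral_inner_stdGaussian {p : ℕ} (a : EuclideanSpace ℝ (Fin p)) :
    ∫ x, inner ℝ a x ∂(stdGaussian (EuclideanSpace ℝ (Fin p))) = 0 :=
  integral_strongDual_stdGaussian (innerSL ℝ a)

lemma integrable_norm_sq_stdGaussian {p : ℕ} :
    Integrable (fun x => ‖x‖ ^ 2) (stdGaussian (EuclideanSpace ℝ (Fin p))) :=
  (IsGaussian.memLp_two_id (μ := stdGaussian (EuclideanSpace ℝ (Fin p)))).integrable_norm_pow
    two_ne_zero

lemma integral_norm_sq_stdGaussian {p : ℕ} :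
    ∫ x, ‖x‖ ^ 2 ∂(stdGaussian (EuclideanSpace ℝ (Fin p))) = p := by
  simp_rw [EuclideanSpace.real_norm_sq_eq]
  have hmp : ∀ i : Fin p, MeasurePreserving (fun x : EuclideanSpace ℝ (Fin p) => x i)
      (stdGaussian (EuclideanSpace ℝ (Fin p))) (gaussianReal 0 1) := by
    intro i
    have := measurePreserving_eval_multivariateGaussian (μ := (0 : EuclideanSpace ℝ (Fin p)))
      (S := (1 : Matrix (Fin p) (Fin p) ℝ)) PosSemidef.one (i := i)
    simpa using this
  have hsq : Integrable (fun z : ℝ => z ^ 2) (gaussianReal 0 1) :=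
    (memLp_id_gaussianReal (μ := 0) (v := 1) 2).integrable_sq
  have h1 : ∫ z, z ^ 2 ∂(gaussianReal 0 1) = 1 := by
    have := variance_fun_id_gaussianReal (μ := 0) (v := 1)
    rw [variance_eq_integral (by fun_prop), integral_id_gaussianReal] at this
    simpa using this
  rw [integral_finsetSum]
  · have : ∀ i : Fin p, ∫ x : EuclideanSpace ℝ (Fin p), x i ^ 2 ∂(stdGaussian _) = 1 := by
      intro i
      rw [← h1, ← (hmp i).map_eq, integral_map (hmp i).measurable.aemeasurable (by fun_prop)]
    simp [this]
  · intro i _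
    exact (hmp i).integrable_comp_of_integrable hsq

lemma lintegral_norm_add_sq_stdGaussian {p : ℕ} (a : EuclideanSpace ℝ (Fin p)) :
    ∫⁻ x, ENNReal.ofReal (‖a + x‖ ^ 2) ∂(stdGaussian (EuclideanSpace ℝ (Fin p))) =
      ENNReal.ofReal (‖a‖ ^ 2 + p) := by
  have hi : Integrable (fun x => inner ℝ a x) (stdGaussian (EuclideanSpace ℝ (Fin p))) :=
    (innerSL ℝ a).integrable_comp IsGaussian.integrable_id
  have hi2 : Integrable (fun x => ‖a‖ ^ 2 + 2 * inner ℝ a x)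
      (stdGaussian (EuclideanSpace ℝ (Fin p))) := (integrable_const _).add (hi.const_mul 2)
  have e : ∀ x : EuclideanSpace ℝ (Fin p), ‖a + x‖ ^ 2 = ‖a‖ ^ 2 + 2 * inner ℝ a x + ‖x‖ ^ 2 :=
    fun x => norm_add_sq_real a x
  have hint : Integrable (fun x => ‖a + x‖ ^ 2) (stdGaussian (EuclideanSpace ℝ (Fin p))) := by
    simp_rw [e]; exact hi2.add integrable_norm_sq_stdGaussian
  rw [← ofReal_integral_eq_lintegral_ofReal hint (.of_forall fun x => by positivity)]
  congr 1
  simp_rw [e]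
  rw [integral_add hi2 integrable_norm_sq_stdGaussian, integral_add (integrable_const _)
    (hi.const_mul 2), integral_const_mul, integral_inner_stdGaussian, integral_norm_sq_stdGaussian]
  simp

namespace ProbitModel

variable {n p : ℕ} {D : ProbitModel n p}

/-! ## The chain as an iterated random map -/

/-- The latent vector as a function of uniform variables. -/
def latent (D : ProbitModel n p) (u : Fin n → ℝ) (β : EuclideanSpace ℝ (Fin p)) : Fin n → ℝ :=
  fun i => truncSample (D.y i) (u i) (D.lin i β)

/-- The linear map of the matrix `(Σ⁻¹) ^ (1/2)`. -/
def gaussMap (D : ProbitModel n p) :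
    EuclideanSpace ℝ (Fin p) →L[ℝ] EuclideanSpace ℝ (Fin p) :=
  toEuclideanCLM (𝕜 := ℝ) (CFC.sqrt D.Sig⁻¹)

lemma multivariateGaussian_eq_map (m : EuclideanSpace ℝ (Fin p)) :
    multivariateGaussian m D.Sig⁻¹ =
      (stdGaussian (EuclideanSpace ℝ (Fin p))).map fun x => m + D.gaussMap x := rfl

lemma sqrtMap_gaussMap (hS : D.Sig.PosDef) (x : EuclideanSpace ℝ (Fin p)) :
    D.sqrtMap (D.gaussMap x) = x := by
  rw [gaussMap, sqrt_inv_Sig hS]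
  exact sqrtMap_SigInvSqrt hS x.ofLp

lemma measurable_gaussMap : Measurable fun x => D.gaussMap x :=
  ContinuousLinearMap.measurable _

/-- One step of the chain, as a function of uniform variables and a standard Gaussian vector. -/
def acStep (D : ProbitModel n p) (ω : (Fin n → ℝ) × EuclideanSpace ℝ (Fin p))
    (β : EuclideanSpace ℝ (Fin p)) : EuclideanSpace ℝ (Fin p) :=
  D.condMean (D.latent ω.1 β) + D.gaussMap ω.2

/-- The law of the randomness used in one step of the chain. -/
def noiseLaw (n p : ℕ) : Measure ((Fin n → ℝ) × EuclideanSpace ℝ (Fin p)) :=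
  (unifLaw n).prod (stdGaussian (EuclideanSpace ℝ (Fin p)))

instance : IsProbabilityMeasure (unifLaw n) := by unfold unifLaw; infer_instance

instance : IsProbabilityMeasure (noiseLaw n p) := by unfold noiseLaw; infer_instance

lemma measurable_condMean : Measurable D.condMean := by
  unfold condMean mulVec dotProduct
  fun_prop

lemma measurable_latent :
    Measurable fun q : (Fin n → ℝ) × EuclideanSpace ℝ (Fin p) => D.latent q.1 q.2 := by
  refine measurable_pi_lambda _ fun i => ?_
  have := D.lin_measurable i
  exact (measurable_truncSample (D.y i)).comp
    (f := fun q : (Fin n → ℝ) × EuclideanSpace ℝ (Fin p) => (q.1 i, D.lin i q.2)) (by fun_prop)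

lemma measurable_acStep : Measurable fun q : ((Fin n → ℝ) × EuclideanSpace ℝ (Fin p)) ×
    EuclideanSpace ℝ (Fin p) => D.acStep q.1 q.2 := by
  have h1 : Measurable fun q : ((Fin n → ℝ) × EuclideanSpace ℝ (Fin p)) ×
      EuclideanSpace ℝ (Fin p) => D.latent q.1.1 q.2 :=
    measurable_latent.comp (f := fun q : ((Fin n → ℝ) × EuclideanSpace ℝ (Fin p)) ×
      EuclideanSpace ℝ (Fin p) => (q.1.1, q.2)) (by fun_prop)
  have h2 : Measurable fun q : ((Fin n → ℝ) × EuclideanSpace ℝ (Fin p)) ×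
      EuclideanSpace ℝ (Fin p) => D.condMean (D.latent q.1.1 q.2) := measurable_condMean.comp h1
  have h3 : Measurable fun q : ((Fin n → ℝ) × EuclideanSpace ℝ (Fin p)) ×
      EuclideanSpace ℝ (Fin p) => q.1.2 := by fun_prop
  exact h2.add (measurable_gaussMap.comp h3)

lemma measurable_latent_left (β : EuclideanSpace ℝ (Fin p)) :
    Measurable fun u => D.latent u β :=
  measurable_latent.comp (f := fun u => (u, β)) (by fun_prop)

lemma measurable_acStep_left (β : EuclideanSpace ℝ (Fin p)) :
    Measurable fun ω => D.acStep ω β :=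
  measurable_acStep.comp (f := fun ω => (ω, β)) (by fun_prop)

lemma map_latent (β : EuclideanSpace ℝ (Fin p)) :
    (unifLaw n).map (fun u => D.latent u β) = D.latentLaw β := by
  have h : ∀ i, AEMeasurable (fun u => truncSample (D.y i) u (D.lin i β))
      (volume.restrict (Ioo (0 : ℝ) 1)) := fun i =>
    ((measurable_truncSample (D.y i)).comp measurable_prodMk_right).aemeasurable
  have : ∀ i, SigmaFinite ((volume.restrict (Ioo (0 : ℝ) 1)).map
      fun u => truncSample (D.y i) u (D.lin i β)) := fun i => by
    rw [map_truncSample]; infer_instance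
  refine (Measure.pi_map_pi h).trans ?_
  simp_rw [map_truncSample]
  rfl

/-- Inverse transform sampling of the latent vector, followed by the affine image of a standard
Gaussian. The randomness no longer depends on β, which is what a coupling by common noise requires.
-/
lemma acKernel_eq_map (β : EuclideanSpace ℝ (Fin p)) :
    D.acKernel β = (noiseLaw n p).map fun ω => D.acStep ω β := by
  have hm := measurable_acStep_left (D := D) β
  have hl := measurable_latent_left (D := D) β
  ext s hs
  rw [acKernel, Kernel.comp_apply' _ _ _ hs, Measure.map_apply hm hs, noiseLaw,
    Measure.prod_apply (hm hs)]
  change ∫⁻ z, multivariateGaussian (D.condMean z) D.Sig⁻¹ s ∂(D.latentLaw β) = _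
  have hk : Measurable fun z => multivariateGaussian (D.condMean z) D.Sig⁻¹ s :=
    (Measure.measurable_coe hs).comp D.gaussStep_measurable
  rw [← map_latent, lintegral_map hk hl]
  refine lintegral_congr fun u => ?_
  have hg : Measurable fun x => D.condMean (D.latent u β) + D.gaussMap x :=
    measurable_gaussMap.const_add _
  rw [multivariateGaussian_eq_map, Measure.map_apply hg hs]
  rfl

/-- The shared Gaussian noise is additive and cancels, so contraction concerns the uniform variables
only. -/
lemma acStep_sub (ω : (Fin n → ℝ) × EuclideanSpace ℝ (Fin p)) (x y : EuclideanSpace ℝ (Fin p)) :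
    D.acStep ω x - D.acStep ω y =
      D.condMean (D.latent ω.1 x) - D.condMean (D.latent ω.1 y) := by
  simp [acStep]

lemma condMean_sub (z z' : Fin n → ℝ) : D.condMean z - D.condMean z' =
    WithLp.toLp 2 (D.Sig⁻¹ *ᵥ (D.Xᵀ *ᵥ (z - z'))) := by
  rw [condMean, condMean, ← WithLp.toLp_sub, ← mulVec_sub, add_sub_add_right_eq_sub,
    ← mulVec_sub]

/-! ## The drift condition -/

lemma integrable_resid (β : EuclideanSpace ℝ (Fin p)) (i : Fin n) :
    Integrable (fun z : Fin n → ℝ => z i - truncMean (D.lin i β) (D.y i)) (D.latentLaw β) :=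
  (integrable_comp_eval (μ := fun i => truncNormal (D.lin i β) (D.y i))
    (f := fun z : ℝ => z - truncMean (D.lin i β) (D.y i))
    (((memLp_id_truncNormal (D.lin i β) (D.y i)).integrable one_le_two).sub (integrable_const _)))

lemma integral_resid (β : EuclideanSpace ℝ (Fin p)) (i : Fin n) :
    ∫ z, (z i - truncMean (D.lin i β) (D.y i)) ∂(D.latentLaw β) = 0 := by
  rw [latentLaw, integral_comp_eval (μ := fun i => truncNormal (D.lin i β) (D.y i))
    (f := fun z : ℝ => z - truncMean (D.lin i β) (D.y i)) (by fun_prop)]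
  have hi : Integrable (fun z => z) (truncNormal (D.lin i β) (D.y i)) :=
    (memLp_id_truncNormal (D.lin i β) (D.y i)).integrable one_le_two
  rw [integral_sub hi (integrable_const _)]
  simp [integral_id_truncNormal]

lemma integrable_resid_mul_and_integral (β : EuclideanSpace ℝ (Fin p)) (i j : Fin n) :
    Integrable (fun z : Fin n → ℝ => (z i - truncMean (D.lin i β) (D.y i)) *
      (z j - truncMean (D.lin j β) (D.y j))) (D.latentLaw β) ∧
    ∫ z, (z i - truncMean (D.lin i β) (D.y i)) *
      (z j - truncMean (D.lin j β) (D.y j)) ∂(D.latentLaw β) =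
      if i = j then truncVar (sgn (D.y i) * D.lin i β) else 0 := by
  rcases eq_or_ne i j with rfl | hij
  · simp only [← sq, if_true]
    have h : MemLp (fun z : ℝ => z - truncMean (D.lin i β) (D.y i)) 2
        (truncNormal (D.lin i β) (D.y i)) :=
      (memLp_id_truncNormal (D.lin i β) (D.y i)).sub (memLp_const _)
    refine ⟨integrable_comp_eval (μ := fun i => truncNormal (D.lin i β) (D.y i))
      (f := fun z : ℝ => (z - truncMean (D.lin i β) (D.y i)) ^ 2)
      h.integrable_sq, ?_⟩
    rw [latentLaw, integral_comp_eval (μ := fun i => truncNormal (D.lin i β) (D.y i))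
      (f := fun z : ℝ => (z - truncMean (D.lin i β) (D.y i)) ^ 2) (by fun_prop),
      integral_sq_truncNormal]
  · have hind : iIndepFun (fun (i : Fin n) (z : Fin n → ℝ) => z i - truncMean (D.lin i β) (D.y i))
        (D.latentLaw β) :=
      iIndepFun_pi (μ := fun i => truncNormal (D.lin i β) (D.y i))
        (X := fun i z => z - truncMean (D.lin i β) (D.y i)) fun i => by fun_prop
    refine ⟨(hind.indepFun hij).integrable_mul (integrable_resid β i) (integrable_resid β j), ?_⟩
    rw [(hind.indepFun hij).integral_fun_mul_eq_mul_integral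
      (integrable_resid β i).aestronglyMeasurable (integrable_resid β j).aestronglyMeasurable,
      integral_resid, zero_mul, if_neg hij]

/-- The hat matrix `X Σ⁻¹ Xᵀ`. -/
def hat (D : ProbitModel n p) : Matrix (Fin n) (Fin n) ℝ := D.X * D.Sig⁻¹ * D.Xᵀ

lemma hat_diag_nonneg (hS : D.Sig.PosDef) (i : Fin n) : 0 ≤ D.hat i i := by
  have h := hS.posSemidef.inv.mul_mul_conjTranspose_same D.X
  rw [conjTranspose_eq_transpose_of_trivial] at h
  exact h.diag_nonneg

/-- By cyclicity the trace is p - tr(Σ⁻¹Q), and tr(Σ⁻¹Q) = tr(Σ^(-1/2)QΣ^(-1/2)) ≥ 0. -/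
lemma trace_hat_le (hQ : D.Q.PosDef ∨ D.Q = 0) (hS : D.Sig.PosDef) :
    ∑ i, D.hat i i ≤ p := by
  have h1 : ∑ i, D.hat i i = trace (D.Sig⁻¹ * (D.Sig - D.Q)) := by
    change trace D.hat = _
    rw [hat, Matrix.mul_assoc, trace_mul_comm, Sig, add_sub_cancel_right, Matrix.mul_assoc]
  have h2 : 0 ≤ trace (D.Sig⁻¹ * D.Q) := by
    have hR : D.SigInvSqrt * D.SigInvSqrt = D.Sig⁻¹ := by
      rw [← sqrt_inv_Sig hS]
      exact CFC.sqrt_mul_sqrt_self _ hS.posSemidef.inv.nonneg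
    rw [← hR, Matrix.mul_assoc, trace_mul_comm]
    have := ((posSemidef_Q hQ).mul_mul_conjTranspose_same D.SigInvSqrt).trace_nonneg
    rwa [conjTranspose_eq_transpose_of_trivial, SigInvSqrt_transpose] at this
  rw [h1, Matrix.mul_sub, nonsing_inv_mul _ (isUnit_det_Sig hS), trace_sub, trace_one,
    Fintype.card_fin]
  linarith

lemma sigNorm_solve_sq (hS : D.Sig.PosDef) (r : Fin n → ℝ) :
    D.sigNorm (WithLp.toLp 2 (D.Sig⁻¹ *ᵥ (D.Xᵀ *ᵥ r))) ^ 2 =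
      ∑ i, ∑ j, D.hat i j * (r i * r j) := by
  rw [sigNorm_eq hS, ← real_inner_self_eq_norm_sq, inner_sqrtMap_solve_design hS]
  refine Finset.sum_congr rfl fun i _ => ?_
  rw [lin, mulVec_mulVec, mulVec_mulVec]
  simp only [mulVec, dotProduct, Finset.sum_mul, hat]
  exact Finset.sum_congr rfl fun j _ => by ring

/-- Bias-variance decomposition. The residuals are independent and centred, so the variance part is
the sum of the hat diagonal weighted by truncated variances, at most the trace and hence at most p.
The p under the integral is the share of the Gaussian noise. -/
lemma lintegral_condMean_le (hQ : D.Q.PosDef ∨ D.Q = 0) (hS : D.Sig.PosDef)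
    (βhat β : EuclideanSpace ℝ (Fin p)) :
    ∫⁻ z, ENNReal.ofReal (D.sigNorm (D.condMean z - βhat) ^ 2 + p) ∂(D.latentLaw β) ≤
      ENNReal.ofReal (D.sigNorm (D.meanMap β - βhat) ^ 2 + p + p) := by
  set w := D.meanMap β - βhat with hw
  set r : (Fin n → ℝ) → Fin n → ℝ := fun z i => z i - truncMean (D.lin i β) (D.y i) with hr
  have e : ∀ z, D.sigNorm (D.condMean z - βhat) ^ 2 + p = D.sigNorm w ^ 2 + p +
      2 * ∑ i, D.lin i w * r z i + ∑ i, ∑ j, D.hat i j * (r z i * r z j) := by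
    intro z
    have e1 : D.condMean z - βhat = w + WithLp.toLp 2 (D.Sig⁻¹ *ᵥ (D.Xᵀ *ᵥ (r z))) := by
      have := condMean_sub (D := D) z fun i => truncMean (D.lin i β) (D.y i)
      change _ = WithLp.toLp 2 (D.Sig⁻¹ *ᵥ (D.Xᵀ *ᵥ (r z))) at this
      rw [← this, hw, meanMap]; abel
    rw [e1, ← sigNorm_solve_sq hS, sigNorm_eq hS, map_add, norm_add_sq_real,
      inner_sqrtMap_solve_design hS, sigNorm_eq hS, sigNorm_eq hS]
    ring
  have i1 : ∀ i, Integrable (fun z => D.lin i w * r z i) (D.latentLaw β) :=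
    fun i => (integrable_resid β i).const_mul _
  have i2 : Integrable (fun z => 2 * ∑ i, D.lin i w * r z i) (D.latentLaw β) :=
    (integrable_finsetSum _ fun i _ => i1 i).const_mul 2
  have i3 : ∀ i j, Integrable (fun z => D.hat i j * (r z i * r z j)) (D.latentLaw β) :=
    fun i j => (integrable_resid_mul_and_integral β i j).1.const_mul _
  have i4 : ∀ i, Integrable (fun z => ∑ j, D.hat i j * (r z i * r z j)) (D.latentLaw β) :=
    fun i => integrable_finsetSum _ fun j _ => i3 i j
  have i5 : Integrable (fun z => ∑ i, ∑ j, D.hat i j * (r z i * r z j)) (D.latentLaw β) :=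
    integrable_finsetSum _ fun i _ => i4 i
  have i6 : Integrable (fun z => D.sigNorm w ^ 2 + p + 2 * ∑ i, D.lin i w * r z i)
      (D.latentLaw β) := (integrable_const _).add i2
  have hint : Integrable (fun z => D.sigNorm (D.condMean z - βhat) ^ 2 + p) (D.latentLaw β) := by
    simp_rw [e]; exact i6.add i5
  rw [← ofReal_integral_eq_lintegral_ofReal hint (.of_forall fun x => by positivity)]
  refine ENNReal.ofReal_le_ofReal ?_
  simp_rw [e]
  rw [integral_add i6 i5, integral_add (integrable_const _) i2, integral_const_mul,
    integral_finsetSum _ fun i _ => i1 i, integral_finsetSum _ fun i _ => i4 i]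
  have h1 : ∀ i, ∫ z, D.lin i w * r z i ∂(D.latentLaw β) = 0 := fun i => by
    rw [integral_const_mul, hr]; simp only; rw [integral_resid, mul_zero]
  have h2 : ∀ i, ∫ z, ∑ j, D.hat i j * (r z i * r z j) ∂(D.latentLaw β) =
      D.hat i i * truncVar (sgn (D.y i) * D.lin i β) := fun i => by
    rw [integral_finsetSum _ fun j _ => i3 i j]
    simp_rw [integral_const_mul, hr, (integrable_resid_mul_and_integral β _ _).2]
    simp
  simp only [h1, h2, Finset.sum_const_zero, mul_zero, add_zero, integral_const,
    probReal_univ, one_smul]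
  have h3 : ∑ i, D.hat i i * truncVar (sgn (D.y i) * D.lin i β) ≤ p := by
    refine le_trans (Finset.sum_le_sum fun i _ => ?_) (trace_hat_le hQ hS)
    exact mul_le_of_le_one_right (hat_diag_nonneg hS i) (truncVar_lt_one _).le
  linarith

lemma driftV_nonneg (βhat β : EuclideanSpace ℝ (Fin p)) : 0 ≤ D.driftV βhat β := by
  unfold driftV; positivity

lemma continuous_driftV (hS : D.Sig.PosDef) (βhat : EuclideanSpace ℝ (Fin p)) :
    Continuous (D.driftV βhat) := by
  have := continuous_sigNorm hS
  unfold driftV; fun_prop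

/-- The squared bias is at most λ‖β - β̂‖², and the latent and Gaussian variances are at most p
each; division by p leaves the constant 2. -/
lemma lintegral_driftV_acStep_le (hp : 0 < p) (hQ : D.Q.PosDef ∨ D.Q = 0)
    (hproper : D.Proper) {βhat : EuclideanSpace ℝ (Fin p)} (hfix : D.meanMap βhat = βhat)
    (β : EuclideanSpace ℝ (Fin p)) :
    ∫⁻ ω, ENNReal.ofReal (D.driftV βhat (D.acStep ω β)) ∂(noiseLaw n p) ≤
      ENNReal.ofReal (D.driftConst βhat * D.driftV βhat β + 2) := by
  have hS := posDef_Sig hQ hproper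
  have hp' : (0 : ℝ) < p := Nat.cast_pos.2 hp
  have hm := measurable_acStep_left (D := D) β
  have hl := measurable_latent_left (D := D) β
  have e : ∀ ω, ENNReal.ofReal (D.driftV βhat (D.acStep ω β)) = ENNReal.ofReal (1 / p) *
      ENNReal.ofReal (‖D.sqrtMap (D.condMean (D.latent ω.1 β) - βhat) + ω.2‖ ^ 2) := by
    intro ω
    rw [← ENNReal.ofReal_mul (by positivity), driftV, acStep, sigNorm_eq hS, add_sub_right_comm,
      map_add, sqrtMap_gaussMap hS]
    congr 1; ring
  have hmA : Measurable fun z => D.sqrtMap (D.condMean z - βhat) := by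
    exact D.sqrtMap.measurable.comp (measurable_condMean.sub_const βhat)
  have hmB : Measurable fun ω : (Fin n → ℝ) × EuclideanSpace ℝ (Fin p) =>
      ENNReal.ofReal (‖D.sqrtMap (D.condMean (D.latent ω.1 β) - βhat) + ω.2‖ ^ 2) :=
    ((((hmA.comp hl).comp measurable_fst).add measurable_snd).norm.pow_const 2).ennreal_ofReal
  simp_rw [e]
  rw [lintegral_const_mul _ hmB, noiseLaw, lintegral_prod _ hmB.aemeasurable]
  simp_rw [lintegral_norm_add_sq_stdGaussian, ← sigNorm_eq hS]
  have hmC : Measurable fun z => ENNReal.ofReal (D.sigNorm (D.condMean z - βhat) ^ 2 + p) := by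
    exact ((((continuous_sigNorm hS).measurable.comp
      (measurable_condMean.sub_const βhat)).pow_const 2).add_const _).ennreal_ofReal
  rw [← lintegral_map (f := fun z => ENNReal.ofReal (D.sigNorm (D.condMean z - βhat) ^ 2 + p))
    hmC hl, map_latent]
  refine (mul_le_mul_right (lintegral_condMean_le hQ hS βhat β) _).trans ?_
  rw [← ENNReal.ofReal_mul (by positivity)]
  refine ENNReal.ofReal_le_ofReal ?_
  have h := sigNorm_meanMap_sub_le hp hQ hproper hfix β
  have h2 := pow_le_pow_left₀ (sigNorm_nonneg _) h 2
  rw [mul_pow, Real.sq_sqrt (driftConst_nonneg _)] at h2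
  rw [driftV, one_div, inv_mul_le_iff₀ hp']
  have h3 : (p : ℝ) * (D.driftConst βhat * (D.sigNorm (β - βhat) ^ 2 / p) + 2) =
      D.driftConst βhat * D.sigNorm (β - βhat) ^ 2 + 2 * p := by
    field_simp
  rw [h3]; linarith

/-! ## Local Lipschitz constants of the random map -/

/-- The derivatives of the inverse cdfs with respect to the linear predictors. -/
def slopes (D : ProbitModel n p) (β : EuclideanSpace ℝ (Fin p)) (u : Fin n → ℝ) : Fin n → ℝ :=
  fun i => upperQuantileDeriv (level (D.y i) (u i)) (sgn (D.y i) * D.lin i β)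

lemma ae_mem_Ioo : ∀ᵐ u ∂(unifLaw n), ∀ i, u i ∈ Ioo (0 : ℝ) 1 := by
  rw [ae_all_iff]
  intro i
  exact (Measure.quasiMeasurePreserving_eval (μ := fun _ : Fin n => volume.restrict (Ioo (0 : ℝ) 1))
    i).ae (ae_restrict_mem measurableSet_Ioo)

lemma slopes_mem (β : EuclideanSpace ℝ (Fin p)) {u : Fin n → ℝ} (hu : ∀ i, u i ∈ Ioo (0 : ℝ) 1)
    (i : Fin n) : D.slopes β u i ∈ Icc (0 : ℝ) 1 :=
  upperQuantileDeriv_mem (level_mem _ (hu i)) _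

/-- Valid for levels in (0, 1), hence almost surely; it replaces the derivative of an infimum by an
explicit, jointly measurable expression. -/
lemma localLip_eq (β : EuclideanSpace ℝ (Fin p)) {u : Fin n → ℝ}
    (hu : ∀ i, u i ∈ Ioo (0 : ℝ) 1) : D.localLip β u = D.gramMax (D.slopes β u) := by
  have : D.S β u = Matrix.diagonal (D.slopes β u) := by
    rw [S]
    congr 1
    funext i
    exact (hasDerivAt_quantileTN (hu i) (D.lin i β) (D.y i)).deriv
  rw [localLip, gramMax, this]

lemma measurable_slopes : Measurable fun q : EuclideanSpace ℝ (Fin p) × (Fin n → ℝ) =>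
    D.slopes q.1 q.2 := by
  refine measurable_pi_lambda _ fun i => ?_
  have h1 := D.lin_measurable i
  have h2 := measurable_level (D.y i)
  exact measurable_upperQuantileDeriv.comp
    (f := fun q : EuclideanSpace ℝ (Fin p) × (Fin n → ℝ) =>
      (level (D.y i) (q.2 i), sgn (D.y i) * D.lin i q.1)) (by fun_prop)

lemma measurable_gramMax_slopes (hp : 0 < p) (hS : D.Sig.PosDef) :
    Measurable fun q : EuclideanSpace ℝ (Fin p) × (Fin n → ℝ) => D.gramMax (D.slopes q.1 q.2) :=
  (measurable_gramMax hp hS).comp measurable_slopes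

lemma gramMax_slopes_mem (hp : 0 < p) (hQ : D.Q.PosDef ∨ D.Q = 0) (hS : D.Sig.PosDef)
    (β : EuclideanSpace ℝ (Fin p)) {u : Fin n → ℝ} (hu : ∀ i, u i ∈ Ioo (0 : ℝ) 1) :
    D.gramMax (D.slopes β u) ∈ Icc (0 : ℝ) 1 :=
  ⟨gramMax_nonneg hp hS fun i => (slopes_mem β hu i).1, (gramMax_le_iff hp hS _ _).2
    (sum_mul_lin_sq_le hQ hS zero_le_one fun i => (slopes_mem β hu i).2)⟩

lemma measurable_gramMax_slopes_right (hp : 0 < p) (hS : D.Sig.PosDef)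
    (β : EuclideanSpace ℝ (Fin p)) : Measurable fun u => D.gramMax (D.slopes β u) :=
  (measurable_gramMax_slopes hp hS).comp (f := fun u => (β, u)) (by fun_prop)

lemma integrable_gramMax_slopes (hp : 0 < p) (hQ : D.Q.PosDef ∨ D.Q = 0) (hS : D.Sig.PosDef)
    (β : EuclideanSpace ℝ (Fin p)) :
    Integrable (fun u => D.gramMax (D.slopes β u)) (unifLaw n) := by
  refine Integrable.of_mem_Icc 0 1 (measurable_gramMax_slopes_right hp hS β).aemeasurable ?_
  filter_upwards [ae_mem_Ioo] with u hu using gramMax_slopes_mem hp hQ hS β hu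

lemma localLip_ae_eq (β : EuclideanSpace ℝ (Fin p)) :
    D.localLip β =ᵐ[unifLaw n] fun u => D.gramMax (D.slopes β u) := by
  filter_upwards [ae_mem_Ioo] with u hu using localLip_eq β hu

lemma integrable_localLip (hp : 0 < p) (hQ : D.Q.PosDef ∨ D.Q = 0) (hS : D.Sig.PosDef)
    (β : EuclideanSpace ℝ (Fin p)) : Integrable (D.localLip β) (unifLaw n) :=
  (integrable_gramMax_slopes hp hQ hS β).congr (localLip_ae_eq β).symm

lemma meanLip_eq (β : EuclideanSpace ℝ (Fin p)) :
    D.meanLip β = ∫ u, D.gramMax (D.slopes β u) ∂(unifLaw n) :=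
  integral_congr_ae (localLip_ae_eq β)

lemma lintegral_gramMax_slopes (hp : 0 < p) (hQ : D.Q.PosDef ∨ D.Q = 0) (hS : D.Sig.PosDef)
    (β : EuclideanSpace ℝ (Fin p)) :
    ∫⁻ u, ENNReal.ofReal (D.gramMax (D.slopes β u)) ∂(unifLaw n) =
      ENNReal.ofReal (D.meanLip β) := by
  rw [meanLip_eq, ofReal_integral_eq_lintegral_ofReal (integrable_gramMax_slopes hp hQ hS β)]
  filter_upwards [ae_mem_Ioo] with u hu using (gramMax_slopes_mem hp hQ hS β hu).1

lemma meanLip_nonneg (hp : 0 < p) (hQ : D.Q.PosDef ∨ D.Q = 0) (hS : D.Sig.PosDef)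
    (β : EuclideanSpace ℝ (Fin p)) : 0 ≤ D.meanLip β := by
  rw [meanLip_eq]
  refine integral_nonneg_of_ae ?_
  filter_upwards [ae_mem_Ioo] with u hu using (gramMax_slopes_mem hp hQ hS β hu).1

lemma meanLip_le_one (hp : 0 < p) (hQ : D.Q.PosDef ∨ D.Q = 0) (hS : D.Sig.PosDef)
    (β : EuclideanSpace ℝ (Fin p)) : D.meanLip β ≤ 1 := by
  rw [meanLip_eq]
  calc _ ≤ ∫ _, (1 : ℝ) ∂(unifLaw n) := by
        refine integral_mono_ae (integrable_gramMax_slopes hp hQ hS β) (integrable_const _) ?_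
        filter_upwards [ae_mem_Ioo] with u hu using (gramMax_slopes_mem hp hQ hS β hu).2
    _ = 1 := by simp

lemma abs_lin_le (hQ : D.Q.PosDef ∨ D.Q = 0) (hS : D.Sig.PosDef) (i : Fin n)
    (α : EuclideanSpace ℝ (Fin p)) : |D.lin i α| ≤ D.sigNorm α := by
  refine abs_le_of_sq_le_sq ?_ (sigNorm_nonneg _)
  rw [sum_lin_sq_add hS]
  have := Finset.single_le_sum (f := fun i => D.lin i α ^ 2) (fun i _ => sq_nonneg _)
    (Finset.mem_univ i)
  exact this.trans (le_add_of_nonneg_right (quad_Q_nonneg hQ α))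

lemma unifLaw_middle : (unifLaw n).real (Set.pi univ fun _ => Icc (1 / 4 : ℝ) (3 / 4)) =
    (1 / 2) ^ n := by
  have h : (Icc (1 / 4 : ℝ) (3 / 4)) ∩ Ioo 0 1 = Icc (1 / 4) (3 / 4) :=
    inter_eq_left.2 fun x hx => ⟨by linarith [hx.1], by linarith [hx.2]⟩
  rw [measureReal_def, unifLaw, Measure.pi_pi]
  simp only [Measure.restrict_apply measurableSet_Icc, h, Real.volume_Icc, Finset.prod_const,
    Finset.card_univ, Fintype.card_fin, ENNReal.toReal_pow]
  rw [ENNReal.toReal_ofReal (by norm_num)]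
  norm_num

/-- The mean local Lipschitz constant is bounded away from `1` where the linear predictors are
bounded. -/
lemma exists_meanLip_le (hp : 0 < p) (hQ : D.Q.PosDef ∨ D.Q = 0) (hS : D.Sig.PosDef) (R : ℝ) :
    ∃ c < 1, ∀ β : EuclideanSpace ℝ (Fin p), (∀ i, |D.lin i β| ≤ R) → D.meanLip β ≤ c := by
  obtain ⟨δ, hδ, h⟩ := exists_upperQuantileDeriv_le R
  set A : Set (Fin n → ℝ) := Set.pi univ fun _ => Icc (1 / 4 : ℝ) (3 / 4) with hA
  have hAm : MeasurableSet A := MeasurableSet.univ_pi fun _ => measurableSet_Icc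
  -- The cap keeps 1 - δ' nonnegative, as `sum_mul_lin_sq_le` requires. The gain occurs on the cube
  -- A, of probability 2⁻ⁿ; off A the bound is 1.
  set δ' := min δ 1
  have hδ' : 0 < δ' := lt_min hδ one_pos
  refine ⟨1 - δ' * (1 / 2) ^ n, by linarith [mul_pos hδ' (pow_pos one_half_pos n)], fun β hβ => ?_⟩
  have hi : Integrable (fun u => 1 - δ' * A.indicator (fun _ => (1 : ℝ)) u) (unifLaw n) :=
    (integrable_const _).sub (((integrable_const _).indicator hAm).const_mul _)
  have hval : ∫ u, (1 - δ' * A.indicator (fun _ => (1 : ℝ)) u) ∂(unifLaw n) =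
      1 - δ' * (1 / 2) ^ n := by
    rw [integral_sub (integrable_const _) (((integrable_const _).indicator hAm).const_mul _),
      integral_const_mul, integral_indicator_const _ hAm, hA, unifLaw_middle]
    simp
  rw [meanLip_eq, ← hval]
  refine integral_mono_ae (integrable_gramMax_slopes hp hQ hS β) hi ?_
  filter_upwards [ae_mem_Ioo] with u hu
  by_cases hu' : u ∈ A
  · rw [indicator_of_mem hu', mul_one, gramMax_le_iff hp hS]
    refine sum_mul_lin_sq_le hQ hS (sub_nonneg.2 (min_le_right _ _)) fun i => ?_
    have hui := hu' i (mem_univ i)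
    refine (h _ ?_ _ ?_).trans (sub_le_sub_left (min_le_left _ _) 1)
    · rw [abs_mul, abs_sgn, one_mul]; exact hβ i
    · cases D.y i
      · simpa [level] using hui
      · simp only [level, if_true]; constructor <;> linarith [hui.1, hui.2]
  · rw [indicator_of_notMem hu', mul_zero, sub_zero]
    exact (gramMax_slopes_mem hp hQ hS β hu).2

lemma sigNorm_sub_le_of_mem_smallBall {βhat β : EuclideanSpace ℝ (Fin p)} {d : ℝ} (hp : 0 < p)
    (h : D.driftV βhat β ≤ d) : D.sigNorm (β - βhat) ≤ √(p * d) := by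
  rw [driftV, div_le_iff₀ (Nat.cast_pos.2 hp)] at h
  refine Real.le_sqrt_of_sq_le (h.trans_eq (mul_comm _ _))

/-- On the ball every predictor is bounded, because |xᵢᵀα| ≤ ‖α‖, so one constant c < 1 serves for
the whole ball. -/
lemma exists_meanLip_le_smallBall (hp : 0 < p) (hQ : D.Q.PosDef ∨ D.Q = 0) (hS : D.Sig.PosDef)
    (βhat : EuclideanSpace ℝ (Fin p)) (d : ℝ) :
    ∃ c < 1, ∀ x ∈ D.meanLip '' D.smallBall βhat d, x ≤ c := by
  obtain ⟨c, hc, h⟩ := exists_meanLip_le hp hQ hS (∑ i, |D.lin i βhat| + √(p * d))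
  refine ⟨c, hc, ?_⟩
  rintro _ ⟨β, hβ, rfl⟩
  refine h β fun i => ?_
  have e : D.lin i β = D.lin i βhat + D.lin i (β - βhat) := by rw [lin_sub]; ring
  rw [e]
  refine (abs_add_le _ _).trans (add_le_add ?_ ?_)
  · exact Finset.single_le_sum (f := fun i => |D.lin i βhat|) (fun i _ => abs_nonneg _)
      (Finset.mem_univ i)
  · exact (abs_lin_le hQ hS i _).trans (sigNorm_sub_le_of_mem_smallBall hp hβ)

lemma bddAbove_meanLip (hp : 0 < p) (hQ : D.Q.PosDef ∨ D.Q = 0) (hS : D.Sig.PosDef)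
    (βhat : EuclideanSpace ℝ (Fin p)) (d : ℝ) :
    BddAbove (D.meanLip '' D.smallBall βhat d) := by
  obtain ⟨c, -, h⟩ := exists_meanLip_le_smallBall hp hQ hS βhat d
  exact ⟨c, h⟩

lemma contractConst_lt_one (hp : 0 < p) (hQ : D.Q.PosDef ∨ D.Q = 0) (hS : D.Sig.PosDef)
    (βhat : EuclideanSpace ℝ (Fin p)) {d : ℝ} (hd : 0 ≤ d) : D.contractConst βhat d < 1 := by
  obtain ⟨c, hc, h⟩ := exists_meanLip_le_smallBall hp hQ hS βhat d
  have hmem : βhat ∈ D.smallBall βhat d := by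
    change D.driftV βhat βhat ≤ d
    simpa [driftV, sigNorm] using hd
  have hne : (D.meanLip '' D.smallBall βhat d).Nonempty := ⟨_, βhat, hmem, rfl⟩
  exact (csSup_le hne h).trans_lt hc

lemma contractConst_nonneg (hp : 0 < p) (hQ : D.Q.PosDef ∨ D.Q = 0) (hS : D.Sig.PosDef)
    (βhat : EuclideanSpace ℝ (Fin p)) (d : ℝ) : 0 ≤ D.contractConst βhat d := by
  refine Real.sSup_nonneg ?_
  rintro _ ⟨β, -, rfl⟩
  exact meanLip_nonneg hp hQ hS β

/-- Convexity of the ball: γ bounds the mean Lipschitz constant along the whole segment between two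
of its points. -/
lemma mem_smallBall_segment (hp : 0 < p) (hS : D.Sig.PosDef)
    {βhat x y : EuclideanSpace ℝ (Fin p)} {d t : ℝ} (ht : t ∈ Icc (0 : ℝ) 1)
    (hx : D.driftV βhat x ≤ d) (hy : D.driftV βhat y ≤ d) :
    y + t • (x - y) ∈ D.smallBall βhat d := by
  have hp' : (0 : ℝ) < p := Nat.cast_pos.2 hp
  have hx' := sigNorm_sub_le_of_mem_smallBall hp hx
  have hy' := sigNorm_sub_le_of_mem_smallBall hp hy
  have hd : 0 ≤ p * d := mul_nonneg hp'.le ((driftV_nonneg _ _).trans hx)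
  have e : y + t • (x - y) - βhat = t • (x - βhat) + (1 - t) • (y - βhat) := by
    module
  have h : D.sigNorm (y + t • (x - y) - βhat) ≤ √(p * d) := by
    have h0 : 0 ≤ t := ht.1
    have h1 : 0 ≤ 1 - t := sub_nonneg.2 ht.2
    rw [e, sigNorm_eq hS, map_add]
    refine (norm_add_le _ _).trans ?_
    rw [← sigNorm_eq hS, ← sigNorm_eq hS, sigNorm_smul ht.1, sigNorm_smul h1]
    calc _ ≤ t * √(p * d) + (1 - t) * √(p * d) := by gcongr
      _ = _ := by ring
  change D.driftV βhat _ ≤ d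
  rw [driftV, div_le_iff₀ hp', mul_comm d, ← Real.sq_sqrt hd]
  exact pow_le_pow_left₀ (sigNorm_nonneg _) h 2

/-! ## Contraction of the random map -/

/-- Pairing the path along the segment with its total displacement w, the fundamental theorem of
calculus writes ‖w‖² as an integral of bilinear forms, each at most `gramMax` times ‖w‖‖x - y‖; one
factor ‖w‖ then cancels. -/
lemma sigNorm_condMean_sub_le (hp : 0 < p) (hQ : D.Q.PosDef ∨ D.Q = 0) (hS : D.Sig.PosDef)
    (x y : EuclideanSpace ℝ (Fin p)) {u : Fin n → ℝ} (hu : ∀ i, u i ∈ Ioo (0 : ℝ) 1) :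
    D.sigNorm (D.condMean (D.latent u x) - D.condMean (D.latent u y)) ≤
      (∫ t in (0 : ℝ)..1, D.gramMax (D.slopes (y + t • (x - y)) u)) * D.sigNorm (x - y) := by
  set α := x - y with hα
  set w := D.condMean (D.latent u x) - D.condMean (D.latent u y) with hw
  set g : ℝ → ℝ := fun t => D.gramMax (D.slopes (y + t • α) u) with hg
  have hg01 : ∀ t, g t ∈ Icc (0 : ℝ) 1 := fun t => gramMax_slopes_mem hp hQ hS _ hu
  have hgm : Measurable g := (measurable_gramMax_slopes hp hS).comp
    (f := fun t : ℝ => (y + t • α, u)) (by fun_prop)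
  have hgi : IntervalIntegrable g volume 0 1 := by
    rw [intervalIntegrable_iff_integrableOn_Ioc_of_le zero_le_one]
    exact Integrable.of_mem_Icc 0 1 hgm.aemeasurable (.of_forall hg01)
  set k' : ℝ → ℝ := fun t => ∑ i, D.lin i w * (D.slopes (y + t • α) u i * D.lin i α) with hk'
  have hd : ∀ t, HasDerivAt (fun t : ℝ => ∑ i, D.lin i w * D.latent u (y + t • α) i) (k' t) t := by
    intro t
    refine HasDerivAt.fun_sum fun i _ => HasDerivAt.const_mul _ ?_
    have h1 := hasDerivAt_quantileTN (hu i) (D.lin i (y + t • α)) (D.y i)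
    simp_rw [quantileTN_eq (hu i)] at h1
    exact HasDerivAt.comp (h₂ := fun μ => truncSample (D.y i) (u i) μ) t h1
      (hasDerivAt_lin_line i y α t)
  have hk'c : Continuous k' := by
    refine continuous_finsetSum _ fun i _ => Continuous.mul continuous_const (Continuous.mul ?_
      continuous_const)
    have hl : Continuous fun t : ℝ => sgn (D.y i) * D.lin i (y + t • α) :=
      ((continuous_lin i).comp (by fun_prop)).const_mul _
    exact (continuous_upperQuantileDeriv (level_mem (D.y i) (hu i))).comp hl
  have hftc := intervalIntegral.integral_eq_sub_of_hasDerivAt (fun t _ => hd t)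
    (hk'c.intervalIntegrable 0 1)
  have e1 : y + (1 : ℝ) • α = x := by simp [α]
  have e2 : y + (0 : ℝ) • α = y := by simp
  have hww : ∫ t in (0 : ℝ)..1, k' t = D.sigNorm w ^ 2 := by
    rw [hftc]
    simp only [e1, e2]
    rw [sigNorm_eq hS, ← real_inner_self_eq_norm_sq]
    have e3 : D.sqrtMap w =
        D.sqrtMap (D.condMean (D.latent u x)) - D.sqrtMap (D.condMean (D.latent u y)) := by
      rw [hw, map_sub]
    conv_rhs => rw [show inner ℝ (D.sqrtMap w) (D.sqrtMap w) = inner ℝ (D.sqrtMap w)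
      (D.sqrtMap (D.condMean (D.latent u x)) - D.sqrtMap (D.condMean (D.latent u y))) from
        congrArg _ e3]
    rw [inner_sub_right, inner_condMean hS, inner_condMean hS]
    ring
  have hle : ∫ t in (0 : ℝ)..1, k' t ≤ ∫ t in (0 : ℝ)..1, D.sigNorm w * D.sigNorm α * g t := by
    refine intervalIntegral.integral_mono_on zero_le_one (hk'c.intervalIntegrable 0 1)
      (hgi.const_mul _) fun t _ => ?_
    have hgt := (hg01 t).1
    have hb := fun a => sum_lin_sq_le_gramMax hp hS (D.slopes (y + t • α) u) a
    have h := sum_mul_lin_le (D := D) (s := D.slopes (y + t • α) u)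
      (fun i => (slopes_mem _ hu i).1) (c := √(g t)) (d := √(g t)) (Real.sqrt_nonneg _)
      (sigNorm_nonneg (D := D) w) (sigNorm_nonneg (D := D) α) (Real.sqrt_nonneg _) w α
      (by rw [Real.sq_sqrt hgt]; exact hb w) (by rw [Real.sq_sqrt hgt]; exact hb α)
    refine h.trans_eq ?_
    nth_rw 3 [← Real.mul_self_sqrt hgt]
    ring
  rw [hww, intervalIntegral.integral_const_mul, sq, mul_assoc] at hle
  rcases (sigNorm_nonneg (D := D) w).eq_or_lt with h | h
  · rw [← h]
    exact mul_nonneg (intervalIntegral.integral_nonneg zero_le_one fun t _ => (hg01 t).1)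
      (sigNorm_nonneg _)
  · rw [mul_comm (∫ t in (0 : ℝ)..1, g t)]
    exact le_of_mul_le_mul_left hle h

/-- Tonelli exchanges the integral over the segment with the expectation over u, so a bound on the
expectation at each point of the segment is enough; no supremum over β enters under the expectation.
-/
lemma lintegral_psi_acStep_le (hp : 0 < p) (hQ : D.Q.PosDef ∨ D.Q = 0) (hS : D.Sig.PosDef)
    (x y : EuclideanSpace ℝ (Fin p)) {c : ℝ}
    (hc : ∀ t ∈ Icc (0 : ℝ) 1, D.meanLip (y + t • (x - y)) ≤ c) :
    ∫⁻ ω, ENNReal.ofReal (D.psi (D.acStep ω x) (D.acStep ω y)) ∂(noiseLaw n p) ≤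
      ENNReal.ofReal c * ENNReal.ofReal (D.psi x y) := by
  simp only [psi, acStep_sub]
  have hmw : Measurable fun u => ENNReal.ofReal
      (D.sigNorm (D.condMean (D.latent u x) - D.condMean (D.latent u y))) :=
    ((continuous_sigNorm hS).measurable.comp
      ((measurable_condMean.comp (measurable_latent_left x)).sub
        (measurable_condMean.comp (measurable_latent_left y)))).ennreal_ofReal
  have e1 : ∫⁻ ω, ENNReal.ofReal (D.sigNorm (D.condMean (D.latent ω.1 x) -
      D.condMean (D.latent ω.1 y))) ∂(noiseLaw n p) = ∫⁻ u, ENNReal.ofReal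
      (D.sigNorm (D.condMean (D.latent u x) - D.condMean (D.latent u y))) ∂(unifLaw n) := by
    have hm2 : Measurable fun ω : (Fin n → ℝ) × EuclideanSpace ℝ (Fin p) => ENNReal.ofReal
        (D.sigNorm (D.condMean (D.latent ω.1 x) - D.condMean (D.latent ω.1 y))) :=
      hmw.comp measurable_fst
    rw [noiseLaw, lintegral_prod _ hm2.aemeasurable]
    simp
  rw [e1]
  have hmg : Measurable fun q : (Fin n → ℝ) × ℝ =>
      ENNReal.ofReal (D.gramMax (D.slopes (y + q.2 • (x - y)) q.1)) :=
    ((measurable_gramMax_slopes hp hS).comp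
      (f := fun q : (Fin n → ℝ) × ℝ => (y + q.2 • (x - y), q.1)) (by fun_prop)).ennreal_ofReal
  calc _ ≤ ∫⁻ u, (∫⁻ t in Ioc (0 : ℝ) 1,
          ENNReal.ofReal (D.gramMax (D.slopes (y + t • (x - y)) u))) *
          ENNReal.ofReal (D.sigNorm (x - y)) ∂(unifLaw n) := by
        refine lintegral_mono_ae ?_
        filter_upwards [ae_mem_Ioo] with u hu
        have h01 : ∀ t : ℝ, D.gramMax (D.slopes (y + t • (x - y)) u) ∈ Icc (0 : ℝ) 1 :=
          fun t => gramMax_slopes_mem hp hQ hS _ hu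
        have hgm : Measurable fun t : ℝ => D.gramMax (D.slopes (y + t • (x - y)) u) :=
          (measurable_gramMax_slopes hp hS).comp
            (f := fun t : ℝ => (y + t • (x - y), u)) (by fun_prop)
        rw [← ofReal_integral_eq_lintegral_ofReal
          (Integrable.of_mem_Icc 0 1 hgm.aemeasurable (.of_forall h01))
          (.of_forall fun t => (h01 t).1), ← intervalIntegral.integral_of_le zero_le_one,
          ← ENNReal.ofReal_mul (intervalIntegral.integral_nonneg zero_le_one
            fun t _ => (h01 t).1)]
        exact ENNReal.ofReal_le_ofReal (sigNorm_condMean_sub_le hp hQ hS x y hu)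
    _ = (∫⁻ t in Ioc (0 : ℝ) 1, ∫⁻ u, ENNReal.ofReal
          (D.gramMax (D.slopes (y + t • (x - y)) u)) ∂(unifLaw n)) *
          ENNReal.ofReal (D.sigNorm (x - y)) := by
        rw [lintegral_mul_const _ hmg.lintegral_prod_right', lintegral_lintegral_swap
          hmg.aemeasurable]
    _ ≤ (∫⁻ _ in Ioc (0 : ℝ) 1, ENNReal.ofReal c) * ENNReal.ofReal (D.sigNorm (x - y)) := by
        gcongr ?_ * _
        refine setLIntegral_mono measurable_const fun t ht => ?_
        rw [lintegral_gramMax_slopes hp hQ hS]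
        exact ENNReal.ofReal_le_ofReal (hc t (Ioc_subset_Icc_self ht))
    _ = _ := by simp

end ProbitModel

/-! ## Densities of products and of Gaussian measures -/

lemma pi_withDensity_ofReal {ι : Type*} [Fintype ι] {g : ι → ℝ → ℝ} (h0 : ∀ i x, 0 ≤ g i x)
    (hi : ∀ i, Integrable (g i)) :
    Measure.pi (fun i => volume.withDensity fun x => ENNReal.ofReal (g i x)) =
      volume.withDensity fun z : ι → ℝ => ENNReal.ofReal (∏ i, g i (z i)) := by
  have : ∀ i, IsFiniteMeasure (volume.withDensity fun x => ENNReal.ofReal (g i x)) :=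
    fun i => isFiniteMeasure_withDensity_ofReal (hi i).2
  refine (Measure.pi_eq fun s hs => ?_)
  have his : ∀ i, Integrable (g i) (volume.restrict (s i)) := fun i => (hi i).restrict
  rw [withDensity_apply _ (.univ_pi hs), volume_pi, Measure.restrict_pi_pi,
    ← ofReal_integral_eq_lintegral_ofReal (Integrable.fintype_prod_dep his)
      (.of_forall fun z => Finset.prod_nonneg fun i _ => h0 i _),
    integral_fintype_prod_eq_prod, ENNReal.ofReal_prod_of_nonneg
      fun i _ => integral_nonneg (h0 i)]
  refine Finset.prod_congr rfl fun i _ => ?_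
  rw [withDensity_apply _ (hs i), ofReal_integral_eq_lintegral_ofReal (his i)
    (.of_forall (h0 i))]

lemma stdGaussian_eq_withDensity (p : ℕ) :
    stdGaussian (EuclideanSpace ℝ (Fin p)) = volume.withDensity fun x =>
      ENNReal.ofReal ((√(2 * Real.pi))⁻¹ ^ p) * ENNReal.ofReal (Real.exp (-‖x‖ ^ 2 / 2)) := by
  have h1 : gaussianReal 0 1 = volume.withDensity fun x => ENNReal.ofReal (stdphi x) := by
    rw [gaussianReal_of_var_ne_zero _ one_ne_zero]; rfl
  have hint : Integrable stdphi := integrable_gaussianPDFReal 0 1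
  have hpi := pi_withDensity_ofReal (g := fun _ : Fin p => stdphi)
    (fun _ => gaussianPDFReal_nonneg 0 1) fun _ => hint
  rw [← map_pi_eq_stdGaussian, h1, hpi]
  ext s hs
  have hmp := PiLp.volume_preserving_toLp (Fin p)
  have hm : Measurable fun x : EuclideanSpace ℝ (Fin p) =>
      ENNReal.ofReal ((√(2 * Real.pi))⁻¹ ^ p) * ENNReal.ofReal (Real.exp (-‖x‖ ^ 2 / 2)) := by
    fun_prop
  rw [Measure.map_apply hmp.measurable hs, withDensity_apply _ (hmp.measurable hs),
    withDensity_apply _ hs, ← hmp.setLIntegral_comp_preimage hs hm]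
  refine lintegral_congr fun z => ?_
  rw [← ENNReal.ofReal_mul (by positivity)]
  simp only [stdphi_eq, Finset.prod_mul_distrib, Finset.prod_const, Finset.card_univ,
    Fintype.card_fin, ← Real.exp_sum, EuclideanSpace.real_norm_sq_eq]
  congr 3
  rw [← Finset.sum_neg_distrib, Finset.sum_div]

lemma integrable_mul_exp_neg_mul_sq_norm {p : ℕ} {c : ℝ} (hc : 0 < c) :
    Integrable fun x : EuclideanSpace ℝ (Fin p) => Real.exp (-c * ‖x‖ ^ 2) := by
  have := GaussianFourier.integrable_cexp_neg_mul_sq_norm_add (b := (c : ℂ)) (by simpa) 0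
    (0 : EuclideanSpace ℝ (Fin p))
  refine this.norm.congr (.of_forall fun x => ?_)
  simp [Complex.norm_exp, ← Complex.ofReal_pow]

namespace ProbitModel

variable {n p : ℕ} {D : ProbitModel n p}

/-! ## Invariance of the posterior -/

/-- The value of the normalizing constant is irrelevant; what matters for invariance is that the
same k, neither 0 nor infinite, serves for all means m. -/
lemma exists_lintegral_multivariateGaussian (hS : D.Sig.PosDef) :
    ∃ k : ℝ≥0∞, k ≠ 0 ∧ k ≠ ∞ ∧ ∀ (m : EuclideanSpace ℝ (Fin p))
      (f : EuclideanSpace ℝ (Fin p) → ℝ≥0∞), Measurable f →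
      ∫⁻ β, f β ∂(multivariateGaussian m D.Sig⁻¹) =
        k * ∫⁻ β, f β * ENNReal.ofReal (Real.exp (-D.sigNorm (β - m) ^ 2 / 2)) := by
  have hdet : LinearMap.det (D.gaussMap : EuclideanSpace ℝ (Fin p) →ₗ[ℝ] _) ≠ 0 := by
    intro h
    have h1 : (D.sqrtMap : EuclideanSpace ℝ (Fin p) →ₗ[ℝ] EuclideanSpace ℝ (Fin p)) ∘ₗ
        (D.gaussMap : EuclideanSpace ℝ (Fin p) →ₗ[ℝ] _) = LinearMap.id :=
      LinearMap.ext fun x => sqrtMap_gaussMap hS x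
    have h2 := congrArg LinearMap.det h1
    rw [LinearMap.det_comp, h, mul_zero, LinearMap.det_id] at h2
    exact zero_ne_one h2
  set c : ℝ≥0∞ := ENNReal.ofReal ((√(2 * Real.pi))⁻¹ ^ p) with hc
  set l : ℝ≥0∞ := ENNReal.ofReal |(LinearMap.det
    (D.gaussMap : EuclideanSpace ℝ (Fin p) →ₗ[ℝ] EuclideanSpace ℝ (Fin p)))⁻¹| with hl
  have hc0 : c ≠ 0 := by
    rw [hc, Ne, ENNReal.ofReal_eq_zero, not_le]; positivity
  have hl0 : l ≠ 0 := by
    rw [hl, Ne, ENNReal.ofReal_eq_zero, not_le]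
    exact abs_pos.2 (inv_ne_zero hdet)
  refine ⟨c * l, mul_ne_zero hc0 hl0, ENNReal.mul_ne_top ENNReal.ofReal_ne_top
    ENNReal.ofReal_ne_top, fun m f hf => ?_⟩
  have hsn := continuous_sigNorm hS
  have hg : Measurable fun x => m + D.gaussMap x := measurable_gaussMap.const_add m
  have hF : Measurable fun b => f (m + b) * ENNReal.ofReal (Real.exp (-D.sigNorm b ^ 2 / 2)) :=
    (hf.comp (measurable_const_add m)).mul (by fun_prop)
  have hd : Measurable fun x : EuclideanSpace ℝ (Fin p) =>
      c * ENNReal.ofReal (Real.exp (-‖x‖ ^ 2 / 2)) := by fun_prop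
  have hfg : Measurable fun x => f (m + D.gaussMap x) := hf.comp hg
  rw [multivariateGaussian_eq_map, lintegral_map hf hg, stdGaussian_eq_withDensity, ← hc,
    lintegral_withDensity_eq_lintegral_mul _ hd hfg]
  have e : ∀ x : EuclideanSpace ℝ (Fin p), ((fun x : EuclideanSpace ℝ (Fin p) =>
      c * ENNReal.ofReal (Real.exp (-‖x‖ ^ 2 / 2))) * fun x => f (m + D.gaussMap x)) x =
      c * (fun b => f (m + b) * ENNReal.ofReal (Real.exp (-D.sigNorm b ^ 2 / 2)))
        (D.gaussMap x) := by
    intro x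
    simp only [Pi.mul_apply, sigNorm_eq hS, sqrtMap_gaussMap hS]
    ring
  have hFg : Measurable fun x => (fun b => f (m + b) *
      ENNReal.ofReal (Real.exp (-D.sigNorm b ^ 2 / 2))) (D.gaussMap x) :=
    hF.comp measurable_gaussMap
  rw [lintegral_congr e, lintegral_const_mul _ hFg, ← lintegral_map hF measurable_gaussMap]
  have hmap := Measure.map_linearMap_addHaar_eq_smul_addHaar
    (volume : Measure (EuclideanSpace ℝ (Fin p))) hdet
  have hmap' : Measure.map (fun x => D.gaussMap x) volume =
      l • (volume : Measure (EuclideanSpace ℝ (Fin p))) := hmap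
  rw [hmap', lintegral_smul_measure, smul_eq_mul, mul_assoc]
  congr 2
  have h := lintegral_add_left_eq_self (μ := volume) (fun β => f β *
    ENNReal.ofReal (Real.exp (-D.sigNorm (β - m) ^ 2 / 2))) m
  simpa only [add_sub_cancel_left] using h

/-- The density of a truncated normal distribution times the probability of the response. -/
def truncPDF (a : Bool) (μ z : ℝ) : ℝ := (truncSet a).indicator (fun z => stdphi (z - μ)) z

lemma truncPDF_nonneg (a : Bool) (μ z : ℝ) : 0 ≤ truncPDF a μ z :=
  indicator_nonneg (fun _ _ => (stdphi_pos _).le) _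

lemma integrable_truncPDF (a : Bool) (μ : ℝ) : Integrable (truncPDF a μ) := by
  refine Integrable.indicator ?_ (truncSet_measurable a)
  exact ((integrable_gaussianPDFReal μ 1).congr
    (.of_forall (gaussianPDFReal_eq_stdphi μ)))

lemma measurable_truncPDF (a : Bool) : Measurable fun q : ℝ × ℝ => truncPDF a q.1 q.2 := by
  have : Measurable fun q : ℝ × ℝ => stdphi (q.2 - q.1) :=
    continuous_stdphi.measurable.comp (by fun_prop)
  exact this.indicator (measurable_snd (truncSet_measurable a))

lemma truncNormal_eq_withDensity_truncPDF (a : Bool) (μ : ℝ) :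
    truncNormal μ a = volume.withDensity fun z =>
      ENNReal.ofReal ((stdPhi (sgn a * μ))⁻¹ * truncPDF a μ z) := by
  have hm : Measurable (gaussianPDF μ 1) := measurable_gaussianPDF μ 1
  rw [truncNormal_eq_withDensity, ← withDensity_indicator (truncSet_measurable a),
    ← withDensity_smul _ (hm.indicator (truncSet_measurable a))]
  congr 1
  funext z
  rw [Pi.smul_apply, smul_eq_mul, ENNReal.ofReal_mul (inv_nonneg.2 (stdPhi_pos _).le),
    ENNReal.ofReal_inv_of_pos (stdPhi_pos _)]
  congr 1
  by_cases hz : z ∈ truncSet a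
  · rw [truncPDF, indicator_of_mem hz, indicator_of_mem hz, gaussianPDF,
      gaussianPDFReal_eq_stdphi]
  · rw [truncPDF, indicator_of_notMem hz, indicator_of_notMem hz, ENNReal.ofReal_zero]

/-- The unnormalized joint density of the parameter and the latent vector. -/
def jointDensity (D : ProbitModel n p) (β : EuclideanSpace ℝ (Fin p)) (z : Fin n → ℝ) : ℝ :=
  (∏ i, truncPDF (D.y i) (D.lin i β) (z i)) * D.prior β

lemma measurable_prior : Measurable D.prior := by
  unfold prior mulVec dotProduct; fun_prop

lemma measurable_jointDensity :
    Measurable fun q : EuclideanSpace ℝ (Fin p) × (Fin n → ℝ) => D.jointDensity q.1 q.2 := by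
  refine Measurable.mul (Finset.measurable_prod _ fun i _ => ?_)
    (measurable_prior.comp measurable_fst)
  have := D.lin_measurable i
  exact (measurable_truncPDF (D.y i)).comp
    (f := fun q : EuclideanSpace ℝ (Fin p) × (Fin n → ℝ) => (D.lin i q.1, q.2 i)) (by fun_prop)

/-- Data augmentation: the normalizing constants of the truncated normals are the likelihood
factors, so the joint density is the posterior density times the latent density given β. -/
lemma lintegral_jointDensity_latent (β : EuclideanSpace ℝ (Fin p)) {h : (Fin n → ℝ) → ℝ≥0∞}
    (hh : Measurable h) : ∫⁻ z, ENNReal.ofReal (D.jointDensity β z) * h z =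
      ENNReal.ofReal (D.postDensity β) * ∫⁻ z, h z ∂(D.latentLaw β) := by
  have hpos : ∀ i, 0 < stdPhi (sgn (D.y i) * D.lin i β) := fun i => stdPhi_pos _
  have hlaw : D.latentLaw β = volume.withDensity fun z => ENNReal.ofReal
      (∏ i, (stdPhi (sgn (D.y i) * D.lin i β))⁻¹ * truncPDF (D.y i) (D.lin i β) (z i)) := by
    rw [latentLaw]
    simp_rw [truncNormal_eq_withDensity_truncPDF]
    exact pi_withDensity_ofReal (g := fun i z => (stdPhi (sgn (D.y i) * D.lin i β))⁻¹ *
        truncPDF (D.y i) (D.lin i β) z)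
      (fun i z => mul_nonneg (inv_nonneg.2 (hpos i).le) (truncPDF_nonneg _ _ _))
      fun i => (integrable_truncPDF _ _).const_mul _
  have hm : Measurable fun z : Fin n → ℝ => ENNReal.ofReal
      (∏ i, (stdPhi (sgn (D.y i) * D.lin i β))⁻¹ * truncPDF (D.y i) (D.lin i β) (z i)) := by
    refine (Finset.measurable_prod _ fun i _ => Measurable.const_mul ?_ _).ennreal_ofReal
    exact (measurable_truncPDF (D.y i)).comp (f := fun z : Fin n → ℝ => (D.lin i β, z i))
      (by fun_prop)
  rw [hlaw, lintegral_withDensity_eq_lintegral_mul _ hm hh,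
    ← lintegral_const_mul _ (hm.mul hh)]
  refine lintegral_congr fun z => ?_
  rw [Pi.mul_apply, ← mul_assoc, ← ENNReal.ofReal_mul (postDensity_pos β).le]
  congr 2
  have hne : ∏ i, stdPhi (sgn (D.y i) * D.lin i β) ≠ 0 :=
    (Finset.prod_pos fun i _ => hpos i).ne'
  rw [jointDensity, postDensity_eq, Finset.prod_mul_distrib, Finset.prod_inv_distrib]
  field_simp

/-- The factor of the joint density that does not depend on the parameter. -/
def latentFactor (D : ProbitModel n p) (z : Fin n → ℝ) : ℝ :=
  (∏ i, (truncSet (D.y i)).indicator (fun _ => (√(2 * Real.pi))⁻¹) (z i)) *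
    Real.exp (-(∑ i, z i ^ 2 + D.v.ofLp ⬝ᵥ (D.Q *ᵥ D.v.ofLp) - D.sigNorm (D.condMean z) ^ 2) / 2)

lemma latentFactor_nonneg (z : Fin n → ℝ) : 0 ≤ D.latentFactor z :=
  mul_nonneg (Finset.prod_nonneg fun i _ => indicator_nonneg (fun _ _ => by positivity) _)
    (Real.exp_pos _).le

lemma complete_square (hQ : D.Q.PosDef ∨ D.Q = 0) (hS : D.Sig.PosDef)
    (β : EuclideanSpace ℝ (Fin p)) (z : Fin n → ℝ) :
    ∑ i, (z i - D.lin i β) ^ 2 + (β - D.v).ofLp ⬝ᵥ (D.Q *ᵥ (β - D.v).ofLp) =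
      D.sigNorm (β - D.condMean z) ^ 2 +
        (∑ i, z i ^ 2 + D.v.ofLp ⬝ᵥ (D.Q *ᵥ D.v.ofLp) - D.sigNorm (D.condMean z) ^ 2) := by
  have h1 : D.sigNorm (β - D.condMean z) ^ 2 = D.sigNorm β ^ 2 -
      2 * (∑ i, D.lin i β * z i + β.ofLp ⬝ᵥ (D.Q *ᵥ D.v.ofLp)) +
        D.sigNorm (D.condMean z) ^ 2 := by
    rw [← inner_condMean hS, sigNorm_eq hS, sigNorm_eq hS, sigNorm_eq hS, map_sub,
      norm_sub_sq_real]
  have h2 : ∑ i, (z i - D.lin i β) ^ 2 =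
      ∑ i, z i ^ 2 - 2 * ∑ i, D.lin i β * z i + ∑ i, D.lin i β ^ 2 := by
    rw [Finset.mul_sum, ← Finset.sum_sub_distrib, ← Finset.sum_add_distrib]
    exact Finset.sum_congr rfl fun i _ => by ring
  rw [h1, h2, sum_lin_sq_add hS β]
  simp only [WithLp.ofLp_sub, mulVec_sub, sub_dotProduct, dotProduct_sub,
    dotProduct_Q_comm hQ D.v.ofLp β.ofLp]
  ring

/-- After completing the square, β enters only through a Gaussian factor centred at `condMean z`:
this is the conditional law drawn in the second half of a step. -/
lemma jointDensity_eq (hQ : D.Q.PosDef ∨ D.Q = 0) (hS : D.Sig.PosDef)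
    (β : EuclideanSpace ℝ (Fin p)) (z : Fin n → ℝ) : D.jointDensity β z =
      D.latentFactor z * Real.exp (-D.sigNorm (β - D.condMean z) ^ 2 / 2) := by
  have h : ∀ i, truncPDF (D.y i) (D.lin i β) (z i) =
      (truncSet (D.y i)).indicator (fun _ => (√(2 * Real.pi))⁻¹) (z i) *
        Real.exp (-(z i - D.lin i β) ^ 2 / 2) := by
    intro i
    by_cases hz : z i ∈ truncSet (D.y i)
    · rw [truncPDF, indicator_of_mem hz, indicator_of_mem hz, stdphi_eq]
    · rw [truncPDF, indicator_of_notMem hz, indicator_of_notMem hz, zero_mul]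
  simp_rw [jointDensity, h, Finset.prod_mul_distrib, ← Real.exp_sum]
  rw [prior, latentFactor, mul_assoc, mul_assoc, ← Real.exp_add, ← Real.exp_add]
  congr 2
  have := complete_square hQ hS β z
  rw [← Finset.sum_div, Finset.sum_neg_distrib]
  linarith

lemma lintegral_postDensity_ne_top (hproper : D.Proper) :
    ∫⁻ β, ENNReal.ofReal (D.postDensity β) ≠ ∞ := by
  rw [← ofReal_integral_eq_lintegral_ofReal hproper (.of_forall fun β => (postDensity_pos β).le)]
  exact ENNReal.ofReal_ne_top

lemma lintegral_postDensity_ne_zero : ∫⁻ β, ENNReal.ofReal (D.postDensity β) ≠ 0 := by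
  rw [Ne, lintegral_eq_zero_iff continuous_postDensity.measurable.ennreal_ofReal]
  intro h
  have h0 : ∀ᵐ _ : EuclideanSpace ℝ (Fin p), False := by
    filter_upwards [h] with β hβ
    exact absurd (ENNReal.ofReal_eq_zero.1 hβ) (not_le.2 (postDensity_pos β))
  rw [Filter.eventually_false_iff_eq_bot, ae_eq_bot] at h0
  exact NeZero.ne _ h0

lemma isProbabilityMeasure_posterior (hproper : D.Proper) :
    IsProbabilityMeasure D.posterior := by
  constructor
  rw [posterior, Measure.smul_apply, withDensity_apply _ MeasurableSet.univ,
    Measure.restrict_univ, smul_eq_mul]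
  exact ENNReal.inv_mul_cancel lintegral_postDensity_ne_zero
    (lintegral_postDensity_ne_top hproper)

lemma lintegral_posterior {f : EuclideanSpace ℝ (Fin p) → ℝ≥0∞} (hf : Measurable f) :
    ∫⁻ β, f β ∂D.posterior = (∫⁻ β, ENNReal.ofReal (D.postDensity β))⁻¹ *
      ∫⁻ β, ENNReal.ofReal (D.postDensity β) * f β := by
  rw [posterior, lintegral_smul_measure, smul_eq_mul, lintegral_withDensity_eq_lintegral_mul _
    continuous_postDensity.measurable.ennreal_ofReal hf]
  rfl

/-- The posterior is invariant under the Albert-Chib kernel. -/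
lemma posterior_bind_acKernel (hQ : D.Q.PosDef ∨ D.Q = 0) (hS : D.Sig.PosDef) :
    D.posterior.bind D.acKernel = D.posterior := by
  obtain ⟨k, hk0, hkt, hk⟩ := exists_lintegral_multivariateGaussian hS
  have hj := measurable_jointDensity (D := D)
  -- On each fibre z the joint density is, up to k and a factor depending on z only, the law of the
  -- Gaussian step. Both sides of the invariance are then written as integrals over z and compared
  -- fibrewise.
  have hfib : ∀ (z : Fin n → ℝ) (f : EuclideanSpace ℝ (Fin p) → ℝ≥0∞), Measurable f →
      k * ∫⁻ β, ENNReal.ofReal (D.jointDensity β z) * f β = ENNReal.ofReal (D.latentFactor z) *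
        ∫⁻ β, f β ∂(multivariateGaussian (D.condMean z) D.Sig⁻¹) := by
    intro z f hf
    have hsn := continuous_sigNorm hS
    have hm : Measurable fun β =>
        f β * ENNReal.ofReal (Real.exp (-D.sigNorm (β - D.condMean z) ^ 2 / 2)) :=
      hf.mul (by fun_prop)
    rw [hk _ _ hf, mul_left_comm, ← lintegral_const_mul _ hm]
    congr 1
    refine lintegral_congr fun β => ?_
    rw [jointDensity_eq hQ hS, ENNReal.ofReal_mul (latentFactor_nonneg z)]
    ring
  ext s hs
  have hN : Measurable fun z => multivariateGaussian (D.condMean z) D.Sig⁻¹ s :=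
    (Measure.measurable_coe hs).comp D.gaussStep_measurable
  have hJ : Measurable fun q : EuclideanSpace ℝ (Fin p) × (Fin n → ℝ) =>
      ENNReal.ofReal (D.jointDensity q.1 q.2) := hj.ennreal_ofReal
  have hJN : Measurable fun q : EuclideanSpace ℝ (Fin p) × (Fin n → ℝ) =>
      ENNReal.ofReal (D.jointDensity q.1 q.2) *
        multivariateGaussian (D.condMean q.2) D.Sig⁻¹ s :=
    hJ.mul (hN.comp (f := fun q : EuclideanSpace ℝ (Fin p) × (Fin n → ℝ) => q.2) measurable_snd)
  have h1s : Measurable (s.indicator (1 : EuclideanSpace ℝ (Fin p) → ℝ≥0∞)) :=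
    measurable_one.indicator hs
  have hJs : Measurable fun q : EuclideanSpace ℝ (Fin p) × (Fin n → ℝ) =>
      ENNReal.ofReal (D.jointDensity q.1 q.2) * s.indicator 1 q.1 :=
    hJ.mul (h1s.comp (f := fun q : EuclideanSpace ℝ (Fin p) × (Fin n → ℝ) => q.1) measurable_fst)
  have hJl : ∀ z, Measurable fun β => ENNReal.ofReal (D.jointDensity β z) := fun z =>
    hJ.comp (f := fun β => (β, z)) measurable_prodMk_right
  have hleft : ∫⁻ β, ENNReal.ofReal (D.postDensity β) * D.acKernel β s =
      ∫⁻ z, (∫⁻ β, ENNReal.ofReal (D.jointDensity β z)) *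
        multivariateGaussian (D.condMean z) D.Sig⁻¹ s := by
    calc _ = ∫⁻ β, ∫⁻ z, ENNReal.ofReal (D.jointDensity β z) *
          multivariateGaussian (D.condMean z) D.Sig⁻¹ s := by
          refine lintegral_congr fun β => ?_
          rw [lintegral_jointDensity_latent β hN, acKernel, Kernel.comp_apply' _ _ _ hs]
          rfl
      _ = _ := by
          rw [lintegral_lintegral_swap hJN.aemeasurable]
          exact lintegral_congr fun z => lintegral_mul_const _ (hJl z)
  have hright : ∫⁻ β, ENNReal.ofReal (D.postDensity β) * s.indicator 1 β =
      ∫⁻ z, ∫⁻ β, ENNReal.ofReal (D.jointDensity β z) * s.indicator 1 β := by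
    rw [← lintegral_lintegral_swap hJs.aemeasurable]
    refine lintegral_congr fun β => ?_
    rw [lintegral_jointDensity_latent β measurable_const, lintegral_const, measure_univ, mul_one]
  have hmid : ∀ z, (∫⁻ β, ENNReal.ofReal (D.jointDensity β z)) *
        multivariateGaussian (D.condMean z) D.Sig⁻¹ s =
      ∫⁻ β, ENNReal.ofReal (D.jointDensity β z) * s.indicator 1 β := by
    intro z
    have h1 := hfib z (fun _ => 1) measurable_const
    have h2 := hfib z (s.indicator 1) h1s
    simp only [mul_one, lintegral_one, measure_univ] at h1
    rw [lintegral_indicator_one hs, ← h1, mul_assoc] at h2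
    exact ((ENNReal.mul_right_inj hk0 hkt).1 h2).symm
  have hKs : Measurable fun β => D.acKernel β s := D.acKernel.measurable_coe hs
  rw [Measure.bind_apply hs D.acKernel.measurable.aemeasurable, lintegral_posterior hKs,
    ← lintegral_indicator_one hs, lintegral_posterior h1s, hleft, hright]
  congr 1
  exact lintegral_congr hmid

/-! ## The posterior mean of the drift function -/

lemma measurable_ofReal_driftV (hS : D.Sig.PosDef) (βhat : EuclideanSpace ℝ (Fin p)) :
    Measurable fun β => ENNReal.ofReal (D.driftV βhat β) :=
  (continuous_driftV hS βhat).measurable.ennreal_ofReal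

lemma exists_driftV_le (hp : 0 < p) (hS : D.Sig.PosDef) (βhat : EuclideanSpace ℝ (Fin p)) {c : ℝ}
    (hc : 0 < c) : ∃ A, 0 ≤ A ∧ ∀ β, D.driftV βhat β ≤ A * Real.exp (c * ‖β‖ ^ 2) := by
  have hp' : (1 : ℝ) ≤ p := Nat.one_le_cast.2 hp
  set s := ‖D.sqrtMap‖
  refine ⟨s ^ 2 * (2 / c + 2 * ‖βhat‖ ^ 2), by positivity, fun β => ?_⟩
  have h1 : D.sigNorm (β - βhat) ≤ s * (‖β‖ + ‖βhat‖) := by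
    rw [sigNorm_eq hS]
    exact (D.sqrtMap.le_opNorm _).trans (by gcongr; exact norm_sub_le _ _)
  have h2 : D.driftV βhat β ≤ (s * (‖β‖ + ‖βhat‖)) ^ 2 :=
    (div_le_self (sq_nonneg _) hp').trans (pow_le_pow_left₀ (sigNorm_nonneg _) h1 2)
  have h3 : c * ‖β‖ ^ 2 + 1 ≤ Real.exp (c * ‖β‖ ^ 2) := Real.add_one_le_exp _
  have h4 : ‖β‖ ^ 2 ≤ 1 / c * Real.exp (c * ‖β‖ ^ 2) := by
    rw [one_div, ← div_eq_inv_mul, le_div_iff₀ hc]; linarith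
  have h5 : ‖βhat‖ ^ 2 ≤ ‖βhat‖ ^ 2 * Real.exp (c * ‖β‖ ^ 2) :=
    le_mul_of_one_le_right (sq_nonneg _) (Real.one_le_exp (by positivity))
  calc D.driftV βhat β ≤ s ^ 2 * (‖β‖ + ‖βhat‖) ^ 2 := by rw [← mul_pow]; exact h2
    _ ≤ s ^ 2 * (2 * ‖β‖ ^ 2 + 2 * ‖βhat‖ ^ 2) := by
        gcongr; nlinarith [sq_nonneg (‖β‖ - ‖βhat‖)]
    _ ≤ s ^ 2 * (2 * (1 / c * Real.exp (c * ‖β‖ ^ 2)) +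
          2 * (‖βhat‖ ^ 2 * Real.exp (c * ‖β‖ ^ 2))) := by gcongr
    _ = _ := by ring

/-- Finiteness has to be known in advance, because the sharper bound below subtracts λ times this
integral from both sides. -/
lemma lintegral_driftV_posterior_ne_top (hp : 0 < p) (hQ : D.Q.PosDef ∨ D.Q = 0)
    (hproper : D.Proper) (βhat : EuclideanSpace ℝ (Fin p)) :
    ∫⁻ β, ENNReal.ofReal (D.driftV βhat β) ∂D.posterior ≠ ∞ := by
  have hS := posDef_Sig hQ hproper
  obtain ⟨c, hc, K, hK⟩ := exists_logPost_le hp hQ hproper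
  -- Half of the Gaussian decay absorbs V; the other half remains integrable.
  obtain ⟨A, hA, hV⟩ := exists_driftV_le hp hS βhat (half_pos hc)
  rw [lintegral_posterior (measurable_ofReal_driftV hS βhat)]
  refine ENNReal.mul_ne_top (ENNReal.inv_ne_top.2 lintegral_postDensity_ne_zero) ?_
  have hi : Integrable fun β : EuclideanSpace ℝ (Fin p) =>
      Real.exp K * A * Real.exp (-(c / 2) * ‖β‖ ^ 2) :=
    (integrable_mul_exp_neg_mul_sq_norm (half_pos hc)).const_mul _
  refine ne_top_of_le_ne_top hi.lintegral_lt_top.ne (lintegral_mono fun β => ?_)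
  rw [← ENNReal.ofReal_mul (postDensity_pos β).le]
  refine ENNReal.ofReal_le_ofReal ?_
  calc D.postDensity β * D.driftV βhat β
      ≤ Real.exp (K - c * ‖β‖ ^ 2) * (A * Real.exp (c / 2 * ‖β‖ ^ 2)) := by
        rw [postDensity_eq_exp]
        exact mul_le_mul (Real.exp_le_exp.2 (hK β)) (hV β) (driftV_nonneg _ _)
          (Real.exp_pos _).le
    _ = Real.exp K * A * Real.exp (-(c / 2) * ‖β‖ ^ 2) := by
        have : Real.exp (K - c * ‖β‖ ^ 2) * Real.exp (c / 2 * ‖β‖ ^ 2) =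
            Real.exp K * Real.exp (-(c / 2) * ‖β‖ ^ 2) := by
          rw [← Real.exp_add, ← Real.exp_add]; congr 1; ring
        linear_combination A * this

/-- Integrating the drift bound against the invariant law gives I ≤ λI + 2, with I finite. -/
lemma lintegral_driftV_posterior_le (hp : 0 < p) (hQ : D.Q.PosDef ∨ D.Q = 0)
    (hproper : D.Proper) {βhat : EuclideanSpace ℝ (Fin p)} (hfix : D.meanMap βhat = βhat) :
    ∫⁻ β, ENNReal.ofReal (D.driftV βhat β) ∂D.posterior ≤
      ENNReal.ofReal (2 / (1 - D.driftConst βhat)) := by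
  have hS := posDef_Sig hQ hproper
  have := isProbabilityMeasure_posterior hproper
  have hlam := driftConst_lt_one hp hQ hproper βhat
  have hlam0 := driftConst_nonneg (D := D) βhat
  have hm := measurable_ofReal_driftV hS βhat
  have htop := lintegral_driftV_posterior_ne_top hp hQ hproper βhat
  set I := ∫⁻ β, ENNReal.ofReal (D.driftV βhat β) ∂D.posterior with hI
  have hle : I ≤ ENNReal.ofReal (D.driftConst βhat) * I + 2 := by
    calc I = ∫⁻ β, ∫⁻ β', ENNReal.ofReal (D.driftV βhat β') ∂(D.acKernel β) ∂D.posterior := by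
          rw [← Measure.lintegral_bind D.acKernel.measurable.aemeasurable hm.aemeasurable,
            posterior_bind_acKernel hQ hS]
      _ ≤ ∫⁻ β, (ENNReal.ofReal (D.driftConst βhat) * ENNReal.ofReal (D.driftV βhat β) + 2)
            ∂D.posterior := by
          refine lintegral_mono fun β => ?_
          rw [acKernel_eq_map, lintegral_map hm (measurable_acStep_left β)]
          refine (lintegral_driftV_acStep_le hp hQ hproper hfix β).trans_eq ?_
          rw [ENNReal.ofReal_add (mul_nonneg hlam0 (driftV_nonneg _ _)) zero_le_two,
            ENNReal.ofReal_mul hlam0, ENNReal.ofReal_ofNat]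
      _ = _ := by
          rw [lintegral_add_right _ measurable_const, lintegral_const_mul _ hm,
            lintegral_const, measure_univ, mul_one]
  rw [← ENNReal.ofReal_toReal htop] at hle ⊢
  rw [← ENNReal.ofReal_mul hlam0, ← ENNReal.ofReal_ofNat 2,
    ← ENNReal.ofReal_add (mul_nonneg hlam0 ENNReal.toReal_nonneg) zero_le_two,
    ENNReal.ofReal_le_ofReal_iff (by positivity)] at hle
  refine ENNReal.ofReal_le_ofReal ?_
  rw [le_div_iff₀ (sub_pos.2 hlam)]
  linarith

/-! ## The convergence rate -/

lemma psi_le (hp : 0 < p) (hS : D.Sig.PosDef) (βhat x y : EuclideanSpace ℝ (Fin p)) :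
    D.psi x y ≤ 2 * p * (D.driftV βhat x + D.driftV βhat y + 1) := by
  have hp' : (1 : ℝ) ≤ p := Nat.one_le_cast.2 hp
  have hpV : ∀ β, p * D.driftV βhat β = D.sigNorm (β - βhat) ^ 2 := fun β => by
    rw [driftV]; field_simp
  have h : D.psi x y ≤ D.sigNorm (x - βhat) + D.sigNorm (y - βhat) := by
    rw [psi, sigNorm_eq hS, sigNorm_eq hS, sigNorm_eq hS, ← sub_sub_sub_cancel_right x y βhat,
      map_sub]
    exact norm_sub_le _ _
  nlinarith [hpV x, hpV y, sq_nonneg (D.sigNorm (x - βhat) - 1),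
    sq_nonneg (D.sigNorm (y - βhat) - 1), sq_nonneg (D.sigNorm (x - βhat)),
    sq_nonneg (D.sigNorm (y - βhat))]

/-- On taking logarithms, the condition on a says (1 - a) log 5 + a log γ < 0. The case γ = 0 is
separate: `Real.log 0` is 0, so the fraction would be 1 and exclude every a < 1. -/
lemma rpow_mul_rpow_lt_one {γ a : ℝ} (hγ : 0 ≤ γ) (hγ1 : γ < 1) (ha : 0 < a)
    (h : 0 < γ → Real.log 5 / (Real.log 5 - Real.log γ) < a) : (5 : ℝ) ^ (1 - a) * γ ^ a < 1 := by
  rcases hγ.eq_or_lt with rfl | hγ0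
  · rw [Real.zero_rpow ha.ne', mul_zero]; exact one_pos
  · have h5 : 0 < Real.log 5 := Real.log_pos (by norm_num)
    have hlog : Real.log γ < 0 := Real.log_neg hγ0 hγ1
    have h' := h hγ0
    rw [div_lt_iff₀ (by linarith)] at h'
    rw [← Real.log_neg_iff (by positivity), Real.log_mul (by positivity) (by positivity),
      Real.log_rpow (by norm_num), Real.log_rpow hγ0]
    linarith

lemma four_lt (hp : 0 < p) (hQ : D.Q.PosDef ∨ D.Q = 0) (hproper : D.Proper)
    {βhat : EuclideanSpace ℝ (Fin p)} {d : ℝ} (hd : 4 / (1 - D.driftConst βhat) < d) :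
    4 < d * (1 - D.driftConst βhat) ∧ 0 < d := by
  have h1 : 0 < 1 - D.driftConst βhat := sub_pos.2 (driftConst_lt_one hp hQ hproper βhat)
  exact ⟨(div_lt_iff₀ h1).1 hd, (div_pos four_pos h1).trans hd⟩

lemma rate_lt_one (hp : 0 < p) (hQ : D.Q.PosDef ∨ D.Q = 0) (hproper : D.Proper)
    {βhat : EuclideanSpace ℝ (Fin p)} {d a : ℝ} (hd : 4 / (1 - D.driftConst βhat) < d)
    (ha : 0 < a) (ha1 : a < 1) (h : 0 < D.contractConst βhat d →
      Real.log 5 / (Real.log 5 - Real.log (D.contractConst βhat d)) < a) :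
    D.rate βhat d a < 1 := by
  have hS := posDef_Sig hQ hproper
  obtain ⟨h4, hd0⟩ := four_lt hp hQ hproper hd
  have hlam0 := driftConst_nonneg (D := D) βhat
  refine max_lt (rpow_mul_rpow_lt_one (contractConst_nonneg hp hQ hS βhat d)
    (contractConst_lt_one hp hQ hS βhat hd0.le) ha h) ?_
  refine Real.rpow_lt_one (by positivity) ?_ (sub_pos.2 ha1)
  rw [div_lt_one (by linarith)]
  linarith

/-- (λd + 5)/(d + 1) lies between λ and 1, and the exponent 1 - a < 1 only increases it. This lets
1/(1 - λ) be replaced by 1/(1 - ρ_a) in c(β), and shows ρ_a ≥ 0. -/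
lemma driftConst_le_rate (hp : 0 < p) (hQ : D.Q.PosDef ∨ D.Q = 0) (hproper : D.Proper)
    {βhat : EuclideanSpace ℝ (Fin p)} {d a : ℝ} (hd : 4 / (1 - D.driftConst βhat) < d)
    (ha : 0 < a) : D.driftConst βhat ≤ D.rate βhat d a := by
  obtain ⟨h4, hd0⟩ := four_lt hp hQ hproper hd
  have hlam0 := driftConst_nonneg (D := D) βhat
  have hlam1 := driftConst_lt_one hp hQ hproper βhat
  have hpos : 0 < (D.driftConst βhat * d + 5) / (d + 1) := by positivity
  refine le_trans ?_ (le_max_right _ _)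
  calc D.driftConst βhat ≤ (D.driftConst βhat * d + 5) / (d + 1) := by
        rw [le_div_iff₀ (by linarith)]; linarith
    _ = ((D.driftConst βhat * d + 5) / (d + 1)) ^ (1 : ℝ) := (Real.rpow_one _).symm
    _ ≤ _ := by
        refine Real.rpow_le_rpow_of_exponent_ge hpos ?_ (by linarith)
        rw [div_le_one (by linarith)]; linarith

lemma wasserstein_psi_le (hp : 0 < p) (hQ : D.Q.PosDef ∨ D.Q = 0) (hproper : D.Proper)
    {βhat : EuclideanSpace ℝ (Fin p)} (hfix : D.meanMap βhat = βhat) {d a : ℝ}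
    (hd : 4 / (1 - D.driftConst βhat) < d) (ha : 0 < a) (ha1 : a < 1)
    (hrate : D.rate βhat d a < 1) (β : EuclideanSpace ℝ (Fin p)) (m : ℕ) :
    wasserstein D.psi (kernelIter D.acKernel m β) D.posterior ≤
      ENNReal.ofReal (D.startConst βhat d a β * D.rate βhat d a ^ m) := by
  have hS := posDef_Sig hQ hproper
  have := isProbabilityMeasure_posterior hproper
  obtain ⟨h4, hd0⟩ := four_lt hp hQ hproper hd
  have hlam0 := driftConst_nonneg (D := D) βhat
  have hlam1 := driftConst_lt_one hp hQ hproper βhat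
  have hr := driftConst_le_rate hp hQ hproper hd ha
  have hpsi : Measurable fun z : EuclideanSpace ℝ (Fin p) × EuclideanSpace ℝ (Fin p) =>
      D.psi z.1 z.2 := (continuous_sigNorm hS).measurable.comp (measurable_fst.sub measurable_snd)
  have hF : Measurable fun q : ((Fin n → ℝ) × EuclideanSpace ℝ (Fin p)) ×
    EuclideanSpace ℝ (Fin p) => D.acStep q.1 q.2 := measurable_acStep
  have hW := wasserstein_kernelIter_le (P := noiseLaw n p) (F := D.acStep) (L := 2)
    (C := 2 * p) (ρ := D.rate βhat d a) (a := a) hF acKernel_eq_map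
    (posterior_bind_acKernel hQ hS) hpsi (continuous_driftV hS βhat).measurable
    (driftV_nonneg βhat) (by positivity) (psi_le hp hS βhat) hlam0 zero_le_two (by linarith)
    (lintegral_driftV_acStep_le hp hQ hproper hfix)
    (fun x y => by
      simpa using lintegral_psi_acStep_le hp hQ hS x y (c := 1)
        fun t _ => meanLip_le_one hp hQ hS _)
    (contractConst_nonneg hp hQ hS βhat d) hd0.le
    (fun x y hx hy => lintegral_psi_acStep_le hp hQ hS x y fun t ht =>
      le_csSup (bddAbove_meanLip hp hQ hS βhat d)
        (mem_image_of_mem _ (mem_smallBall_segment hp hS ht hx hy)))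
    ha.le ha1.le (by norm_num [rate]) (by norm_num [rate]) β m
  have hV0 := driftV_nonneg (D := D) βhat β
  have h2 : 0 ≤ 2 / (1 - D.driftConst βhat) := div_nonneg zero_le_two (by linarith)
  have hint : ∫⁻ y, ENNReal.ofReal (D.driftV βhat β + D.driftV βhat y + 1) ∂D.posterior ≤
      ENNReal.ofReal (D.driftV βhat β + 1 + 2 / (1 - D.driftConst βhat)) := by
    rw [ENNReal.ofReal_add (by linarith) h2]
    calc _ = ∫⁻ y, (ENNReal.ofReal (D.driftV βhat β + 1) + ENNReal.ofReal (D.driftV βhat y))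
          ∂D.posterior := by
          refine lintegral_congr fun y => ?_
          rw [← ENNReal.ofReal_add (by linarith) (driftV_nonneg _ _)]
          congr 1; ring
      _ = ENNReal.ofReal (D.driftV βhat β + 1) +
          ∫⁻ y, ENNReal.ofReal (D.driftV βhat y) ∂D.posterior := by
          rw [lintegral_add_left measurable_const, lintegral_const, measure_univ, mul_one]
      _ ≤ _ := by gcongr; exact lintegral_driftV_posterior_le hp hQ hproper hfix
  refine hW.trans ((mul_le_mul_right hint _).trans ?_)
  have hρ0 : 0 ≤ D.rate βhat d a := hlam0.trans hr
  rw [← ENNReal.ofReal_pow hρ0, ← ENNReal.ofReal_mul (by positivity),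
    ← ENNReal.ofReal_mul (by positivity)]
  refine ENNReal.ofReal_le_ofReal ?_
  -- The initial cost from the general bound is brought to the stated form by 1 + 2/(1 - λ) ≤ 3/(1 -
  -- λ) and λ ≤ ρ_a.
  have key : D.driftV βhat β + 1 + 2 / (1 - D.driftConst βhat) ≤
      ((D.driftConst βhat + 1) * D.driftV βhat β + 3) / (1 - D.rate βhat d a) := by
    have hl : 0 < 1 - D.driftConst βhat := by linarith
    have hρ : 0 < 1 - D.rate βhat d a := by linarith
    have e1 : 1 + 2 / (1 - D.driftConst βhat) ≤ 3 / (1 - D.rate βhat d a) := by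
      calc 1 + 2 / (1 - D.driftConst βhat) ≤ 3 / (1 - D.driftConst βhat) := by
            rw [le_div_iff₀ hl, add_mul, div_mul_cancel₀ _ hl.ne']; linarith
        _ ≤ _ := by gcongr
    have e2 : D.driftV βhat β ≤
        (D.driftConst βhat + 1) * D.driftV βhat β / (1 - D.rate βhat d a) := by
      rw [le_div_iff₀ hρ]; nlinarith [mul_nonneg hρ0 hV0, mul_nonneg hlam0 hV0]
    rw [add_div]; linarith
  rw [startConst]
  calc _ = 2 * p * (D.driftV βhat β + 1 + 2 / (1 - D.driftConst βhat)) *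
        D.rate βhat d a ^ m := by ring
    _ ≤ _ := by gcongr

lemma convergesGeometrically_psi (hp : 0 < p) (hQ : D.Q.PosDef ∨ D.Q = 0) (hproper : D.Proper)
    {βhat : EuclideanSpace ℝ (Fin p)} (hfix : D.meanMap βhat = βhat) :
    ConvergesGeometrically (wasserstein D.psi) D.acKernel D.posterior := by
  have hS := posDef_Sig hQ hproper
  set d := 4 / (1 - D.driftConst βhat) + 1
  have hd : 4 / (1 - D.driftConst βhat) < d := lt_add_one _
  obtain ⟨h4, hd0⟩ := four_lt hp hQ hproper hd
  have hγ0 := contractConst_nonneg hp hQ hS βhat d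
  have hγ1 := contractConst_lt_one hp hQ hS βhat hd0.le
  have h5 : 0 < Real.log 5 := Real.log_pos (by norm_num)
  obtain ⟨a, ha, ha1, h⟩ : ∃ a : ℝ, 0 < a ∧ a < 1 ∧ (0 < D.contractConst βhat d →
      Real.log 5 / (Real.log 5 - Real.log (D.contractConst βhat d)) < a) := by
    rcases hγ0.eq_or_lt with h0 | h0
    · exact ⟨1 / 2, by norm_num, by norm_num, fun h => absurd h0 h.ne⟩
    · have hlog := Real.log_neg h0 hγ1
      have hlt : Real.log 5 / (Real.log 5 - Real.log (D.contractConst βhat d)) < 1 := by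
        rw [div_lt_one (by linarith)]; linarith
      obtain ⟨a, h1, h2⟩ := exists_between hlt
      exact ⟨a, (div_pos h5 (by linarith)).trans h1, h2, fun _ => h1⟩
  have hrate := rate_lt_one hp hQ hproper hd ha ha1 h
  have hρ0 : 0 ≤ D.rate βhat d a :=
    (driftConst_nonneg βhat).trans (driftConst_le_rate hp hQ hproper hd ha)
  refine ⟨D.rate βhat d a, hρ0, hrate, fun β => (D.startConst βhat d a β).toNNReal, fun m β => ?_⟩
  refine (wasserstein_psi_le hp hQ hproper hfix hd ha ha1 hrate β m).trans
    (ENNReal.ofReal_le_ofReal ?_)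
  gcongr
  exact Real.le_coe_toNNReal _

end ProbitModel

/-! ### Transfer to the Euclidean distance and the final statement -/

lemma ConvergesGeometrically.of_le {E : Type*} [MeasurableSpace E] {ψ ψ' : E → E → ℝ}
    {K : Kernel E E} {π : Measure E} (h : ConvergesGeometrically (wasserstein ψ) K π) {C : ℝ≥0}
    (hC : 0 < C) (hle : ∀ x y, ψ' x y ≤ C * ψ x y) :
    ConvergesGeometrically (wasserstein ψ') K π := by
  obtain ⟨ρ, h0, h1, M, hM⟩ := h
  refine ⟨ρ, h0, h1, fun x => C * M x, fun m x => ?_⟩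
  refine (wasserstein_mono (NNReal.coe_pos.2 hC) hle _ _).trans
    ((mul_le_mul_right (hM m x) _).trans_eq ?_)
  rw [← ENNReal.ofReal_mul C.coe_nonneg, NNReal.coe_mul, mul_assoc]

end

theorem proposition4 {n p : ℕ} (hp : 0 < p) (D : ProbitModel n p)
    (hQ : D.Q.PosDef ∨ D.Q = 0) (hproper : D.Proper) :
    -- geometric convergence in the Wasserstein distances of the two metrics
    ConvergesGeometrically (wasserstein D.psi) D.acKernel D.posterior ∧
    ConvergesGeometrically (wasserstein fun β β' => dist β β') D.acKernel D.posterior ∧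
    -- the posterior density has a unique mode, for which the explicit bound holds
    ∃ βhat : EuclideanSpace ℝ (Fin p),
      (∀ β, β ≠ βhat → D.postDensity β < D.postDensity βhat) ∧
      BddAbove (D.driftRatios βhat) ∧ D.driftConst βhat < 1 ∧
      (∀ β, Integrable (D.localLip β) (unifLaw n)) ∧
      ∀ d : ℝ, 4 / (1 - D.driftConst βhat) < d →
        BddAbove (D.meanLip '' D.smallBall βhat d) ∧ D.contractConst βhat d < 1 ∧
        ∀ a : ℝ, 0 < a → a < 1 →
          (0 < D.contractConst βhat d →
            Real.log 5 / (Real.log 5 - Real.log (D.contractConst βhat d)) < a) →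
          D.rate βhat d a < 1 ∧
          ∀ (β : EuclideanSpace ℝ (Fin p)) (m : ℕ),
            wasserstein D.psi (kernelIter D.acKernel m β) D.posterior ≤
              ENNReal.ofReal (D.startConst βhat d a β * D.rate βhat d a ^ m) := by
  have hS := ProbitModel.posDef_Sig hQ hproper
  obtain ⟨βhat, hmax⟩ := ProbitModel.exists_isMax_logPost hp hQ hproper
  have hfix : D.meanMap βhat = βhat := ProbitModel.meanMap_eq_self hQ hS hmax
  have hψ := ProbitModel.convergesGeometrically_psi hp hQ hproper hfix
  obtain ⟨C, hC, hnorm⟩ := ProbitModel.exists_norm_le_sigNorm hS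
  -- C is only known to be nonnegative; adding 1 gives the strictly positive constant that `of_le`
  -- needs.
  refine ⟨hψ, hψ.of_le (C := C.toNNReal + 1) (by positivity) fun x y => ?_, βhat,
    fun β hβ => ProbitModel.postDensity_lt hp hQ hproper hfix hβ,
    ProbitModel.bddAbove_driftRatios hp hQ hproper βhat,
    ProbitModel.driftConst_lt_one hp hQ hproper βhat,
    ProbitModel.integrable_localLip hp hQ hS, fun d hd => ?_⟩
  · rw [dist_eq_norm, NNReal.coe_add, Real.coe_toNNReal _ hC, NNReal.coe_one, add_mul, one_mul]
    exact (hnorm _).trans (le_add_of_nonneg_right (ProbitModel.sigNorm_nonneg _))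
  · obtain ⟨-, hd0⟩ := ProbitModel.four_lt hp hQ hproper hd
    refine ⟨ProbitModel.bddAbove_meanLip hp hQ hS βhat d,
      ProbitModel.contractConst_lt_one hp hQ hS βhat hd0.le, fun a ha ha1 h => ?_⟩
    have hrate := ProbitModel.rate_lt_one hp hQ hproper hd ha ha1 h
    exact ⟨hrate, ProbitModel.wasserstein_psi_le hp hQ hproper hfix hd ha ha1 hrate⟩
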